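/- Let $H$ be an infinite-dimensional real Hilbert space and let $A:D(A)\to H$ be a positive definite self-adjoint operator with compact inverse, with eigenvalues $0<\lambda_1\le\lambda_2\le\cdots$ and a corresponding orthonormal basis $\{e_n\}$ of eigenvectors. For $s\in\mathbb R$ let $A^su=\sum_n\lambda_n^s(u,e_n)e_n$, and let $H^s=D(A^{s/2})$ be the completion of the finite linear combinations of the $e_n$ in the norm $\|u\|_{H^s}^2=\sum_n\lambda_n^s(u,e_n)^2$. Let $\gamma\ge0$, let $F:H\to H$ be globally bounded ($\sup_{v\in H}\|F(v)\|_H<\infty$) and globally Lipschitz continuous with constant $L$, and let $g\in H$. Consider the problem $$\partial_tA^{-\gamma}u+Au+F(u)=g,\qquad u|_{t=0}=u_0. \tag{$*$}$$ A function $u\in C([0,T];H^{-\gamma})\cap L^2(0,T;H^1)$ is a solution of the equation on $[0,T]$ if for every $\varphi\in C_0^\infty(0,T;H^2)$ $$-\int_0^T(u(t),A^{-\gamma}\partial_t\varphi(t))\,dt+\int_0^T(u(t),A\varphi(t))\,dt=\int_0^T(g-F(u(t)),\varphi(t))\,dt,$$ and a global solution if it is a solution on $[0,T]$ for every $T>0$.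 Then: 1. For every $u_0\in H^{-\gamma}$ problem $(*)$ has a global solution $u$, and two solutions on $[0,T]$ with the same initial value coincide on $[0,T]$. The operators $S(t):H^{-\gamma}\to H^{-\gamma}$, $S(t)u_0:=u(t)$, $t\ge0$, form a semigroup ($S(0)=\mathrm{Id}$, $S(t+s)=S(t)S(s)$), which is dissipative: for all $u_0\in H^{-\gamma}$ and $t\ge0$ $$\|u(t)\|^2_{H^{-\gamma}}+\|u\|^2_{L^2(t,t+1;H^1)}\le Ce^{-\alpha t}\|u_0\|^2_{H^{-\gamma}}+C(1+\|g\|_H^2).$$ 2. For any two global solutions $u_1,u_2$ of the equation and all $t\ge0$ $$\|u_1(t)-u_2(t)\|^2_{H^{-\gamma}}+\|u_1-u_2\|^2_{L^2(t,t+1;H^1)}\le C'\|u_1(0)-u_2(0)\|^2_{H^{-\gamma}}e^{L_\gamma t},$$ where the positive constants $C'$ and $L_\gamma$ depend only on $L$ and $\gamma$. 3. For all $u_0\in H^{-\gamma}$ and $t\in(0,1]$ one has $u(t)=S(t)u_0\in H^2$ and $$\|u(t)\|_{H^2}\le Ct^{-1}\big(\|u_0\|_{H^{-\gamma}}+\|g\|_H+1\big).$$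 If in addition $u_0\in H^2$, then for all $t\ge0$ one has $u(t)\in H^2$ and $$\|u(t)\|^2_{H^2}\le C\|u_0\|^2_{H^2}e^{-\alpha t}+C(1+\|g\|_H^2).$$ The positive constants $C$ and $\alpha$ in 1 and 3 depend only on $\gamma$, $A$ and $F$; in particular they do not depend on $t$, $u_0$ and $g$. -/

import Mathlib

open Set Filter Topology MeasureTheory
open scoped NNReal ENNReal ContDiff InnerProductSpace

universe u

/-- A positive definite self-adjoint (in general unbounded, densely defined) operator
`A : D(A) → H` with compact inverse in an infinite-dimensional real Hilbert space `H`. -/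
structure PosSelfAdjOp (H : Type u) [NormedAddCommGroup H] [InnerProductSpace ℝ H]
    [CompleteSpace H] where
  /-- the operator, with its domain -/
  op : H →ₗ.[ℝ] H
  /-- `A` is self-adjoint (in Mathlib this forces the domain to be dense) -/
  isSelfAdjoint : IsSelfAdjoint op
  /-- `A` is positive definite -/
  pos : ∀ x : op.domain, (x : H) ≠ 0 → 0 < ⟪op x, (x : H)⟫_ℝ
  /-- `A` has a compact inverse, defined on all of `H` -/
  compact_inverse : ∃ K : H →L[ℝ] H, IsCompactOperator K ∧
    (∀ f : H, ∃ hf : K f ∈ op.domain, op ⟨K f, hf⟩ = f) ∧ ∀ x : op.domain, K (op x) = (x : H)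
  /-- `H` is infinite-dimensional -/
  infinite_dim : ¬ FiniteDimensional ℝ H

/-- An infinite family of reals with finite sublevel sets can be enumerated by `ℕ` in
non-decreasing order. -/
theorem exists_monotone_enumeration {ι : Type*} [Infinite ι] (f : ι → ℝ)
    (hf : ∀ R : ℝ, {i | f i ≤ R}.Finite) : ∃ σ : ℕ ≃ ι, Monotone (f ∘ σ) := by
  classical
  let _ : LinearOrder ι := WellOrderingRel.isWellOrder.linearOrder
  let k : ι → Lex (ℝ × ι) := fun i => toLex (f i, i)
  have hk : Function.Injective k := fun i j h => by
    have := congrArg (fun p => (ofLex p).2) h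
    exact this
  have hkf : ∀ i j, k i ≤ k j → f i ≤ f j := fun i j h => by
    rcases (Prod.Lex.toLex_le_toLex.1 h) with h | h
    · exact h.le
    · exact h.1.le
  have hfin : ∀ i, {j | k j < k i}.Finite := fun i =>
    (hf (f i)).subset fun j hj => hkf j i (le_of_lt hj)
  let r : ι → ℕ := fun i => (hfin i).toFinset.card
  have hr : ∀ i j, k i < k j → r i < r j := fun i j h => by
    apply Finset.card_lt_card
    refine ⟨fun l hl => ?_, fun hsub => ?_⟩
    · simp only [Finite.mem_toFinset, mem_ofPred_eq] at hl ⊢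
      exact hl.trans h
    · have : i ∈ (hfin i).toFinset := hsub (by simpa using h)
      simp at this
  have hinj : Function.Injective r := fun i j h => by
    rcases lt_trichotomy (k i) (k j) with h1 | h1 | h1
    · exact absurd h (hr i j h1).ne
    · exact hk h1
    · exact absurd h (hr j i h1).ne'
  have hsurj : Function.Surjective r := fun n => by
    have hlow : {i | r i < n}.Finite :=
      (Set.finite_Iio n).preimage hinj.injOn
    obtain ⟨i₀, hi₀⟩ := hlow.infinite_compl.nonempty
    have hi₀' : n ≤ r i₀ := by simpa using hi₀
    have hsf : {j | n ≤ r j ∧ k j ≤ k i₀}.Finite :=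
      (hf (f i₀)).subset fun j hj => hkf j i₀ hj.2
    obtain ⟨x, hx, hmin⟩ := Set.exists_min_image _ k hsf ⟨i₀, hi₀', le_rfl⟩
    have hbelow : ∀ y, k y < k x → r y < n := fun y hy => by
      by_contra hcon
      exact absurd (hmin y ⟨not_lt.1 hcon, hy.le.trans hx.2⟩) (not_le.2 hy)
    refine ⟨x, le_antisymm ?_ hx.1⟩
    have : r x ≤ (Finset.range n).card := by
      refine Finset.card_le_card_of_injOn r (fun y hy => ?_) hinj.injOn
      simpa using hbelow y (by simpa using hy)
    simpa using this
  refine ⟨(Equiv.ofBijective r ⟨hinj, hsurj⟩).symm, fun m n hmn => ?_⟩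
  set e := Equiv.ofBijective r ⟨hinj, hsurj⟩ with he
  by_contra hcon
  have h1 : k (e.symm n) < k (e.symm m) := by
    by_contra h2
    exact hcon (hkf _ _ (not_lt.1 h2))
  have h2 := hr _ _ h1
  have h3 : ∀ l, r (e.symm l) = l := fun l => e.apply_symm_apply l
  rw [h3, h3] at h2
  omega

namespace PosSelfAdjOp

variable {H : Type u} [NormedAddCommGroup H] [InnerProductSpace ℝ H] [CompleteSpace H]
  (A : PosSelfAdjOp H)

/-- Spectral theorem: there is an orthonormal basis of `H` that consists of eigenvectors of `A`,
with positive eigenvalues enumerated in non-decreasing order and tending to infinity. -/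
theorem exists_eigenbasis : ∃ (e : HilbertBasis ℕ ℝ H) (lam : ℕ → ℝ), Monotone lam ∧
    (∀ n, 0 < lam n) ∧ Tendsto lam atTop atTop ∧
    ∀ n, ∃ hn : e n ∈ A.op.domain, A.op ⟨e n, hn⟩ = lam n • e n := by
  classical
  obtain ⟨K, hK, hAK, hKA⟩ := A.compact_inverse
  have hsym : ∀ x y : A.op.domain, ⟪A.op x, (y : H)⟫_ℝ = ⟪(x : H), A.op y⟫_ℝ := by
    have h := LinearPMap.adjoint_isFormalAdjoint A.isSelfAdjoint.dense_domain
    rw [show A.op.adjoint = A.op from A.isSelfAdjoint] at h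
    exact h
  have hKs : (K : H →ₗ[ℝ] H).IsSymmetric := fun f h => by
    obtain ⟨h1, h2⟩ := hAK f
    obtain ⟨h3, h4⟩ := hAK h
    have := hsym ⟨K f, h1⟩ ⟨K h, h3⟩
    rw [h2, h4] at this
    exact this.symm
  have hK0 : ∀ f, K f = 0 → f = 0 := fun f hf => by
    obtain ⟨h1, h2⟩ := hAK f
    rw [← h2, show (⟨K f, h1⟩ : A.op.domain) = 0 from Subtype.ext hf]
    exact A.op.toFun.map_zero
  let E : ℝ → Submodule ℝ H := fun μ => Module.End.eigenspace (K : H →ₗ[ℝ] H) μ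
  have hE0 : E 0 = ⊥ := by
    rw [Submodule.eq_bot_iff]
    intro x hx
    have : (K : H →ₗ[ℝ] H) x = (0 : ℝ) • x := Module.End.mem_eigenspace_iff.1 hx
    exact hK0 x (by simpa using this)
  have hfd : ∀ μ, FiniteDimensional ℝ (E μ) := fun μ => by
    by_cases h : μ = 0
    · subst h; rw [hE0]; infer_instance
    · exact ContinuousLinearMap.finite_dimensional_eigenspace hK μ h
  let b : ∀ μ, OrthonormalBasis (Fin (Module.finrank ℝ (E μ))) ℝ (E μ) :=
    fun μ => stdOrthonormalBasis ℝ (E μ)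
  let ι := Σ μ : ℝ, Fin (Module.finrank ℝ (E μ))
  let v : ι → H := fun i => (b i.1 i.2 : H)
  have hv : Orthonormal ℝ v :=
    hKs.orthogonalFamily_eigenspaces.orthonormal_sigma_orthonormal
      (v_family := fun μ => ⇑(b μ)) fun μ => (b μ).orthonormal
  have hKv : ∀ i : ι, K (v i) = i.1 • v i := fun i =>
    Module.End.mem_eigenspace_iff.1 (b i.1 i.2).2
  have hbot : (Submodule.span ℝ (Set.range v))ᗮ = ⊥ := by
    rw [eq_bot_iff, ← ContinuousLinearMap.orthogonalComplement_iSup_eigenspaces_eq_bot hK hKs]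
    apply Submodule.orthogonal_le
    refine iSup_le fun μ x hx => ?_
    have h1 := (b μ).sum_repr ⟨x, hx⟩
    have h2 : x = ∑ i, (b μ).repr ⟨x, hx⟩ i • v ⟨μ, i⟩ := by
      have := congrArg (Subtype.val) h1
      simpa [v] using this.symm
    rw [h2]
    exact Submodule.sum_mem _ fun i _ =>
      Submodule.smul_mem _ _ (Submodule.subset_span ⟨⟨μ, i⟩, rfl⟩)
  let B : HilbertBasis ι ℝ H := HilbertBasis.mkOfOrthogonalEqBot hv hbot
  have hB : ∀ i, B i = v i := fun i => by simp [B]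
  have hv0 : ∀ i, v i ≠ 0 := hv.ne_zero
  have hμ0 : ∀ i : ι, i.1 ≠ 0 := fun i h => hv0 i (hK0 _ (by rw [hKv, h, zero_smul]))
  have hAv : ∀ i, ∃ hi : v i ∈ A.op.domain, A.op ⟨v i, hi⟩ = (i.1)⁻¹ • v i := fun i => by
    obtain ⟨h1, h2⟩ := hAK ((i.1)⁻¹ • v i)
    have h3 : K ((i.1)⁻¹ • v i) = v i := by
      rw [map_smul, hKv, smul_smul, inv_mul_cancel₀ (hμ0 i), one_smul]
    exact ⟨h3 ▸ h1, (congrArg A.op (Subtype.ext h3.symm)).trans h2⟩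
  have hpos : ∀ i : ι, 0 < (i.1)⁻¹ := fun i => by
    obtain ⟨h1, h2⟩ := hAv i
    have h3 := A.pos ⟨v i, h1⟩ (hv0 i)
    rw [h2, inner_smul_left, real_inner_self_eq_norm_sq, hv.1 i] at h3
    simpa using h3
  have hfin : ∀ R : ℝ, {i : ι | (i.1)⁻¹ ≤ R}.Finite := fun R => by
    by_contra hinf
    have hinf : {i : ι | (i.1)⁻¹ ≤ R}.Infinite := hinf
    obtain ⟨i₀, hi₀⟩ := hinf.nonempty
    have hR : 0 < R := (hpos i₀).trans_le hi₀
    let s : ℕ → ι := fun n => (hinf.natEmbedding _ n : ι)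
    have hs : Function.Injective s :=
      Subtype.val_injective.comp (hinf.natEmbedding _).injective
    obtain ⟨Q, hQ, hQs⟩ := hK.image_closedBall_subset_compact 1
    obtain ⟨a, -, φ, hφ, hlim⟩ := hQ.tendsto_subseq (x := fun n => K (v (s n))) fun n =>
      hQs ⟨v (s n), by simp [hv.1], rfl⟩
    have hC := hlim.cauchySeq
    obtain ⟨N, hN⟩ := Metric.cauchySeq_iff.1 hC (R⁻¹) (inv_pos.2 hR)
    have h1 := hN N le_rfl (N + 1) (Nat.le_succ N)
    have hne : s (φ N) ≠ s (φ (N + 1)) := fun h =>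
      absurd (hφ (Nat.lt_succ_self N)) (by rw [hs h]; exact lt_irrefl _)
    set p := s (φ N) with hp
    set q := s (φ (N + 1)) with hq
    have hpR : (p.1)⁻¹ ≤ R := (hinf.natEmbedding _ (φ N)).2
    have h2 : ‖K (v p) - K (v q)‖ ^ 2 = p.1 ^ 2 + q.1 ^ 2 := by
      rw [hKv, hKv, @norm_sub_sq_real, norm_smul, norm_smul, hv.1, hv.1, inner_smul_left,
        inner_smul_right, hv.2 hne]
      simp
    have hp0 : 0 < p.1 := inv_pos.1 (hpos p)
    have h3 : R⁻¹ ≤ p.1 := by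
      rw [inv_le_comm₀ hR hp0]; exact hpR
    have h4 : ‖K (v p) - K (v q)‖ < R⁻¹ := by simpa [dist_eq_norm] using h1
    have h5 : 0 < R⁻¹ := inv_pos.2 hR
    nlinarith [norm_nonneg (K (v p) - K (v q)), sq_nonneg q.1]
  have : Infinite ι := by
    by_contra hcon
    rw [not_infinite_iff_finite] at hcon
    have := Fintype.ofFinite ι
    exact A.infinite_dim (B.toOrthonormalBasis.toBasis.finiteDimensional_of_finite)
  obtain ⟨σ, hσ⟩ := exists_monotone_enumeration (fun i : ι => (i.1)⁻¹) hfin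
  have hvσ : Orthonormal ℝ (v ∘ σ) := hv.comp σ σ.injective
  let e : HilbertBasis ℕ ℝ H := HilbertBasis.mkOfOrthogonalEqBot hvσ (by
    rw [σ.surjective.range_comp]; exact hbot)
  have he : ∀ n, e n = v (σ n) := fun n => by simp [e]
  refine ⟨e, fun n => ((σ n).1)⁻¹, hσ, fun n => hpos _, ?_, fun n => ?_⟩
  · refine tendsto_atTop_atTop_of_monotone hσ fun R => ?_
    by_contra! hcon
    have : (Set.univ : Set ℕ).Finite :=
      ((hfin R).preimage σ.injective.injOn).subset fun n _ => (hcon n).le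
    exact Set.infinite_univ this
  · rw [he]; exact hAv _

/-- The orthonormal basis `e_0, e_1, …` of eigenvectors of `A`. -/
noncomputable def eigenbasis : HilbertBasis ℕ ℝ H := A.exists_eigenbasis.choose

/-- The eigenvalues of `A`, enumerated (from index `0`) in non-decreasing order. -/
noncomputable def eigenvalue : ℕ → ℝ := A.exists_eigenbasis.choose_spec.choose

theorem eigenvalue_monotone : Monotone A.eigenvalue :=
  A.exists_eigenbasis.choose_spec.choose_spec.1

theorem eigenvalue_pos (n : ℕ) : 0 < A.eigenvalue n :=
  A.exists_eigenbasis.choose_spec.choose_spec.2.1 n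

theorem eigenvalue_tendsto : Tendsto A.eigenvalue atTop atTop :=
  A.exists_eigenbasis.choose_spec.choose_spec.2.2.1

theorem op_eigenbasis (n : ℕ) : ∃ hn : A.eigenbasis n ∈ A.op.domain,
    A.op ⟨A.eigenbasis n, hn⟩ = A.eigenvalue n • A.eigenbasis n :=
  A.exists_eigenbasis.choose_spec.choose_spec.2.2.2 n

/-- A formal Fourier series `∑ aₙ eₙ` is given by its coefficients `a : ℕ → ℝ`. It belongs to
`H^s` if `∑ λₙ^s aₙ² < ∞`. -/
def MemSob (s : ℝ) (a : ℕ → ℝ) : Prop :=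
  Summable fun n => A.eigenvalue n ^ s * a n ^ 2

theorem memSob_iff_memℓp (s : ℝ) (a : ℕ → ℝ) :
    A.MemSob s a ↔ Memℓp (fun n => A.eigenvalue n ^ (s / 2) * a n) 2 := by
  rw [memℓp_gen_iff (by norm_num)]
  refine summable_congr fun n => ?_
  have h := A.eigenvalue_pos n
  rw [ENNReal.toReal_ofNat, Real.rpow_two, Real.norm_eq_abs, sq_abs, mul_pow,
    ← Real.rpow_natCast (_ ^ _), ← Real.rpow_mul h.le]
  norm_num

/-- The formal Fourier series that belong to `H^s`, as a vector space. -/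
def sobSubmodule (s : ℝ) : Submodule ℝ (ℕ → ℝ) where
  carrier := {a | A.MemSob s a}
  zero_mem' := by simp [MemSob, summable_zero]
  add_mem' {a b} ha hb := by
    simp only [mem_ofPred_eq, memSob_iff_memℓp] at ha hb ⊢
    convert ha.add hb using 1
    funext n; simp [mul_add]
  smul_mem' c a ha := by
    simp only [mem_ofPred_eq, memSob_iff_memℓp] at ha ⊢
    convert ha.const_smul c using 1
    funext n; simp; ring

/-- The space `H^s = D(A^{s/2})`, for any real `s`: the completion of the finite linear
combinations of the `eₙ` in the norm `‖a‖² = ∑ λₙ^s aₙ²`, realized as the weighted `ℓ²` space of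
formal Fourier series. -/
def Sob (s : ℝ) : Type := A.sobSubmodule s

noncomputable instance (s : ℝ) : AddCommGroup (A.Sob s) :=
  inferInstanceAs (AddCommGroup (A.sobSubmodule s))

noncomputable instance (s : ℝ) : Module ℝ (A.Sob s) :=
  inferInstanceAs (Module ℝ (A.sobSubmodule s))

variable {A}

/-- The Fourier coefficients of an element of `H^s`. Elements of different spaces `H^s` are
identified if they have the same coefficients. -/
def coeff {s : ℝ} : A.Sob s →ₗ[ℝ] (ℕ → ℝ) := (A.sobSubmodule s).subtype

theorem memSob_coeff {s : ℝ} (x : A.Sob s) : A.MemSob s (coeff x) := x.2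

theorem coeff_injective {s : ℝ} : Function.Injective (coeff : A.Sob s → ℕ → ℝ) :=
  Subtype.val_injective

variable (A)

/-- The bijection `A^{s/2}` of `H^s` onto `ℓ²`. It carries the norm of `ℓ²` to that of `H^s`. -/
noncomputable def sobToL2 (s : ℝ) : A.Sob s →ₗ[ℝ] lp (fun _ : ℕ => ℝ) 2 where
  toFun x := ⟨fun n => A.eigenvalue n ^ (s / 2) * coeff x n,
    (A.memSob_iff_memℓp s _).1 (memSob_coeff x)⟩
  map_add' x y := by
    ext n
    change _ * coeff (x + y) n = _ * coeff x n + _ * coeff y n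
    rw [map_add, Pi.add_apply, mul_add]
  map_smul' c x := by
    ext n
    change _ * coeff (c • x) n = c * (_ * coeff x n)
    rw [map_smul, Pi.smul_apply, smul_eq_mul, mul_left_comm]

theorem sobToL2_injective (s : ℝ) : Function.Injective (A.sobToL2 s) := fun x y h => by
  apply coeff_injective
  funext n
  have h1 : A.eigenvalue n ^ (s / 2) * coeff x n = A.eigenvalue n ^ (s / 2) * coeff y n :=
    congrFun (congrArg Subtype.val h) n
  exact mul_left_cancel₀ (Real.rpow_pos_of_pos (A.eigenvalue_pos n) _).ne' h1

noncomputable instance (s : ℝ) : NormedAddCommGroup (A.Sob s) :=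
  NormedAddCommGroup.induced _ _ (A.sobToL2 s) (A.sobToL2_injective s)

noncomputable instance (s : ℝ) : NormedSpace ℝ (A.Sob s) :=
  NormedSpace.induced ℝ _ _ (A.sobToL2 s)

/-- The norm of `H^s` is the one it should be. -/
theorem Sob.norm_sq {s : ℝ} (x : A.Sob s) :
    ‖x‖ ^ 2 = ∑' n, A.eigenvalue n ^ s * coeff x n ^ 2 := by
  have h0 : ‖x‖ = ‖A.sobToL2 s x‖ := rfl
  have h1 := lp.norm_rpow_eq_tsum (p := 2) (by norm_num) (A.sobToL2 s x)
  rw [ENNReal.toReal_ofNat, Real.rpow_two] at h1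
  rw [h0, h1]
  refine tsum_congr fun n => ?_
  have h := A.eigenvalue_pos n
  change ‖A.eigenvalue n ^ (s / 2) * coeff x n‖ ^ (2 : ℝ) = _
  rw [Real.rpow_two, Real.norm_eq_abs, sq_abs, mul_pow,
    ← Real.rpow_natCast (_ ^ _), ← Real.rpow_mul h.le]
  norm_num

open Classical in
/-- A formal Fourier series regarded as an element of `H^r`; `0` if it does not belong
to `H^r`. -/
noncomputable def toSob (r : ℝ) (a : ℕ → ℝ) : A.Sob r :=
  if h : A.MemSob r a then (⟨a, h⟩ : A.sobSubmodule r) else 0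

open Classical in
/-- The element `∑ aₙ eₙ` of `H` given by a formal Fourier series; `0` if the series does not
converge in `H`, that is, if `∑ aₙ² = ∞`. -/
noncomputable def toH (a : ℕ → ℝ) : H :=
  if h : Memℓp a 2 then A.eigenbasis.repr.symm ⟨a, h⟩ else 0

/-- The fractional power `A^r`, acting on formal Fourier series. -/
noncomputable def power (r : ℝ) (a : ℕ → ℝ) : ℕ → ℝ := fun n => A.eigenvalue n ^ r * a n

/-- `u` is a solution, on the time interval `[0,T]`, of
`∂ₜ A^{-γ} u + A u + F(u) = g`, in the sense of distributions. The values of `u` outside `[0,T]`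
play no role. The second condition says that `u(t) ∈ H^1` for almost all `t`, so that all pairings
below are inner products of elements of `H` for almost all `t`. -/
structure IsSolution (γ : ℝ) (F : H → H) (g : H) (T : ℝ) (u : ℝ → A.Sob (-γ)) : Prop where
  /-- `u ∈ C([0,T]; H^{-γ})` -/
  continuousOn : ContinuousOn u (Icc 0 T)
  /-- `u ∈ L²(0,T; H^1)` -/
  ae_mem : ∀ᵐ t ∂volume.restrict (Ioo 0 T), A.MemSob 1 (coeff (u t))
  memLp : MemLp (fun t => A.toSob 1 (coeff (u t))) 2 (volume.restrict (Ioo 0 T))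
  /-- the equation, tested with all `φ ∈ C₀^∞(0,T; H²)` -/
  weak : ∀ φ : ℝ → A.Sob 2, ContDiff ℝ ∞ φ → HasCompactSupport φ → tsupport φ ⊆ Ioo 0 T →
    -(∫ t in Ioo 0 T, ⟪A.toH (coeff (u t)), A.toH (A.power (-γ) (coeff (deriv φ t)))⟫_ℝ)
      + ∫ t in Ioo 0 T, ⟪A.toH (coeff (u t)), A.toH (A.power 1 (coeff (φ t)))⟫_ℝ
      = ∫ t in Ioo 0 T, ⟪g - F (A.toH (coeff (u t))), A.toH (coeff (φ t))⟫_ℝ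

/-- `u` is a global solution: a solution on `[0,T]` for every `T > 0`. -/
def IsGlobalSolution (γ : ℝ) (F : H → H) (g : H) (u : ℝ → A.Sob (-γ)) : Prop :=
  ∀ T : ℝ, 0 < T → A.IsSolution γ F g T u

end PosSelfAdjOp

/-! In the eigenbasis the linear part decouples. With `μ = λ^(1+γ)` and `θ = γ/(1+γ) < 1`, the
coefficients solve `a' + μ a = μ^θ h`, where `h` holds the coefficients of `g - F(u)`. The Duhamel
kernel `μ^θ exp(-μτ)` is at most `τ^(-θ)`, an integrable singularity: the factor `A^γ` uses up the
fraction `θ` of the parabolic smoothing and leaves `1 - θ = 2δ`. In this scale `H^{-γ}` carries the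
weight `μ^(-θ/2)` and `H²` the weight `μ^(1-θ)`.

Existence is a fixed point for the forcing instead of for `u`. The forcing stays bounded in `H`
because `F` is bounded, whereas `u(t)` may blow up in `H` as `t → 0`. In a sup norm weighted by
`exp(-κt)` with `κ` large, the map is a contraction on all of `(0,∞)` (`exists_weight`,
`exists_forcing`). Weak and Duhamel solutions are the same: one direction is the lemma of du
Bois-Reymond with an integrating factor (`IsSolution.isMild`), the other a dominated passage to the
limit in the partial sums (`IsMild.isSolution`). All estimates are therefore proved for Duhamel
solutions.

Dissipation is the energy identity in `H^{-γ}`: the forcing is a bounded perturbation and the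
smallest eigenvalue gives the decay. For a difference `w` of two solutions the nonlinearity
contributes `2L‖w‖²` in `H`, which `le_interp` splits between the dissipated `H^1` norm and the
`H^{-γ}` norm with constants depending only on `L` and `γ`. Gronwall's inequality concludes.

For a forcing that is merely bounded, the last step to `H²` fails logarithmically, since `μ^(1-θ)
μ^θ exp(-μτ)` is only bounded by `1/τ`. But Duhamel's formula makes `u`, hence by the Lipschitz
condition also the forcing, Hölder continuous with exponent `δ` at positive times. Subtracting
`h(t)` under the integral restores integrability (`duhamel_smooth_bound`,
`semilinear_smooth_bound`). The estimate for data in `H²` combines a bound on the first unit of time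
with smoothing from `t - 1` to `t` and decay in `H^{-γ}`. -/

/-! ### Bounds for square-summable sequences -/

/-- The `ℓ²` norm of the sequence `x` is at most `B`. -/
def L2Bound (x : ℕ → ℝ) (B : ℝ) : Prop :=
  0 ≤ B ∧ ∀ N, ∑ n ∈ Finset.range N, x n ^ 2 ≤ B ^ 2

namespace L2Bound

variable {x y : ℕ → ℝ} {B C : ℝ}

theorem mono (h : L2Bound x B) (hBC : B ≤ C) : L2Bound x C :=
  ⟨h.1.trans hBC, fun N => (h.2 N).trans (pow_le_pow_left₀ h.1 hBC 2)⟩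

theorem summable (h : L2Bound x B) : Summable fun n => x n ^ 2 :=
  summable_of_sum_range_le (fun _ => sq_nonneg _) h.2

theorem tsum_le (h : L2Bound x B) : ∑' n, x n ^ 2 ≤ B ^ 2 :=
  h.summable.tsum_le_of_sum_range_le h.2

theorem of_tsum (hs : Summable fun n => x n ^ 2) (hB : 0 ≤ B) (h : ∑' n, x n ^ 2 ≤ B ^ 2) :
    L2Bound x B :=
  ⟨hB, fun _ => (hs.sum_le_tsum _ fun _ _ => sq_nonneg _).trans h⟩

theorem abs_le (h : L2Bound x B) (n : ℕ) : |x n| ≤ B := by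
  apply abs_le_of_sq_le_sq _ h.1
  refine le_trans ?_ (h.2 (n + 1))
  exact Finset.single_le_sum (f := fun n => x n ^ 2) (fun _ _ => sq_nonneg _)
    (Finset.self_mem_range_succ n)

/-- The Cauchy–Schwarz inequality for partial sums. -/
theorem sum_mul_le (hx : L2Bound x B) (hy : L2Bound y C) (N : ℕ) :
    ∑ n ∈ Finset.range N, x n * y n ≤ B * C := by
  have h := Finset.sum_mul_sq_le_sq_mul_sq (Finset.range N) x y
  have h1 := mul_le_mul (hx.2 N) (hy.2 N) (Finset.sum_nonneg fun _ _ => sq_nonneg _) (sq_nonneg B)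
  refine le_of_sq_le_sq ?_ (mul_nonneg hx.1 hy.1)
  rw [mul_pow]; exact h.trans h1

/-- The norm by duality, tested with `c = x` on the first `N` indices. Being linear in `x`, this
criterion is what makes the triangle inequality and its integral form immediate. -/
theorem of_sum_mul_le (hB : 0 ≤ B)
    (h : ∀ (c : ℕ → ℝ) (N : ℕ) (C : ℝ), 0 ≤ C → ∑ n ∈ Finset.range N, c n ^ 2 ≤ C ^ 2 →
      ∑ n ∈ Finset.range N, c n * x n ≤ C * B) : L2Bound x B := by
  refine ⟨hB, fun N => ?_⟩
  set S := ∑ n ∈ Finset.range N, x n ^ 2 with hS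
  have hS0 : 0 ≤ S := Finset.sum_nonneg fun _ _ => sq_nonneg _
  have h1 := h x N (√S) (Real.sqrt_nonneg _) (Real.sq_sqrt hS0).ge
  have h2 : S ≤ √S * B := by
    refine le_trans (le_of_eq ?_) h1
    exact Finset.sum_congr rfl fun _ _ => sq _
  have h3 := Real.sq_sqrt hS0
  rcases (Real.sqrt_nonneg S).eq_or_lt with h0 | h0
  · rw [← h0] at h3
    nlinarith [sq_nonneg B]
  · have : √S ≤ B := by
      by_contra! hcon
      nlinarith
    exact h3 ▸ pow_le_pow_left₀ h0.le this 2

theorem sum_mul_le' (hx : L2Bound x B) {c : ℕ → ℝ} {N : ℕ} (hC : 0 ≤ C)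
    (hc : ∑ n ∈ Finset.range N, c n ^ 2 ≤ C ^ 2) : ∑ n ∈ Finset.range N, c n * x n ≤ C * B := by
  have h := Finset.sum_mul_sq_le_sq_mul_sq (Finset.range N) c x
  have h1 := mul_le_mul hc (hx.2 N) (Finset.sum_nonneg fun _ _ => sq_nonneg _) (sq_nonneg C)
  refine le_of_sq_le_sq ?_ (mul_nonneg hC hx.1)
  rw [mul_pow]; exact h.trans h1

theorem add (hx : L2Bound x B) (hy : L2Bound y C) : L2Bound (fun n => x n + y n) (B + C) := by
  refine of_sum_mul_le (add_nonneg hx.1 hy.1) fun c N D hD hc => ?_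
  simp only [mul_add, Finset.sum_add_distrib]
  exact add_le_add (hx.sum_mul_le' hD hc) (hy.sum_mul_le' hD hc)

theorem mul (hx : L2Bound x B) {m : ℕ → ℝ} (hC : 0 ≤ C) (hm : ∀ n, |m n| ≤ C) :
    L2Bound (fun n => m n * x n) (C * B) := by
  refine ⟨mul_nonneg hC hx.1, fun N => ?_⟩
  rw [mul_pow]
  refine le_trans ?_ (mul_le_mul_of_nonneg_left (hx.2 N) (sq_nonneg C))
  rw [Finset.mul_sum]
  refine Finset.sum_le_sum fun n _ => ?_
  rw [mul_pow]
  refine mul_le_mul_of_nonneg_right ?_ (sq_nonneg _)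
  rw [← sq_abs]
  exact pow_le_pow_left₀ (abs_nonneg _) (hm n) 2

theorem neg (hx : L2Bound x B) : L2Bound (fun n => -x n) B := by
  simpa [L2Bound] using hx

theorem of_abs_le (hx : L2Bound x B) (h : ∀ n, |y n| ≤ |x n|) : L2Bound y B :=
  ⟨hx.1, fun N => (Finset.sum_le_sum fun n _ => sq_le_sq.2 (h n)).trans (hx.2 N)⟩

/-- Minkowski's integral inequality. -/
theorem intervalIntegral {f : ℝ → ℕ → ℝ} {β : ℝ → ℝ} {a b : ℝ} (hab : a ≤ b)
    (hf : ∀ n, AEStronglyMeasurable (fun s => f s n) (volume.restrict (Ioo a b)))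
    (hβ : IntervalIntegrable β volume a b) (h : ∀ s ∈ Ioo a b, L2Bound (f s) (β s)) :
    L2Bound (fun n => ∫ s in a..b, f s n) (∫ s in a..b, β s) := by
  have hβ0 : 0 ≤ ∫ s in a..b, β s := by
    rw [intervalIntegral.integral_of_le hab, integral_Ioc_eq_integral_Ioo]
    exact setIntegral_nonneg measurableSet_Ioo fun s hs => (h s hs).1
  have hβ' : IntegrableOn β (Ioo a b) volume := (hβ.1).mono_set Ioo_subset_Ioc_self
  have hint : ∀ n, IntegrableOn (fun s => f s n) (Ioo a b) volume := fun n => by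
    refine Integrable.mono' hβ' (hf n) ?_
    exact (ae_restrict_iff' measurableSet_Ioo).2 (ae_of_all _ fun s hs => (h s hs).abs_le n)
  -- By duality only a finite sum has to be exchanged with the integral.
  refine of_sum_mul_le hβ0 fun c N C hC hc => ?_
  simp only [intervalIntegral.integral_of_le hab, integral_Ioc_eq_integral_Ioo]
  simp only [← integral_const_mul]
  rw [← integral_finsetSum _ fun n _ => (hint n).const_mul _]
  refine setIntegral_mono_on (integrable_finsetSum _ fun n _ => (hint n).const_mul _)
    (hβ'.const_mul _) measurableSet_Ioo fun s hs => (h s hs).sum_mul_le' hC hc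

end L2Bound

/-! ### Elementary inequalities for the exponential -/

theorem Real.rpow_mul_exp_neg_le_one {x p : ℝ} (hx : 0 ≤ x) (hp : 0 ≤ p) (hp1 : p ≤ 1) :
    x ^ p * Real.exp (-x) ≤ 1 := by
  have h1 : x ^ p ≤ Real.exp x := by
    calc x ^ p ≤ (1 + x) ^ p := Real.rpow_le_rpow hx (by linarith) hp
      _ ≤ (1 + x) ^ (1 : ℝ) := Real.rpow_le_rpow_of_exponent_le (by linarith) hp1
      _ ≤ Real.exp x := by rw [Real.rpow_one]; linarith [Real.add_one_le_exp x]
  calc x ^ p * Real.exp (-x) ≤ Real.exp x * Real.exp (-x) := by gcongr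
    _ = 1 := by rw [← Real.exp_add]; simp

theorem Real.one_sub_exp_neg_le_rpow {x p : ℝ} (hx : 0 ≤ x) (hp : 0 ≤ p) (hp1 : p ≤ 1) :
    1 - Real.exp (-x) ≤ x ^ p := by
  rcases le_total x 1 with h | h
  · rcases hx.eq_or_lt with rfl | h0
    · simp [Real.rpow_nonneg]
    · calc 1 - Real.exp (-x) ≤ x := by linarith [Real.add_one_le_exp (-x)]
        _ = x ^ (1 : ℝ) := (Real.rpow_one x).symm
        _ ≤ x ^ p := Real.rpow_le_rpow_of_exponent_ge h0 h hp1
  · calc 1 - Real.exp (-x) ≤ 1 := by linarith [Real.exp_pos (-x)]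
      _ ≤ x ^ p := Real.one_le_rpow h hp

theorem Real.rpow_mul_exp_neg_mul_le {m t p : ℝ} (hm : 0 ≤ m) (ht : 0 < t) (hp : 0 ≤ p)
    (hp1 : p ≤ 1) : m ^ p * Real.exp (-m * t) ≤ t ^ (-p) := by
  have h := Real.rpow_mul_exp_neg_le_one (mul_nonneg hm ht.le) hp hp1
  rw [Real.mul_rpow hm ht.le] at h
  rw [Real.rpow_neg ht.le, ← one_div, le_div_iff₀ (Real.rpow_pos_of_pos ht p), neg_mul]
  linarith

/-! ### Integrals of powers -/

theorem intervalIntegrable_sub_rpow {p : ℝ} (hp : -1 < p) (s t : ℝ) :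
    IntervalIntegrable (fun r => (t - r) ^ p) volume s t := by
  have h := (intervalIntegral.intervalIntegrable_rpow' hp (a := t - s) (b := 0)).comp_sub_left t
  simpa using h

theorem integral_sub_rpow {p : ℝ} (hp : -1 < p) (s t : ℝ) :
    ∫ r in s..t, (t - r) ^ p = (t - s) ^ (p + 1) / (p + 1) := by
  rw [intervalIntegral.integral_comp_sub_left (fun x => x ^ p) t, sub_self,
    integral_rpow (Or.inl hp), Real.zero_rpow (by linarith), sub_zero]

/-! ### Duhamel's formula for a diagonal parabolic equation -/

/-- The coefficients at time `t` of the solution of `aₙ' + μₙ aₙ = μₙ^θ hₙ` that starts at `a`. -/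
noncomputable def duhamel (μ : ℕ → ℝ) (θ : ℝ) (a : ℕ → ℝ) (h : ℝ → ℕ → ℝ) (t : ℝ) (n : ℕ) : ℝ :=
  Real.exp (-μ n * t) * a n + ∫ s in (0)..t, μ n ^ θ * Real.exp (-μ n * (t - s)) * h s n

/-- `h` is measurable on `(0,T]`, with values bounded by `G` in `ℓ²`. -/
structure BoundedForcing (T G : ℝ) (h : ℝ → ℕ → ℝ) : Prop where
  meas : ∀ n, AEStronglyMeasurable (fun s => h s n) (volume.restrict (Ioc 0 T))
  bound : ∀ s ∈ Ioc 0 T, L2Bound (h s) G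

namespace BoundedForcing

variable {μ : ℕ → ℝ} {θ T G : ℝ} {a : ℕ → ℝ} {h : ℝ → ℕ → ℝ}

theorem nonneg (hh : BoundedForcing T G h) (hT : 0 < T) : 0 ≤ G := (hh.bound T ⟨hT, le_rfl⟩).1

theorem intervalIntegrable (hh : BoundedForcing T G h) (n : ℕ) {s t : ℝ} (hs : 0 ≤ s)
    (hst : s ≤ t) (ht : t ≤ T) : IntervalIntegrable (fun r => h r n) volume s t := by
  rw [intervalIntegrable_iff_integrableOn_Ioc_of_le hst]
  refine IntegrableOn.mono_set (t := Ioc 0 T) ?_ (Ioc_subset_Ioc hs ht)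
  refine Integrable.mono' (g := fun _ => G) (integrable_const _) (hh.meas n) ?_
  exact (ae_restrict_iff' measurableSet_Ioc).2 (ae_of_all _ fun s hs => (hh.bound s hs).abs_le n)

theorem meas_kernel (hh : BoundedForcing T G h) {k : ℝ → ℝ} (hk : Continuous k) (n : ℕ) {s t : ℝ}
    (hs : 0 ≤ s) (ht : t ≤ T) :
    AEStronglyMeasurable (fun r => k r * h r n) (volume.restrict (Ioo s t)) :=
  (hk.aestronglyMeasurable).mul ((hh.meas n).mono_set
    (Ioo_subset_Ioc_self.trans (Ioc_subset_Ioc hs ht)))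

/-- The general estimate of a Duhamel integral. -/
theorem integral_bound (hh : BoundedForcing T G h) {k : ℝ → ℕ → ℝ} (hk : ∀ n, Continuous (k · n))
    {s t : ℝ} (hs : 0 ≤ s) (hst : s ≤ t) (ht : t ≤ T) {β : ℝ → ℝ}
    (hβ : IntervalIntegrable β volume s t) (hkβ : ∀ r ∈ Ioo s t, ∀ n, |k r n| ≤ β r) :
    L2Bound (fun n => ∫ r in s..t, k r n * h r n) ((∫ r in s..t, β r) * G) := by
  rw [← intervalIntegral.integral_mul_const]
  refine L2Bound.intervalIntegral hst (fun n => hh.meas_kernel (hk n) n hs ht)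
    (hβ.mul_const G) fun r hr => ?_
  exact (hh.bound r ⟨hs.trans_lt hr.1, hr.2.le.trans ht⟩).mul
    ((abs_nonneg _).trans (hkβ r hr 0)) (hkβ r hr)

theorem integral_rpow_bound (hh : BoundedForcing T G h) {k : ℝ → ℕ → ℝ}
    (hk : ∀ n, Continuous (k · n)) {s t p c : ℝ} (hs : 0 ≤ s) (hst : s ≤ t) (ht : t ≤ T)
    (hp : -1 < p) (hkβ : ∀ r ∈ Ioo s t, ∀ n, |k r n| ≤ c * (t - r) ^ p) :
    L2Bound (fun n => ∫ r in s..t, k r n * h r n) (c * ((t - s) ^ (p + 1) / (p + 1)) * G) := by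
  have := hh.integral_bound hk hs hst ht
    ((intervalIntegrable_sub_rpow hp s t).const_mul c) hkβ
  rwa [intervalIntegral.integral_const_mul, integral_sub_rpow hp] at this

variable (hμ : ∀ n, 0 < μ n) (hθ0 : 0 ≤ θ) (hθ1 : θ < 1)
include hμ hθ0 hθ1

/-- The maximum of `m^θ exp(-mτ)` over `m > 0` scales like `τ^(-θ)`. It is integrable in time
because `θ < 1`, and the bound is uniform over all modes. -/
theorem kernel_bound {τ : ℝ} (hτ : 0 < τ) (n : ℕ) :
    |μ n ^ θ * Real.exp (-μ n * τ)| ≤ τ ^ (-θ) := by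
  have h0 := Real.rpow_nonneg (hμ n).le θ
  rw [abs_of_nonneg (mul_nonneg h0 (Real.exp_pos _).le)]
  exact Real.rpow_mul_exp_neg_mul_le (hμ n).le hτ hθ0 hθ1.le

omit hθ0 in
/-- The Duhamel integral is bounded in every `ℓ²` space between `ℓ²` and the one with weight
`μ^{-2p}`, where `p ≤ θ`. -/
theorem duhamel_integral_bound (hh : BoundedForcing T G h) {t p : ℝ} (ht0 : 0 ≤ t) (ht : t ≤ T)
    (hp0 : 0 ≤ p) (hp : p ≤ θ) :
    L2Bound (fun n => μ n ^ (-p) * ∫ s in (0)..t, μ n ^ θ * Real.exp (-μ n * (t - s)) * h s n)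
      (t ^ (1 - (θ - p)) / (1 - (θ - p)) * G) := by
  simp only [← intervalIntegral.integral_const_mul, ← mul_assoc]
  have := hh.integral_rpow_bound (k := fun s n => μ n ^ (-p) * μ n ^ θ * Real.exp (-μ n * (t - s)))
    (fun n => by fun_prop) (p := -(θ - p)) (c := 1) le_rfl ht0 ht (by linarith)
    (fun r hr n => by
      rw [← Real.rpow_add (hμ n), one_mul, neg_add_eq_sub]
      exact kernel_bound hμ (by linarith) (by linarith) (sub_pos.2 hr.2) n)
  convert this using 1
  rw [sub_zero, one_mul, neg_add_eq_sub]

/-- Data with weight `μ^(-θ/2)` become square-summable at the price `t^(-θ/2)`. The Duhamel term is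
handled by the case `p = 0` of `duhamel_integral_bound`. -/
theorem duhamel_bound (hh : BoundedForcing T G h) {t N : ℝ} (ht0 : 0 < t) (ht : t ≤ T)
    (ha : L2Bound (fun n => μ n ^ (-(θ / 2)) * a n) N) :
    L2Bound (duhamel μ θ a h t) (t ^ (-(θ / 2)) * N + t ^ (1 - θ) / (1 - θ) * G) := by
  have h1 := ha.mul (m := fun n => μ n ^ (θ / 2) * Real.exp (-μ n * t))
    (Real.rpow_nonneg ht0.le (-(θ / 2))) fun n =>
      kernel_bound hμ (by linarith) (by linarith) ht0 n
  have h2 := duhamel_integral_bound hμ hθ1 hh ht0.le ht le_rfl hθ0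
  simp only [neg_zero, Real.rpow_zero, one_mul, sub_zero] at h2
  convert h1.add h2 using 2 with n
  rw [duhamel]
  congr 1
  rw [Real.rpow_neg (hμ n).le]
  have := (Real.rpow_pos_of_pos (hμ n) (θ / 2)).ne'
  field_simp

omit hμ hθ0 hθ1 in
-- Splitting the integral at `s` and factoring `exp(-μ(t-s))` out of the first piece; the semigroup
-- law and Hölder continuity both rest on this.
theorem duhamel_restart (hh : BoundedForcing T G h) {s t : ℝ} (hs : 0 ≤ s) (hst : s ≤ t)
    (ht : t ≤ T) (n : ℕ) :
    duhamel μ θ a h t n = Real.exp (-μ n * (t - s)) * duhamel μ θ a h s n +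
      ∫ r in s..t, μ n ^ θ * Real.exp (-μ n * (t - r)) * h r n := by
  have hi : ∀ x y, 0 ≤ x → x ≤ y → y ≤ T → IntervalIntegrable
      (fun r => μ n ^ θ * Real.exp (-μ n * (t - r)) * h r n) volume x y := fun x y hx hxy hy =>
    (hh.intervalIntegrable n hx hxy hy).continuousOn_mul (by fun_prop)
  rw [duhamel, duhamel, ← intervalIntegral.integral_add_adjacent_intervals
    (hi 0 s le_rfl hs (hst.trans ht)) (hi s t hs hst ht), mul_add, ← mul_assoc, ← Real.exp_add,
    ← add_assoc, ← intervalIntegral.integral_const_mul]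
  congr 2
  · congr 2; ring
  · refine intervalIntegral.integral_congr fun r _ => ?_
    rw [show -μ n * (t - r) = -μ n * (t - s) + -μ n * (s - r) by ring, Real.exp_add]
    ring

/-- Hölder continuity in time. -/
theorem duhamel_sub_bound (hh : BoundedForcing T G h) {s t ρ δ : ℝ} (hδ0 : 0 < δ)
    (hδ : 2 * δ = 1 - θ) (hs : 0 < s) (hst : s ≤ t) (ht : t ≤ T)
    (ha : L2Bound (fun n => μ n ^ δ * Real.exp (-μ n * s) * a n) ρ) :
    L2Bound (fun n => duhamel μ θ a h t n - duhamel μ θ a h s n)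
      ((t - s) ^ δ * (ρ + (s ^ δ / δ + (t - s) ^ δ / (2 * δ)) * G)) := by
  have hτ : 0 ≤ t - s := sub_nonneg.2 hst
  -- Time regularity is traded for `δ` powers of `μ`: `1 - exp(-μτ) ≤ (μτ)^δ`.
  have hm : ∀ n, |-(1 - Real.exp (-μ n * (t - s)))| ≤ (t - s) ^ δ * μ n ^ δ := fun n => by
    have h0 := mul_nonneg (hμ n).le hτ
    have h1 := Real.one_sub_exp_neg_le_rpow h0 hδ0.le (by linarith)
    have h2 : Real.exp (-(μ n * (t - s))) ≤ 1 := Real.exp_le_one_iff.2 (by linarith)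
    rw [Real.mul_rpow (hμ n).le hτ] at h1
    rw [abs_neg, neg_mul, abs_of_nonneg (by linarith)]
    linarith
  have hpos : ∀ n, 0 < μ n ^ δ := fun n => Real.rpow_pos_of_pos (hμ n) δ
  have hτδ : 0 ≤ (t - s) ^ δ := Real.rpow_nonneg hτ _
  have hm' : ∀ n, |-(1 - Real.exp (-μ n * (t - s))) * (μ n ^ δ)⁻¹| ≤ (t - s) ^ δ := fun n => by
    rw [abs_mul, abs_of_pos (inv_pos.2 (hpos n)), ← div_eq_mul_inv, div_le_iff₀ (hpos n)]
    exact hm n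
  -- Three contributions: the data at time `s` (`h1`), the forcing before `s` (`h2`) and the forcing
  -- between `s` and `t` (`h3`). In `h2` the kernel has exponent `θ + δ`, still below `1` because `θ
  -- + 2δ = 1`.
  have h1 := ha.mul hτδ hm'
  have h2 := (hh.integral_rpow_bound (k := fun r n => μ n ^ δ * (μ n ^ θ *
    Real.exp (-μ n * (s - r)))) (fun n => by fun_prop) (p := -(θ + δ)) (c := 1) le_rfl hs.le
    (hst.trans ht) (by linarith) (fun r hr n => by
      rw [← mul_assoc, ← Real.rpow_add (hμ n), one_mul, add_comm δ θ]
      exact kernel_bound hμ (by linarith) (by linarith) (sub_pos.2 hr.2) n)).mul hτδ hm'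
  have h3 := hh.integral_rpow_bound (k := fun r n => μ n ^ θ * Real.exp (-μ n * (t - r)))
    (fun n => by fun_prop) (p := -θ) (c := 1) hs.le hst ht (by linarith) (fun r hr n => by
      rw [one_mul]
      exact kernel_bound hμ hθ0 hθ1 (sub_pos.2 hr.2) n)
  convert (h1.add h2).add h3 using 1
  · funext n
    rw [duhamel_restart hh hs.le hst ht n, add_sub_right_comm]
    congr 1
    rw [duhamel]
    simp only [mul_assoc (μ n ^ δ)]
    rw [intervalIntegral.integral_const_mul]
    have := (hpos n).ne'
    field_simp
    ring
  · rw [show -(θ + δ) + 1 = δ by linarith, show -θ + 1 = δ + δ by linarith, sub_zero,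
      Real.rpow_add_of_nonneg hτ hδ0.le hδ0.le]
    ring

omit hθ0 hθ1 in
/-- The bound in the domain of `μ^{1-θ}`, if `h` is Hölder continuous at `t`. -/
theorem duhamel_smooth_bound (hh : BoundedForcing T G h) {t R : ℝ} (ht0 : 0 < t) (ht : t ≤ T)
    {β : ℝ → ℝ} (hβ : IntervalIntegrable β volume 0 t)
    (ha : L2Bound (fun n => μ n ^ (1 - θ) * (Real.exp (-μ n * t) * a n)) R)
    (hhβ : ∀ s ∈ Ioo 0 t, L2Bound (fun n => h s n - h t n) ((t - s) * β s)) :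
    L2Bound (fun n => μ n ^ (1 - θ) * duhamel μ θ a h t n) (R + (∫ s in (0)..t, β s) + G) := by
  -- The weight `μ^(1-θ)` turns the kernel into `μ exp(-μ(t-s))`, of size `1/(t-s)`. Writing `h(s) =
  -- (h(s) - h(t)) + h(t)`, the factor `t - s` in the hypothesis compensates this singularity, and
  -- the constant part integrates exactly to `(1 - exp(-μt)) h(t)`.
  have h2 := L2Bound.intervalIntegral (a := 0) (b := t)
    (f := fun s n => μ n * Real.exp (-μ n * (t - s)) * (h s n - h t n)) ht0.le
    (fun n => by
      have h1 := hh.meas_kernel (k := fun s => μ n * Real.exp (-μ n * (t - s))) (by fun_prop) n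
        le_rfl ht
      have h2 : AEStronglyMeasurable (fun s => μ n * Real.exp (-μ n * (t - s)) * h t n)
        (volume.restrict (Ioo 0 t)) := Continuous.aestronglyMeasurable (by fun_prop)
      exact (h1.sub h2).congr (ae_of_all _ fun s => (mul_sub _ _ _).symm)) hβ
    (fun s hs => by
      have hts : 0 < t - s := sub_pos.2 hs.2
      have := (hhβ s hs).mul (m := fun n => μ n * Real.exp (-μ n * (t - s)))
        (C := (t - s)⁻¹) (inv_nonneg.2 hts.le) (fun n => by
          have := Real.rpow_mul_exp_neg_mul_le (hμ n).le hts zero_le_one le_rfl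
          rw [Real.rpow_one, Real.rpow_neg_one] at this
          rwa [abs_of_nonneg (mul_nonneg (hμ n).le (Real.exp_pos _).le)])
      rwa [inv_mul_cancel_left₀ hts.ne'] at this)
  have h3 := (hh.bound t ⟨ht0, ht⟩).mul (m := fun n => 1 - Real.exp (-μ n * t)) zero_le_one
    (fun n => by
      have h2 : Real.exp (-μ n * t) ≤ 1 :=
        Real.exp_le_one_iff.2 (by nlinarith [mul_pos (hμ n) ht0])
      have := Real.exp_pos (-μ n * t)
      rw [abs_le]; constructor <;> linarith)
  rw [one_mul] at h3
  convert (ha.add h2).add h3 using 2 with n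
  have hi : IntervalIntegrable (fun s => μ n * Real.exp (-μ n * (t - s)) * h s n) volume 0 t :=
    (hh.intervalIntegrable n le_rfl ht0.le ht).continuousOn_mul (by fun_prop)
  have hexp : ∫ s in (0)..t, μ n * Real.exp (-μ n * (t - s)) = 1 - Real.exp (-μ n * t) := by
    rw [intervalIntegral.integral_eq_sub_of_hasDerivAt
      (f := fun s => Real.exp (-μ n * (t - s)))]
    · simp
    · intro s _
      have := (((hasDerivAt_id s).const_sub t).const_mul (-μ n)).exp
      refine this.congr_deriv ?_
      simp only [id]
      ring
    · exact (Continuous.intervalIntegrable (by fun_prop) _ _)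
  rw [duhamel, mul_add, add_assoc]
  congr 1
  simp only [show ∀ s, μ n * Real.exp (-μ n * (t - s)) * (h s n - h t n) =
    μ n * Real.exp (-μ n * (t - s)) * h s n - μ n * Real.exp (-μ n * (t - s)) * h t n from
    fun s => mul_sub _ _ _]
  rw [intervalIntegral.integral_sub hi (Continuous.intervalIntegrable (by fun_prop) _ _),
    intervalIntegral.integral_mul_const, hexp, sub_add_cancel,
    ← intervalIntegral.integral_const_mul]
  refine intervalIntegral.integral_congr fun r _ => ?_
  rw [← mul_assoc, ← mul_assoc, ← Real.rpow_add (hμ n), sub_add_cancel, Real.rpow_one]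

/-- Smoothing for a forcing term that depends on the solution in a Lipschitz way. -/
theorem semilinear_smooth_bound (hh : BoundedForcing T G h) {L t δ σ N R : ℝ} (hL : 0 ≤ L)
    (hδ0 : 0 < δ) (hδ : 2 * δ = 1 - θ) (hσ0 : 0 ≤ σ) (hσ1 : σ < 1) (ht0 : 0 < t) (ht : t ≤ T)
    (hN : 0 ≤ N)
    (ha : ∀ s ∈ Ioo 0 t, L2Bound (fun n => μ n ^ δ * Real.exp (-μ n * s) * a n) (s ^ (-σ) * N))
    (haR : L2Bound (fun n => μ n ^ (1 - θ) * (Real.exp (-μ n * t) * a n)) R)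
    (hlip : ∀ s ∈ Ioo 0 t, ∀ D,
      L2Bound (fun n => duhamel μ θ a h t n - duhamel μ θ a h s n) D →
      L2Bound (fun n => h s n - h t n) (L * D)) :
    L2Bound (fun n => μ n ^ (1 - θ) * duhamel μ θ a h t n)
      (R + L * (N * ((t / 2) ^ (δ - 1) * (t ^ (1 - σ) / (1 - σ)) + (t / 2) ^ (-σ) * (t ^ δ / δ))
        + 2 / δ * t ^ δ * G * (t ^ δ / δ)) + G) := by
  have hG := hh.nonneg (ht0.trans_le ht)
  have i1 := (intervalIntegral.intervalIntegrable_rpow' (a := 0) (b := t) (r := -σ)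
    (by linarith)).const_mul ((t / 2) ^ (δ - 1))
  have i2 := (intervalIntegrable_sub_rpow (p := δ - 1) (by linarith) 0 t).const_mul
    ((t / 2) ^ (-σ))
  have i3 := (intervalIntegrable_sub_rpow (p := δ - 1) (by linarith) 0 t).const_mul
    (2 / δ * t ^ δ * G)
  -- The Hölder bound of the solution passes to the forcing through `hlip`. One factor `t - s` is
  -- then split off from `(t-s)^δ`, leaving the integrable `(t-s)^(δ-1)`.
  have h := duhamel_smooth_bound hμ hh ht0 ht
    ((((i1.add i2).const_mul N).add i3).const_mul L) haR (fun s hs => by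
      have hts : 0 < t - s := sub_pos.2 hs.2
      have h1 := hlip s hs _ (duhamel_sub_bound hμ hθ0 hθ1 hh hδ0 hδ hs.1 hs.2.le ht (ha s hs))
      refine h1.mono ?_
      have e1 : (t - s) ^ δ = (t - s) * (t - s) ^ (δ - 1) := by
        rw [Real.rpow_sub_one hts.ne']; field_simp
      have h0 : 0 ≤ (t - s) ^ (δ - 1) := Real.rpow_nonneg hts.le _
      -- The singularities at `s = 0` and `s = t` are separated at the midpoint: on each half one of
      -- the two factors is bounded by its value at `t/2`.
      have e2 : (t - s) ^ (δ - 1) * s ^ (-σ) ≤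
          (t / 2) ^ (δ - 1) * s ^ (-σ) + (t / 2) ^ (-σ) * (t - s) ^ (δ - 1) := by
        have p1 := Real.rpow_nonneg hs.1.le (-σ)
        have p2 := Real.rpow_nonneg (half_pos ht0).le (-σ)
        have p3 := Real.rpow_nonneg (half_pos ht0).le (δ - 1)
        rcases le_total s (t / 2) with hc | hc
        · have : (t - s) ^ (δ - 1) ≤ (t / 2) ^ (δ - 1) :=
            Real.rpow_le_rpow_of_nonpos (half_pos ht0) (by linarith) (by linarith)
          have := mul_le_mul_of_nonneg_right this p1
          have := mul_nonneg p2 h0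
          linarith
        · have : s ^ (-σ) ≤ (t / 2) ^ (-σ) :=
            Real.rpow_le_rpow_of_nonpos (half_pos ht0) hc (by linarith)
          have := mul_le_mul_of_nonneg_left this h0
          have := mul_nonneg p3 p1
          linarith
      have e3 : s ^ δ / δ + (t - s) ^ δ / (2 * δ) ≤ 2 / δ * t ^ δ := by
        have q1 : s ^ δ ≤ t ^ δ := Real.rpow_le_rpow hs.1.le hs.2.le hδ0.le
        have q2 : (t - s) ^ δ ≤ t ^ δ := Real.rpow_le_rpow hts.le (by linarith [hs.1]) hδ0.le
        have q3 := Real.rpow_nonneg ht0.le δ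
        rw [show 2 / δ * t ^ δ = t ^ δ / δ + 2 * t ^ δ / (2 * δ) by field_simp; ring]
        gcongr
        linarith
      have e4 := mul_le_mul_of_nonneg_left e2 hN
      have e5 := mul_le_mul_of_nonneg_left (mul_le_mul_of_nonneg_right e3 hG) h0
      calc L * ((t - s) ^ δ * (s ^ (-σ) * N + (s ^ δ / δ + (t - s) ^ δ / (2 * δ)) * G))
          = L * ((t - s) * (t - s) ^ (δ - 1) *
            (s ^ (-σ) * N + (s ^ δ / δ + (t - s) ^ δ / (2 * δ)) * G)) := by rw [← e1]
        _ = (t - s) * (L * (N * ((t - s) ^ (δ - 1) * s ^ (-σ)) +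
            (t - s) ^ (δ - 1) * ((s ^ δ / δ + (t - s) ^ δ / (2 * δ)) * G))) := by ring
        _ ≤ (t - s) * (L * (N * ((t / 2) ^ (δ - 1) * s ^ (-σ) +
            (t / 2) ^ (-σ) * (t - s) ^ (δ - 1)) +
            (t - s) ^ (δ - 1) * ((2 / δ * t ^ δ) * G))) := by gcongr
        _ = _ := by ring)
  convert h using 3
  rw [intervalIntegral.integral_const_mul, intervalIntegral.integral_add ((i1.add i2).const_mul N) i3,
    intervalIntegral.integral_const_mul, intervalIntegral.integral_add i1 i2,
    intervalIntegral.integral_const_mul, intervalIntegral.integral_const_mul,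
    intervalIntegral.integral_const_mul, integral_sub_rpow (by linarith), integral_rpow
    (Or.inl (by linarith)), Real.zero_rpow (by linarith), neg_add_eq_sub, sub_add_cancel,
    sub_zero, sub_zero]

end BoundedForcing

namespace PosSelfAdjOp

/-! ### Sequences of Fourier coefficients -/

section Coefficients

variable {H : Type u} [NormedAddCommGroup H] [InnerProductSpace ℝ H] [CompleteSpace H]
  (A : PosSelfAdjOp H)

theorem eigenvalue_zero_le (n : ℕ) : A.eigenvalue 0 ≤ A.eigenvalue n :=
  A.eigenvalue_monotone n.zero_le

theorem rpow_half_mul_sq (s : ℝ) (a : ℕ → ℝ) (n : ℕ) :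
    (A.eigenvalue n ^ (s / 2) * a n) ^ 2 = A.eigenvalue n ^ s * a n ^ 2 := by
  rw [mul_pow, ← Real.rpow_natCast (_ ^ _), ← Real.rpow_mul (A.eigenvalue_pos n).le]
  norm_num

variable {A}

theorem l2Bound_coeff {s : ℝ} (x : A.Sob s) :
    L2Bound (fun n => A.eigenvalue n ^ (s / 2) * coeff x n) ‖x‖ := by
  refine L2Bound.of_tsum ?_ (norm_nonneg x) ?_
  · simp only [rpow_half_mul_sq]; exact memSob_coeff x
  · simp only [rpow_half_mul_sq]; exact (Sob.norm_sq A x).ge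

theorem MemSob.of_l2Bound {s B : ℝ} {a : ℕ → ℝ}
    (h : L2Bound (fun n => A.eigenvalue n ^ (s / 2) * a n) B) : A.MemSob s a := by
  have := h.summable
  simp only [rpow_half_mul_sq] at this
  exact this

theorem coeff_toSob {s : ℝ} {a : ℕ → ℝ} (h : A.MemSob s a) : coeff (A.toSob s a) = a := by
  have : A.toSob s a = (⟨a, h⟩ : A.sobSubmodule s) := dif_pos h
  rw [this]; rfl

theorem toSob_coeff {s : ℝ} (x : A.Sob s) : A.toSob s (coeff x) = x :=
  coeff_injective (coeff_toSob (memSob_coeff x))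

theorem norm_le_of_l2Bound {s B : ℝ} (x : A.Sob s)
    (h : L2Bound (fun n => A.eigenvalue n ^ (s / 2) * coeff x n) B) : ‖x‖ ≤ B := by
  refine le_of_sq_le_sq ?_ h.1
  rw [Sob.norm_sq]
  have := h.tsum_le
  simpa only [rpow_half_mul_sq] using this

theorem norm_toSob_le {s B : ℝ} {a : ℕ → ℝ}
    (h : L2Bound (fun n => A.eigenvalue n ^ (s / 2) * a n) B) : ‖A.toSob s a‖ ≤ B := by
  refine norm_le_of_l2Bound _ ?_
  rwa [coeff_toSob (MemSob.of_l2Bound h)]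

theorem norm_sq_toSob {s : ℝ} {a : ℕ → ℝ} (h : A.MemSob s a) :
    ‖A.toSob s a‖ ^ 2 = ∑' n, A.eigenvalue n ^ s * a n ^ 2 := by
  rw [Sob.norm_sq, coeff_toSob h]

theorem l2Bound_toSob {s : ℝ} {a : ℕ → ℝ} (h : A.MemSob s a) :
    L2Bound (fun n => A.eigenvalue n ^ (s / 2) * a n) ‖A.toSob s a‖ := by
  simpa only [coeff_toSob h] using l2Bound_coeff (A.toSob s a)

/-- The embedding of the stronger space into the weaker one; its constant comes from the smallest
eigenvalue, as `r - s ≤ 0`. -/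
theorem l2Bound_weight_mono {r s B : ℝ} (hrs : r ≤ s) {a : ℕ → ℝ}
    (h : L2Bound (fun n => A.eigenvalue n ^ s * a n) B) :
    L2Bound (fun n => A.eigenvalue n ^ r * a n) (A.eigenvalue 0 ^ (r - s) * B) := by
  have h0 := A.eigenvalue_pos 0
  have := h.mul (m := fun n => A.eigenvalue n ^ (r - s))
    (Real.rpow_nonneg h0.le (r - s)) fun n => by
      rw [abs_of_pos (Real.rpow_pos_of_pos (A.eigenvalue_pos n) _)]
      exact Real.rpow_le_rpow_of_nonpos h0 (A.eigenvalue_zero_le n) (by linarith)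
  convert this using 2 with n
  rw [← mul_assoc, ← Real.rpow_add (A.eigenvalue_pos n), sub_add_cancel]

theorem MemSob.mono {r s : ℝ} (hrs : r ≤ s) {a : ℕ → ℝ} (h : A.MemSob s a) : A.MemSob r a :=
  MemSob.of_l2Bound (l2Bound_weight_mono (by linarith) (l2Bound_toSob h))

theorem memSob_zero_iff {a : ℕ → ℝ} : A.MemSob 0 a ↔ Summable fun n => a n ^ 2 := by
  simp [MemSob]

theorem memℓp_two_of_summable {a : ℕ → ℝ} (h : Summable fun n => a n ^ 2) : Memℓp a 2 := by
  rw [memℓp_gen_iff (by norm_num)]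
  simpa using h

theorem MemSob.memℓp {s : ℝ} (hs : 0 ≤ s) {a : ℕ → ℝ} (h : A.MemSob s a) : Memℓp a 2 :=
  memℓp_two_of_summable (memSob_zero_iff.1 (h.mono hs))

theorem l2Bound_repr (v : H) : L2Bound (fun n => A.eigenbasis.repr v n) ‖v‖ := by
  have h := lp.hasSum_norm (p := 2) (by norm_num) (A.eigenbasis.repr v)
  simp only [ENNReal.toReal_ofNat, Real.rpow_two, Real.norm_eq_abs, sq_abs,
    LinearIsometryEquiv.norm_map] at h
  exact L2Bound.of_tsum h.summable (norm_nonneg v) h.tsum_eq.le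

theorem norm_le_of_l2Bound_repr {v : H} {B : ℝ} (h : L2Bound (fun n => A.eigenbasis.repr v n) B) :
    ‖v‖ ≤ B := by
  have h' := lp.hasSum_norm (p := 2) (by norm_num) (A.eigenbasis.repr v)
  simp only [ENNReal.toReal_ofNat, Real.rpow_two, Real.norm_eq_abs, sq_abs,
    LinearIsometryEquiv.norm_map] at h'
  refine le_of_sq_le_sq ?_ h.1
  rw [← h'.tsum_eq]
  exact h.tsum_le

theorem repr_toH {a : ℕ → ℝ} (h : Memℓp a 2) (n : ℕ) : A.eigenbasis.repr (A.toH a) n = a n := by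
  rw [toH, dif_pos h, LinearIsometryEquiv.apply_symm_apply]

theorem repr_toH_of_l2Bound {a : ℕ → ℝ} {B : ℝ} (h : L2Bound a B) (n : ℕ) :
    A.eigenbasis.repr (A.toH a) n = a n := repr_toH (memℓp_two_of_summable h.summable) n

theorem norm_toH_le {a : ℕ → ℝ} {B : ℝ} (h : L2Bound a B) : ‖A.toH a‖ ≤ B := by
  refine norm_le_of_l2Bound_repr (A := A) ?_
  simpa only [repr_toH_of_l2Bound h] using h

theorem norm_toH_sub_le {a b : ℕ → ℝ} {D : ℝ} (ha : Memℓp a 2) (hb : Memℓp b 2)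
    (h : L2Bound (fun n => a n - b n) D) : ‖A.toH a - A.toH b‖ ≤ D := by
  refine norm_le_of_l2Bound_repr (A := A) ?_
  simpa only [map_sub, lp.coeFn_sub, Pi.sub_apply, repr_toH ha, repr_toH hb] using h

theorem l2Bound_toH_sub {a b : ℕ → ℝ} (ha : Memℓp a 2) (hb : Memℓp b 2) :
    L2Bound (fun n => a n - b n) ‖A.toH a - A.toH b‖ := by
  simpa only [map_sub, lp.coeFn_sub, Pi.sub_apply, repr_toH ha, repr_toH hb] using
    l2Bound_repr (A := A) (A.toH a - A.toH b)

theorem hasSum_inner (v w : H) :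
    HasSum (fun n => A.eigenbasis.repr v n * A.eigenbasis.repr w n) ⟪v, w⟫_ℝ := by
  have := A.eigenbasis.hasSum_inner_mul_inner v w
  have e : (fun n => A.eigenbasis.repr v n * A.eigenbasis.repr w n) =
      fun n => ⟪v, A.eigenbasis n⟫_ℝ * ⟪A.eigenbasis n, w⟫_ℝ := funext fun n => by
    rw [HilbertBasis.repr_apply_apply, HilbertBasis.repr_apply_apply, real_inner_comm v]
  rwa [e]

/-- The function is the pointwise limit of its partial Fourier sums, so measurability can be checked
mode by mode. -/
theorem aestronglyMeasurable_of_repr {X : Type*} [MeasurableSpace X] {ν : Measure X} {f : X → H}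
    (h : ∀ n, AEStronglyMeasurable (fun t => A.eigenbasis.repr (f t) n) ν) :
    AEStronglyMeasurable f ν := by
  refine aestronglyMeasurable_of_tendsto_ae atTop
    (f := fun N t => ∑ n ∈ Finset.range N, A.eigenbasis.repr (f t) n • A.eigenbasis n)
    (fun N => ?_) (ae_of_all _ fun t => (A.eigenbasis.hasSum_repr (f t)).tendsto_sum_nat)
  exact Finset.aestronglyMeasurable_fun_sum _ fun n _ => (h n).smul_const _

theorem norm_sobToL2 {s : ℝ} (x : A.Sob s) : ‖A.sobToL2 s x‖ = ‖x‖ := rfl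

theorem isEmbedding_sobToL2 (s : ℝ) : IsEmbedding (A.sobToL2 s) :=
  (AddMonoidHomClass.isometry_of_norm (A.sobToL2 s) norm_sobToL2).isEmbedding

theorem aestronglyMeasurable_of_coeff {X : Type*} [MeasurableSpace X] {ν : Measure X} {s : ℝ}
    {f : X → A.Sob s} (h : ∀ n, AEStronglyMeasurable (fun t => coeff (f t) n) ν) :
    AEStronglyMeasurable f ν := by
  rw [← (isEmbedding_sobToL2 s).aestronglyMeasurable_comp_iff,
    ← A.eigenbasis.repr.symm.toHomeomorph.isEmbedding.aestronglyMeasurable_comp_iff]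
  refine aestronglyMeasurable_of_repr (A := A) fun n => ?_
  have : ∀ t, A.eigenbasis.repr ((A.eigenbasis.repr.symm.toHomeomorph ∘ A.sobToL2 s ∘ f) t) n =
      A.eigenvalue n ^ (s / 2) * coeff (f t) n := fun t => by
    change A.eigenbasis.repr (A.eigenbasis.repr.symm (A.sobToL2 s (f t))) n = _
    rw [LinearIsometryEquiv.apply_symm_apply]
    rfl
  exact ((h n).const_mul (A.eigenvalue n ^ (s / 2))).congr (ae_of_all _ fun t => (this t).symm)

/-- The Fourier coefficients are continuous linear functionals on `H^s`. -/
noncomputable def coeffCLM (A : PosSelfAdjOp H) (s : ℝ) (n : ℕ) : A.Sob s →L[ℝ] ℝ :=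
  LinearMap.mkContinuous ((LinearMap.proj n).comp coeff) (A.eigenvalue n ^ (-(s / 2))) fun x => by
    have h := (l2Bound_coeff x).abs_le n
    have h0 := Real.rpow_pos_of_pos (A.eigenvalue_pos n) (s / 2)
    rw [abs_mul, abs_of_pos h0] at h
    rw [Real.rpow_neg (A.eigenvalue_pos n).le, inv_mul_eq_div, le_div_iff₀' h0]
    exact h

theorem memSob_single (s : ℝ) (n : ℕ) : A.MemSob s (Pi.single n 1) := by
  refine summable_of_ne_finset_zero (s := {n}) fun m hm => ?_
  rw [Finset.mem_singleton] at hm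
  simp [hm]

end Coefficients

end PosSelfAdjOp

/-! ### Smoothing of the free evolution, and regularity of Duhamel's formula in time -/

/-- Passing from the weight `μ^(-q)` to `μ^p` costs `s^(-(p+q))`. A negative `q` is allowed: for `q
= -p` there is no singularity at `s = 0`. -/
theorem L2Bound.exp_mul {μ : ℕ → ℝ} (hμ : ∀ n, 0 < μ n) {a : ℕ → ℝ} {N p q s : ℝ} (hs : 0 < s)
    (h0 : 0 ≤ p + q) (h1 : p + q ≤ 1) (ha : L2Bound (fun n => μ n ^ (-q) * a n) N) :
    L2Bound (fun n => μ n ^ p * Real.exp (-μ n * s) * a n) (s ^ (-(p + q)) * N) := by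
  have := ha.mul (m := fun n => μ n ^ (p + q) * Real.exp (-μ n * s))
    (Real.rpow_nonneg hs.le (-(p + q))) fun n => by
      rw [abs_of_nonneg (mul_nonneg (Real.rpow_nonneg (hμ n).le _) (Real.exp_pos _).le)]
      exact Real.rpow_mul_exp_neg_mul_le (hμ n).le hs h0 h1
  convert this using 2 with n
  rw [Real.rpow_add (hμ n), Real.rpow_neg (hμ n).le]
  have := (Real.rpow_pos_of_pos (hμ n) q).ne'
  field_simp

/-- The Hölder constant may degenerate as `ε → 0`; at a point `t₀` it is used with `ε = t₀ / 2`. -/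
theorem continuousOn_Ioc_of_holder {E : Type*} [SeminormedAddCommGroup E] {f : ℝ → E} {T δ : ℝ}
    (hδ : 0 < δ)
    (h : ∀ ε > 0, ∃ K, ∀ s t, ε ≤ s → s ≤ t → t ≤ T → ‖f t - f s‖ ≤ (t - s) ^ δ * K) :
    ContinuousOn f (Ioc 0 T) := by
  intro t₀ ht₀
  obtain ⟨K, hK⟩ := h (t₀ / 2) (half_pos ht₀.1)
  rw [ContinuousWithinAt, tendsto_iff_norm_sub_tendsto_zero]
  have hlim : Tendsto (fun t => |t - t₀| ^ δ * K) (𝓝[Ioc 0 T] t₀) (𝓝 0) := by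
    have : ContinuousAt (fun t => |t - t₀| ^ δ * K) t₀ :=
      ((continuous_id.sub continuous_const).abs.continuousAt.rpow_const
        (Or.inr hδ.le)).mul continuousAt_const
    have h2 := this.tendsto.mono_left (nhdsWithin_le_nhds (s := Ioc 0 T))
    simpa [Real.zero_rpow hδ.ne'] using h2
  refine squeeze_zero' (Eventually.of_forall fun _ => norm_nonneg _) ?_ hlim
  have h1 : ∀ᶠ t in 𝓝[Ioc 0 T] t₀, t₀ / 2 ≤ t :=
    nhdsWithin_le_nhds (Ici_mem_nhds (half_lt_self ht₀.1))
  filter_upwards [h1, self_mem_nhdsWithin] with t ht htT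
  rcases le_total t t₀ with hc | hc
  · rw [norm_sub_rev, abs_sub_comm, abs_of_nonneg (sub_nonneg.2 hc)]
    exact hK t t₀ ht hc ht₀.2
  · rw [abs_of_nonneg (sub_nonneg.2 hc)]
    exact hK t₀ t (half_le_self ht₀.1.le) hc htT.2

namespace BoundedForcing

variable {μ : ℕ → ℝ} {θ T G : ℝ} {a : ℕ → ℝ} {h : ℝ → ℕ → ℝ}

theorem holder_bound (hμ : ∀ n, 0 < μ n) (hθ0 : 0 ≤ θ) (hθ1 : θ < 1)
    (hh : BoundedForcing T G h) {s t N δ : ℝ} (hδ0 : 0 < δ)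
    (hδ : 2 * δ = 1 - θ) (hs : 0 < s) (hst : s ≤ t) (ht : t ≤ T)
    (ha : L2Bound (fun n => μ n ^ (-(θ / 2)) * a n) N) :
    L2Bound (fun n => duhamel μ θ a h t n - duhamel μ θ a h s n)
      ((t - s) ^ δ * (s ^ (-(1 / 2) : ℝ) * N + (s ^ δ / δ + (t - s) ^ δ / (2 * δ)) * G)) := by
  refine hh.duhamel_sub_bound hμ hθ0 hθ1 hδ0 hδ hs hst ht ?_
  have := ha.exp_mul hμ (p := δ) (q := θ / 2) hs (by linarith) (by linarith)
  rwa [show δ + θ / 2 = 1 / 2 by linarith] at this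

theorem holder_bound_local (hμ : ∀ n, 0 < μ n) (hθ0 : 0 ≤ θ) (hθ1 : θ < 1)
    (hh : BoundedForcing T G h) {N δ : ℝ} (hδ0 : 0 < δ) (hδ : 2 * δ = 1 - θ)
    (ha : L2Bound (fun n => μ n ^ (-(θ / 2)) * a n) N) {ε : ℝ} (hε : 0 < ε) :
    ∃ K, ∀ s t, ε ≤ s → s ≤ t → t ≤ T →
      L2Bound (fun n => duhamel μ θ a h t n - duhamel μ θ a h s n) ((t - s) ^ δ * K) := by
  refine ⟨ε ^ (-(1 / 2) : ℝ) * N + (T ^ δ / δ + T ^ δ / (2 * δ)) * G, fun s t hs hst ht => ?_⟩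
  have hs0 := hε.trans_le hs
  have hT : 0 < T := hs0.trans_le (hst.trans ht)
  refine (hh.holder_bound hμ hθ0 hθ1 hδ0 hδ hs0 hst ht ha).mono ?_
  have hts : 0 ≤ t - s := sub_nonneg.2 hst
  have hG := hh.nonneg hT
  have hN := ha.1
  have h1 : s ^ (-(1 / 2) : ℝ) ≤ ε ^ (-(1 / 2) : ℝ) :=
    Real.rpow_le_rpow_of_nonpos hε hs (by norm_num)
  have h2 : s ^ δ ≤ T ^ δ := Real.rpow_le_rpow hs0.le (hst.trans ht) hδ0.le
  have h3 : (t - s) ^ δ ≤ T ^ δ := Real.rpow_le_rpow hts (by linarith) hδ0.le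
  have h4 := Real.rpow_nonneg hts δ
  gcongr

/-- Pulling out `exp(-μt)` makes the integrand independent of `t`, so the fundamental theorem of
calculus applies directly. -/
theorem duhamel_eq_exp_mul (t : ℝ) (n : ℕ) : duhamel μ θ a h t n = Real.exp (-μ n * t) * (a n +
    ∫ s in (0)..t, μ n ^ θ * Real.exp (μ n * s) * h s n) := by
  rw [duhamel, mul_add, ← intervalIntegral.integral_const_mul]
  congr 1
  refine intervalIntegral.integral_congr fun s _ => ?_
  simp only [mul_sub, Real.exp_sub, neg_mul, Real.exp_neg]
  field_simp

theorem hasDerivAt_duhamel_coord (hh : BoundedForcing T G h) (n : ℕ)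
    (hc : ContinuousOn (fun s => h s n) (Ioo 0 T)) {t : ℝ} (ht : t ∈ Ioo 0 T) :
    HasDerivAt (fun t => duhamel μ θ a h t n) (-μ n * duhamel μ θ a h t n + μ n ^ θ * h t n) t := by
  have hc' : ContinuousOn (fun s => μ n ^ θ * Real.exp (μ n * s) * h s n) (Ioo 0 T) :=
    ContinuousOn.mul (by fun_prop) hc
  have h1 := intervalIntegral.integral_hasDerivAt_right
    (((hh.intervalIntegrable n le_rfl ht.1.le ht.2.le).continuousOn_mul (by fun_prop)) :
      IntervalIntegrable (fun s => μ n ^ θ * Real.exp (μ n * s) * h s n) volume 0 t)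
    (hc'.stronglyMeasurableAtFilter isOpen_Ioo t ht) (hc'.continuousAt (Ioo_mem_nhds ht.1 ht.2))
  have h2 := (((hasDerivAt_id t).const_mul (-μ n)).exp).mul (h1.const_add (a n))
  have h3 : HasDerivAt (fun t => duhamel μ θ a h t n) _ t :=
    h2.congr_of_eventuallyEq (Eventually.of_forall fun t => duhamel_eq_exp_mul t n)
  refine h3.congr_deriv ?_
  rw [duhamel_eq_exp_mul]
  have : Real.exp (-μ n * t) * Real.exp (μ n * t) = 1 := by
    rw [← Real.exp_add]; simp
  simp only [id]
  linear_combination (μ n ^ θ * h t n) * this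

end BoundedForcing

namespace PosSelfAdjOp

variable {H : Type u} [NormedAddCommGroup H] [InnerProductSpace ℝ H] [CompleteSpace H]
  {A : PosSelfAdjOp H}

/-! ### Mild solutions -/

/-- The eigenvalues of `A^{1+γ}`. -/
noncomputable def rate (A : PosSelfAdjOp H) (γ : ℝ) (n : ℕ) : ℝ := A.eigenvalue n ^ (1 + γ)

theorem rate_pos (γ : ℝ) (n : ℕ) : 0 < A.rate γ n := Real.rpow_pos_of_pos (A.eigenvalue_pos n) _

theorem rate_rpow (γ p : ℝ) (n : ℕ) : A.rate γ n ^ p = A.eigenvalue n ^ ((1 + γ) * p) := by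
  rw [rate, ← Real.rpow_mul (A.eigenvalue_pos n).le]

/-- This and the next two lemmas are the dictionary between powers of the rates and of the
eigenvalues: `θ` gives `A^γ`, `1 - θ` gives the weight of `H²`, and `-θ/2` that of `H^{-γ}`. The
exponent `2/2` keeps the form `s/2` of the norm of `H^s`. -/
theorem rate_rpow_theta {γ : ℝ} (hγ : 0 ≤ γ) (n : ℕ) :
    A.rate γ n ^ (γ / (1 + γ)) = A.eigenvalue n ^ γ := by
  rw [rate_rpow, mul_div_cancel₀ _ (by positivity)]

theorem rate_rpow_one_sub_theta {γ : ℝ} (hγ : 0 ≤ γ) (n : ℕ) :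
    A.rate γ n ^ (1 - γ / (1 + γ)) = A.eigenvalue n ^ ((2 : ℝ) / 2) := by
  rw [rate_rpow]; congr 1; field_simp; ring

theorem rate_rpow_neg_half_theta {γ : ℝ} (hγ : 0 ≤ γ) (n : ℕ) :
    A.rate γ n ^ (-(γ / (1 + γ) / 2)) = A.eigenvalue n ^ (-γ / 2) := by
  rw [rate_rpow]; congr 1; field_simp

theorem theta_nonneg {γ : ℝ} (hγ : 0 ≤ γ) : 0 ≤ γ / (1 + γ) := by positivity

theorem theta_lt_one {γ : ℝ} (hγ : 0 ≤ γ) : γ / (1 + γ) < 1 := by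
  rw [div_lt_one (by positivity)]; linarith

/-- Half of the order of the smoothing. -/
noncomputable def holderExp (γ : ℝ) : ℝ := 1 / (2 * (1 + γ))

theorem holderExp_pos {γ : ℝ} (hγ : 0 ≤ γ) : 0 < holderExp γ := by unfold holderExp; positivity

theorem two_mul_holderExp {γ : ℝ} (hγ : 0 ≤ γ) : 2 * holderExp γ = 1 - γ / (1 + γ) := by
  unfold holderExp; field_simp; ring

theorem rate_rpow_holderExp {γ : ℝ} (hγ : 0 ≤ γ) (n : ℕ) :
    A.rate γ n ^ holderExp γ = A.eigenvalue n ^ ((1 : ℝ) / 2) := by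
  rw [rate_rpow]; congr 1; unfold holderExp; field_simp

theorem l2Bound_rate {γ : ℝ} (hγ : 0 ≤ γ) (x : A.Sob (-γ)) :
    L2Bound (fun n => A.rate γ n ^ (-(γ / (1 + γ) / 2)) * coeff x n) ‖x‖ := by
  simp only [rate_rpow_neg_half_theta hγ]
  exact l2Bound_coeff x

/-- The coefficients of `g - F(u(t))`. -/
noncomputable def forcing (A : PosSelfAdjOp H) (F : H → H) (g : H) (c : ℝ → ℕ → ℝ) (t : ℝ)
    (n : ℕ) : ℝ :=
  A.eigenbasis.repr (g - F (A.toH (c t))) n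

/-- `u` satisfies Duhamel's formula on `[0,T]`. -/
structure IsMild (A : PosSelfAdjOp H) (γ : ℝ) (F : H → H) (g : H) (T : ℝ) (u : ℝ → A.Sob (-γ)) :
    Prop where
  continuousOn : ContinuousOn u (Icc 0 T)
  memℓp : ∀ t ∈ Ioc 0 T, Memℓp (coeff (u t)) 2
  formula : ∀ t ∈ Icc 0 T, coeff (u t) = duhamel (A.rate γ) (γ / (1 + γ)) (coeff (u 0))
    (A.forcing F g fun s => coeff (u s)) t

theorem continuousOn_toH_duhamel {γ T G : ℝ} (hγ : 0 ≤ γ) {h : ℝ → ℕ → ℝ}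
    (hh : BoundedForcing T G h) (x : A.Sob (-γ)) :
    ContinuousOn (fun t => A.toH (duhamel (A.rate γ) (γ / (1 + γ)) (coeff x) h t)) (Ioc 0 T) := by
  refine continuousOn_Ioc_of_holder (holderExp_pos hγ) fun ε hε => ?_
  obtain ⟨K, hK⟩ := hh.holder_bound_local (rate_pos (A := A) γ) (theta_nonneg hγ) (theta_lt_one hγ)
    (holderExp_pos hγ) (two_mul_holderExp hγ) (l2Bound_rate hγ x) hε
  refine ⟨K, fun s t hs hst ht => norm_toH_sub_le ?_ ?_ (hK s t hs hst ht)⟩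
  · exact memℓp_two_of_summable (hh.duhamel_bound (rate_pos (A := A) γ) (theta_nonneg hγ)
      (theta_lt_one hγ) (by linarith) ht (l2Bound_rate hγ x)).summable
  · exact memℓp_two_of_summable (hh.duhamel_bound (rate_pos (A := A) γ) (theta_nonneg hγ)
      (theta_lt_one hγ) (by linarith) (hst.trans ht) (l2Bound_rate hγ x)).summable

/-- Boundedness of `F` gives the bound at every time, even where the series does not converge in `H`
and `toH` takes its default value; only measurability uses `hmem`. -/
theorem boundedForcing_of_continuousOn {F : H → H} {M : ℝ} (hM : ∀ v, ‖F v‖ ≤ M)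
    (hF : Continuous F) (g : H) {T : ℝ} {c : ℝ → ℕ → ℝ}
    (hc : ∀ n, AEStronglyMeasurable (fun t => c t n) (volume.restrict (Ioc 0 T)))
    (hmem : ∀ᵐ t ∂volume.restrict (Ioc 0 T), Memℓp (c t) 2) :
    BoundedForcing T (‖g‖ + M) (A.forcing F g c) where
  meas n := by
    have h1 : AEStronglyMeasurable (fun t => A.toH (c t)) (volume.restrict (Ioc 0 T)) :=
      aestronglyMeasurable_of_repr (A := A) fun n => (hc n).congr <| by
        filter_upwards [hmem] with t ht
        rw [repr_toH ht]
    have h2 : Continuous fun v : H => A.eigenbasis.repr (g - F v) n := by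
      simp only [HilbertBasis.repr_apply_apply]
      fun_prop
    exact h2.comp_aestronglyMeasurable h1
  bound s _ := (l2Bound_repr _).mono ((norm_sub_le _ _).trans (by gcongr; exact hM _))

/-! ### Regularity of mild solutions -/

namespace IsMild

variable {γ : ℝ} {F : H → H} {g : H} {T M : ℝ} {u : ℝ → A.Sob (-γ)}

theorem continuousOn_coeff (hu : A.IsMild γ F g T u) (n : ℕ) :
    ContinuousOn (fun t => coeff (u t) n) (Icc 0 T) :=
  (coeffCLM A (-γ) n).continuous.comp_continuousOn hu.continuousOn

theorem boundedForcing (hu : A.IsMild γ F g T u) (hM : ∀ v, ‖F v‖ ≤ M) (hF : Continuous F) :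
    BoundedForcing T (‖g‖ + M) (A.forcing F g fun s => coeff (u s)) :=
  boundedForcing_of_continuousOn hM hF g (fun n =>
    ((hu.continuousOn_coeff n).mono Ioc_subset_Icc_self).aestronglyMeasurable measurableSet_Ioc)
    ((ae_restrict_iff' measurableSet_Ioc).2 (ae_of_all _ hu.memℓp))

theorem continuousOn_toH (hγ : 0 ≤ γ) (hu : A.IsMild γ F g T u) (hM : ∀ v, ‖F v‖ ≤ M)
    (hF : Continuous F) : ContinuousOn (fun t => A.toH (coeff (u t))) (Ioc 0 T) :=
  (continuousOn_toH_duhamel hγ (hu.boundedForcing hM hF) (u 0)).congr fun t ht =>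
    congrArg A.toH (hu.formula t (Ioc_subset_Icc_self ht))

theorem continuousOn_forcing (hγ : 0 ≤ γ) (hu : A.IsMild γ F g T u) (hM : ∀ v, ‖F v‖ ≤ M)
    (hF : Continuous F) (n : ℕ) :
    ContinuousOn (fun t => A.forcing F g (fun s => coeff (u s)) t n) (Ioc 0 T) := by
  have h2 : Continuous fun v : H => A.eigenbasis.repr (g - F v) n := by
    simp only [HilbertBasis.repr_apply_apply]
    fun_prop
  exact h2.comp_continuousOn (hu.continuousOn_toH hγ hM hF)

/-- At positive times the solution is continuous into `H`, hence so is the forcing, and each mode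
satisfies its differential equation classically. -/
theorem hasDerivAt_coeff (hγ : 0 ≤ γ) (hu : A.IsMild γ F g T u) (hM : ∀ v, ‖F v‖ ≤ M)
    (hF : Continuous F) (n : ℕ) {t : ℝ} (ht : t ∈ Ioo 0 T) :
    HasDerivAt (fun t => coeff (u t) n) (-A.rate γ n * coeff (u t) n +
      A.eigenvalue n ^ γ * A.forcing F g (fun s => coeff (u s)) t n) t := by
  have h := (hu.boundedForcing hM hF).hasDerivAt_duhamel_coord (μ := A.rate γ)
    (θ := γ / (1 + γ)) (a := coeff (u 0)) n
    ((hu.continuousOn_forcing hγ hM hF n).mono Ioo_subset_Ioc_self) ht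
  rw [← hu.formula t (Ioo_subset_Icc_self ht), rate_rpow_theta hγ] at h
  refine h.congr_of_eventuallyEq ?_
  filter_upwards [Ioo_mem_nhds ht.1 ht.2] with s hs
  rw [← hu.formula s (Ioo_subset_Icc_self hs)]

theorem shift (hu : A.IsMild γ F g T u) (hM : ∀ v, ‖F v‖ ≤ M)
    (hF : Continuous F) {t₀ : ℝ} (ht₀ : 0 ≤ t₀) : A.IsMild γ F g (T - t₀) fun t => u (t₀ + t) where
  continuousOn := hu.continuousOn.comp (by fun_prop) fun t ht => by
    constructor <;> linarith [ht.1, ht.2]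
  memℓp t ht := hu.memℓp _ (by constructor <;> linarith [ht.1, ht.2])
  formula t ht := by
    funext n
    rw [hu.formula (t₀ + t) (by constructor <;> linarith [ht.1, ht.2]),
      (hu.boundedForcing hM hF).duhamel_restart ht₀ (by linarith [ht.1]) (by linarith [ht.2]),
      ← hu.formula t₀ ⟨ht₀, by linarith [ht.1, ht.2]⟩, duhamel, add_zero, add_sub_cancel_left]
    congr 1
    have := intervalIntegral.integral_comp_add_left (a := 0) (b := t)
      (fun r => A.rate γ n ^ (γ / (1 + γ)) * Real.exp (-A.rate γ n * (t₀ + t - r)) *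
        A.forcing F g (fun s => coeff (u s)) r n) t₀
    rw [add_zero] at this
    rw [← this]
    refine intervalIntegral.integral_congr fun r _ => ?_
    simp only [add_sub_add_left_eq_sub]
    rfl

/-- In the difference of the forcings `g` cancels and `F` enters with the times exchanged, so its
Lipschitz constant is all that remains. -/
theorem l2Bound_forcing_sub (hu : A.IsMild γ F g T u) {L : ℝ≥0} (hL : LipschitzWith L F)
    {s t D : ℝ} (hs : s ∈ Ioc 0 T) (ht : t ∈ Ioc 0 T)
    (h : L2Bound (fun n => coeff (u t) n - coeff (u s) n) D) :
    L2Bound (fun n => A.forcing F g (fun s => coeff (u s)) s n -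
      A.forcing F g (fun s => coeff (u s)) t n) (L * D) := by
  have h1 := norm_toH_sub_le (A := A) (hu.memℓp t ht) (hu.memℓp s hs) h
  have h2 := hL.norm_sub_le (A.toH (coeff (u t))) (A.toH (coeff (u s)))
  have h3 := l2Bound_repr (A := A) (F (A.toH (coeff (u t))) - F (A.toH (coeff (u s))))
  convert h3.mono (h2.trans (mul_le_mul_of_nonneg_left h1 L.2)) using 2 with n
  simp only [forcing, map_sub, lp.coeFn_sub, Pi.sub_apply]
  ring

/-- Smoothing from `H^{-γ}` to `H²`. -/
theorem smooth_bound (hγ : 0 ≤ γ) (hu : A.IsMild γ F g T u) (hM : ∀ v, ‖F v‖ ≤ M) {L : ℝ≥0}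
    (hL : LipschitzWith L F) {t : ℝ} (ht0 : 0 < t) (ht1 : t ≤ 1) (htT : t ≤ T) :
    L2Bound (fun n => A.eigenvalue n ^ ((2 : ℝ) / 2) * coeff (u t) n)
      (t⁻¹ * ((1 + L * (4 + 2 / holderExp γ)) * ‖u 0‖ +
        (1 + L * (2 / holderExp γ ^ 2)) * (‖g‖ + M))) := by
  have hh := hu.boundedForcing hM hL.continuous
  have hδ0 := holderExp_pos hγ
  have hδ := two_mul_holderExp hγ
  have hθ0 := theta_nonneg hγ
  have hθ1 := theta_lt_one hγ
  have hG : 0 ≤ ‖g‖ + M := hh.nonneg (ht0.trans_le htT)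
  -- Data in `H^{-γ}` have weight `μ^(-θ/2)`, so reaching `μ^δ` costs `s^(-(δ + θ/2))`. Since `2δ =
  -- 1 - θ`, this exponent is `σ = 1/2` whatever `γ` is.
  have h := hh.semilinear_smooth_bound (rate_pos (A := A) γ) (L := L) (a := coeff (u 0))
    (σ := 1 / 2) hθ0 hθ1 L.2 hδ0 hδ
    (by norm_num) (by norm_num) ht0 htT (norm_nonneg (u 0))
    (fun s hs => by
      have := (l2Bound_rate hγ (u 0)).exp_mul (rate_pos γ) (p := holderExp γ) hs.1
        (by linarith) (by linarith)
      rwa [show holderExp γ + γ / (1 + γ) / 2 = 1 / 2 by linarith] at this)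
    (by
      have := (l2Bound_rate hγ (u 0)).exp_mul (rate_pos γ) (p := 1 - γ / (1 + γ)) ht0
        (by linarith) (by linarith)
      simpa only [mul_assoc] using this)
    (fun s hs D hD => by
      have hsT : s ≤ T := hs.2.le.trans htT
      rw [← hu.formula t ⟨ht0.le, htT⟩, ← hu.formula s ⟨hs.1.le, hsT⟩] at hD
      exact hu.l2Bound_forcing_sub hL ⟨hs.1, hsT⟩ ⟨ht0, htT⟩ hD)
  rw [← hu.formula t ⟨ht0.le, htT⟩] at h
  simp only [rate_rpow_one_sub_theta hγ] at h
  refine h.mono ?_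
  set δ := holderExp γ
  have hinv : 1 ≤ t⁻¹ := (one_le_inv₀ ht0).2 ht1
  -- Each power of `t` or `t/2` with negative exponent has exponent at least `-1`; as `t ≤ 1`, all
  -- of them are absorbed into `t⁻¹`.
  have a1 : t ^ (-(1 - γ / (1 + γ) + γ / (1 + γ) / 2)) ≤ t⁻¹ := by
    rw [← Real.rpow_neg_one]
    exact Real.rpow_le_rpow_of_exponent_ge ht0 ht1 (by linarith)
  have ht2 : (t / 2)⁻¹ = 2 * t⁻¹ := by field_simp
  have a2 : (t / 2) ^ (δ - 1) ≤ 2 * t⁻¹ := by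
    rw [← ht2, ← Real.rpow_neg_one]
    exact Real.rpow_le_rpow_of_exponent_ge (half_pos ht0) (by linarith) (by linarith)
  have a3 : (t / 2) ^ (-(1 / 2) : ℝ) ≤ 2 * t⁻¹ := by
    rw [← ht2, ← Real.rpow_neg_one]
    exact Real.rpow_le_rpow_of_exponent_ge (half_pos ht0) (by linarith) (by norm_num)
  have a4 : t ^ δ ≤ 1 := Real.rpow_le_one ht0.le ht1 hδ0.le
  have a5 : t ^ (1 - 1 / 2 : ℝ) / (1 - 1 / 2) ≤ 2 := by
    have := Real.rpow_le_one ht0.le ht1 (z := 1 - 1 / 2) (by norm_num)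
    rw [div_le_iff₀ (by norm_num)]; linarith
  have a6 : 0 ≤ t ^ δ := Real.rpow_nonneg ht0.le _
  have a7 : t ^ δ / δ ≤ 1 / δ := by gcongr
  have hL0 : (0 : ℝ) ≤ L := L.2
  have hu0 := norm_nonneg (u 0)
  have b1 : (t / 2) ^ (δ - 1) * (t ^ (1 - 1 / 2 : ℝ) / (1 - 1 / 2)) ≤ 2 * t⁻¹ * 2 := by
    gcongr
  have b2 : (t / 2) ^ (-(1 / 2) : ℝ) * (t ^ δ / δ) ≤ 2 * t⁻¹ * (1 / δ) := by
    gcongr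
  have b3 : 2 / δ * t ^ δ * (‖g‖ + M) * (t ^ δ / δ) ≤ 2 / δ * 1 * (‖g‖ + M) * (1 / δ) := by
    gcongr
  calc _ ≤ t⁻¹ * ‖u 0‖ + L * (‖u 0‖ * (2 * t⁻¹ * 2 + 2 * t⁻¹ * (1 / δ)) +
        2 / δ * 1 * (‖g‖ + M) * (1 / δ)) + (‖g‖ + M) := by
        gcongr
    _ ≤ t⁻¹ * ‖u 0‖ + L * (‖u 0‖ * (2 * t⁻¹ * 2 + 2 * t⁻¹ * (1 / δ)) +
        t⁻¹ * (2 / δ * 1 * (‖g‖ + M) * (1 / δ))) + t⁻¹ * (‖g‖ + M) := by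
        have c1 := mul_le_mul_of_nonneg_left (le_mul_of_one_le_left
          (by positivity : 0 ≤ 2 / δ * 1 * (‖g‖ + M) * (1 / δ)) hinv) hL0
        have c2 := le_mul_of_one_le_left hG hinv
        linarith
    _ = _ := by field_simp; ring

/-- Short-time bound in `H²`. -/
theorem smooth_bound_of_memSob (hγ : 0 ≤ γ) (hu : A.IsMild γ F g T u) (hM : ∀ v, ‖F v‖ ≤ M)
    {L : ℝ≥0} (hL : LipschitzWith L F) {t N : ℝ} (ht0 : 0 < t) (ht1 : t ≤ 1) (htT : t ≤ T)
    (hN : L2Bound (fun n => A.eigenvalue n ^ ((2 : ℝ) / 2) * coeff (u 0) n) N) :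
    L2Bound (fun n => A.eigenvalue n ^ ((2 : ℝ) / 2) * coeff (u t) n)
      ((1 + L * (A.eigenvalue 0 ^ (-(1 / 2) : ℝ) * (2 + 1 / holderExp γ))) * N +
        (1 + L * (2 / holderExp γ ^ 2)) * (‖g‖ + M)) := by
  have hh := hu.boundedForcing hM hL.continuous
  have hδ0 := holderExp_pos hγ
  have hδ := two_mul_holderExp hγ
  have hθ0 := theta_nonneg hγ
  have hθ1 := theta_lt_one hγ
  have hG : 0 ≤ ‖g‖ + M := hh.nonneg (ht0.trans_le htT)
  -- Since `μ^δ = λ^(1/2)`, data in `H²` already carry the weight needed for Hölder continuity.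
  -- Hence `σ = 0` below, and no negative power of `t` survives.
  have hN' := l2Bound_weight_mono (A := A) (r := 1 / 2) (by norm_num) hN
  rw [show (1 / 2 - 2 / 2 : ℝ) = -(1 / 2) by norm_num] at hN'
  have h := hh.semilinear_smooth_bound (rate_pos (A := A) γ) (L := L) (a := coeff (u 0))
    (σ := 0) (R := N) hθ0 hθ1 L.2 hδ0 hδ
    le_rfl one_pos ht0 htT hN'.1
    (fun s hs => by
      simp only [← rate_rpow_holderExp hγ] at hN'
      have := L2Bound.exp_mul (rate_pos γ) (p := holderExp γ) (q := -holderExp γ) hs.1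
        (by linarith) (by linarith) ((neg_neg (holderExp γ)).symm ▸ hN')
      rwa [add_neg_cancel] at this)
    (by
      simp only [← rate_rpow_one_sub_theta hγ] at hN
      have := L2Bound.exp_mul (rate_pos γ) (p := 1 - γ / (1 + γ)) (q := -(1 - γ / (1 + γ))) ht0
        (by linarith) (by linarith) ((neg_neg (1 - γ / (1 + γ))).symm ▸ hN)
      rw [add_neg_cancel, neg_zero, Real.rpow_zero, one_mul] at this
      simpa only [mul_assoc] using this)
    (fun s hs D hD => by
      have hsT : s ≤ T := hs.2.le.trans htT
      rw [← hu.formula t ⟨ht0.le, htT⟩, ← hu.formula s ⟨hs.1.le, hsT⟩] at hD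
      exact hu.l2Bound_forcing_sub hL ⟨hs.1, hsT⟩ ⟨ht0, htT⟩ hD)
  rw [← hu.formula t ⟨ht0.le, htT⟩] at h
  simp only [rate_rpow_one_sub_theta hγ] at h
  refine h.mono ?_
  set δ := holderExp γ
  set N' := A.eigenvalue 0 ^ (-(1 / 2) : ℝ) * N with hN'def
  have hN'0 := hN'.1
  have a2 : (t / 2) ^ (δ - 1) ≤ 2 * t⁻¹ := by
    rw [show 2 * t⁻¹ = (t / 2)⁻¹ by field_simp, ← Real.rpow_neg_one]
    exact Real.rpow_le_rpow_of_exponent_ge (half_pos ht0) (by linarith) (by linarith)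
  have a4 : t ^ δ ≤ 1 := Real.rpow_le_one ht0.le ht1 hδ0.le
  have a6 : 0 ≤ t ^ δ := Real.rpow_nonneg ht0.le _
  have a7 : t ^ δ / δ ≤ 1 / δ := by gcongr
  have hL0 : (0 : ℝ) ≤ L := L.2
  have b1 : (t / 2) ^ (δ - 1) * (t ^ (1 - 0 : ℝ) / (1 - 0)) ≤ 2 := by
    rw [sub_zero, Real.rpow_one, div_one]
    calc _ ≤ 2 * t⁻¹ * t := by gcongr
      _ = 2 := by field_simp
  have b2 : (t / 2) ^ (-0 : ℝ) * (t ^ δ / δ) ≤ 1 / δ := by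
    rwa [neg_zero, Real.rpow_zero, one_mul]
  have b3 : 2 / δ * t ^ δ * (‖g‖ + M) * (t ^ δ / δ) ≤ 2 / δ * 1 * (‖g‖ + M) * (1 / δ) := by
    gcongr
  calc _ ≤ N + L * (N' * (2 + 1 / δ) + 2 / δ * 1 * (‖g‖ + M) * (1 / δ)) + (‖g‖ + M) := by
        gcongr
    _ = _ := by rw [hN'def]; field_simp; ring

end IsMild

end PosSelfAdjOp

/-! ### The lemma of du Bois-Reymond -/

/-- The primitive that starts at the left of the support vanishes again on the right exactly because
the mean of `f` is zero. -/
theorem exists_primitive_compact_support {f : ℝ → ℝ} {T : ℝ} (hT : 0 < T) (hf : ContDiff ℝ ∞ f)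
    (hc : HasCompactSupport f) (hs : tsupport f ⊆ Ioo 0 T) (h0 : ∫ t in (0)..T, f t = 0) :
    ∃ ψ : ℝ → ℝ, ContDiff ℝ ∞ ψ ∧ HasCompactSupport ψ ∧ tsupport ψ ⊆ Ioo 0 T ∧ deriv ψ = f := by
  obtain ⟨p, q, hp, hpq, hq, hK⟩ : ∃ p q : ℝ, 0 < p ∧ p ≤ q ∧ q < T ∧ tsupport f ⊆ Ioo p q := by
    rcases (tsupport f).eq_empty_or_nonempty with he | hne
    · exact ⟨T / 2, T / 2, by linarith, le_rfl, by linarith, by simp [he]⟩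
    · obtain ⟨x, hx⟩ := hc.isCompact.exists_isLeast hne
      obtain ⟨y, hy⟩ := hc.isCompact.exists_isGreatest hne
      have hx0 := hs hx.1
      have hy0 := hs hy.1
      refine ⟨x / 2, (y + T) / 2, by linarith [hx0.1], ?_, by linarith [hy0.2], fun z hz => ?_⟩
      · linarith [hx.2 hy.1, hx0.1, hy0.2]
      · exact ⟨by linarith [hx.2 hz, hx0.1], by linarith [hy.2 hz, hy0.2]⟩
  have hz : ∀ t, t ∉ Ioo p q → f t = 0 := fun t ht =>
    image_eq_zero_of_notMem_tsupport fun h => ht (hK h)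
  have hfi : ∀ x y, IntervalIntegrable f volume x y := fun x y =>
    hf.continuous.intervalIntegrable x y
  have hl : ∀ x y, x ≤ p → y ≤ p → ∫ t in x..y, f t = 0 := fun x y hx hy => by
    rw [intervalIntegral.integral_congr (g := fun _ => 0)]
    · simp
    · intro t ht
      exact hz t fun h => absurd h.1 (not_lt.2 (ht.2.trans (max_le hx hy)))
  have hr : ∀ x y, q ≤ x → q ≤ y → ∫ t in x..y, f t = 0 := fun x y hx hy => by
    rw [intervalIntegral.integral_congr (g := fun _ => 0)]
    · simp
    · intro t ht
      exact hz t fun h => absurd h.2 (not_lt.2 ((le_min hx hy).trans ht.1))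
  have hd : ∀ t, HasDerivAt (fun t => ∫ s in p..t, f s) (f t) t := fun t =>
    intervalIntegral.integral_hasDerivAt_right (hfi _ _)
      hf.continuous.stronglyMeasurable.stronglyMeasurableAtFilter hf.continuous.continuousAt
  have hd' : deriv (fun t => ∫ s in p..t, f s) = f := funext fun t => (hd t).deriv
  have hsupp : Function.support (fun t => ∫ s in p..t, f s) ⊆ Icc p q := by
    intro t ht
    by_contra hcon
    apply ht
    rcases lt_or_ge t p with h | h
    · exact hl p t le_rfl h.le
    · have hqt : q ≤ t := by
        by_contra! h'
        exact hcon ⟨h, h'.le⟩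
      have h1 := intervalIntegral.integral_add_adjacent_intervals (hfi 0 p) (hfi p T)
      have h2 := intervalIntegral.integral_add_adjacent_intervals (hfi p t) (hfi t T)
      rw [hl 0 p hp.le le_rfl, h0] at h1
      rw [hr t T hqt hq.le] at h2
      simp only
      linarith
  refine ⟨fun t => ∫ s in p..t, f s, ?_, HasCompactSupport.of_support_subset_isCompact
    isCompact_Icc hsupp, ?_, hd'⟩
  · rw [contDiff_infty_iff_deriv, hd']
    exact ⟨fun t => (hd t).differentiableAt, hf⟩
  · exact (closure_minimal hsupp isClosed_Icc).trans (Icc_subset_Ioo hp hq)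

/-- Any test function minus its mean times a fixed bump of mass one is an admissible derivative. So
`c` minus its average against the bump annihilates all test functions and vanishes almost
everywhere, then everywhere by continuity. -/
theorem eq_of_integral_mul_deriv_eq_zero {c : ℝ → ℝ} {T : ℝ} (hT : 0 < T)
    (hc : ContinuousOn c (Icc 0 T))
    (h : ∀ ψ : ℝ → ℝ, ContDiff ℝ ∞ ψ → HasCompactSupport ψ → tsupport ψ ⊆ Ioo 0 T →
      ∫ t in (0)..T, c t * deriv ψ t = 0) : ∀ t ∈ Icc 0 T, c t = c 0 := by
  -- Centre `T/2` and outer radius `T/4` keep the support inside `(0,T)`.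
  let B : ContDiffBump (T / 2) := ⟨T / 8, T / 4, by linarith, by linarith⟩
  let η : ℝ → ℝ := B.normed volume
  have hηs : tsupport η ⊆ Ioo 0 T := by
    rw [B.tsupport_normed_eq, Real.closedBall_eq_Icc]
    apply Icc_subset_Ioo <;> (simp only [B]; linarith)
  have hηd : ContDiff ℝ ∞ η := B.contDiff_normed
  have hηc : HasCompactSupport η := B.hasCompactSupport_normed
  have hfull : ∀ f : ℝ → ℝ, tsupport f ⊆ Ioo 0 T → ∫ t in (0)..T, f t = ∫ t, f t := fun f hf => by
    rw [intervalIntegral.integral_of_le hT.le, setIntegral_eq_integral_of_forall_compl_eq_zero]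
    intro t ht
    exact image_eq_zero_of_notMem_tsupport fun h' => ht (Ioo_subset_Ioc_self (hf h'))
  have hη1 : ∫ t in (0)..T, η t = 1 := by rw [hfull η hηs]; exact B.integral_normed
  have hci : ∀ f : ℝ → ℝ, Continuous f → IntervalIntegrable (fun t => c t * f t) volume 0 T :=
    fun f hf => by
      refine ContinuousOn.intervalIntegrable ?_
      rw [uIcc_of_le hT.le]
      exact hc.mul hf.continuousOn
  set c₀ := ∫ t in (0)..T, c t * η t with hc₀
  have key : ∀ χ : ℝ → ℝ, ContDiff ℝ ∞ χ → HasCompactSupport χ → tsupport χ ⊆ Ioo 0 T →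
      ∫ t, χ t • (c t - c₀) = 0 := fun χ hχ hχc hχs => by
    set I := ∫ t in (0)..T, χ t with hI
    have hfs : tsupport (fun t => χ t - I * η t) ⊆ tsupport χ ∪ tsupport η := by
      refine closure_minimal (fun t ht => ?_) ((isClosed_tsupport _).union (isClosed_tsupport _))
      by_contra hcon
      rw [mem_union, not_or] at hcon
      apply ht
      simp only [image_eq_zero_of_notMem_tsupport hcon.1, image_eq_zero_of_notMem_tsupport hcon.2,
        mul_zero, sub_zero]
    obtain ⟨ψ, h1, h2, h3, h4⟩ := exists_primitive_compact_support hT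
      (f := fun t => χ t - I * η t) (hχ.sub (contDiff_const.mul hηd))
      ((hχc.isCompact.union hηc.isCompact).of_isClosed_subset (isClosed_tsupport _) hfs)
      (hfs.trans (union_subset hχs hηs)) (by
        rw [intervalIntegral.integral_sub (hχ.continuous.intervalIntegrable _ _)
          ((hηd.continuous.intervalIntegrable _ _).const_mul I),
          intervalIntegral.integral_const_mul, hη1, mul_one, sub_self])
    have h5 := h ψ h1 h2 h3
    rw [h4] at h5
    have h6 : ∀ t, c t * (χ t - I * η t) = c t * χ t - I * (c t * η t) := fun t => by ring
    simp only [h6] at h5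
    rw [intervalIntegral.integral_sub (hci _ hχ.continuous)
      ((hci _ hηd.continuous).const_mul I), intervalIntegral.integral_const_mul, ← hc₀] at h5
    rw [← hfull (fun t => χ t • (c t - c₀))
      ((closure_mono (Function.support_smul_subset_left χ fun t => c t - c₀)).trans hχs)]
    have h7 : ∀ t, χ t • (c t - c₀) = c t * χ t - c₀ * χ t := fun t => by
      rw [smul_eq_mul]; ring
    simp only [h7]
    rw [intervalIntegral.integral_sub (hci _ hχ.continuous)
      ((hχ.continuous.intervalIntegrable _ _).const_mul c₀), intervalIntegral.integral_const_mul,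
      ← hI]
    linarith
  have hae := isOpen_Ioo.ae_eq_zero_of_integral_contDiff_smul_eq_zero (U := Ioo 0 T)
    (f := fun t => c t - c₀) (((hc.mono Ioo_subset_Icc_self).sub
      continuousOn_const).locallyIntegrableOn measurableSet_Ioo) key
  have hIoo : EqOn c (fun _ => c₀) (Ioo 0 T) := by
    refine Measure.eqOn_open_of_ae_eq (μ := volume) ?_ isOpen_Ioo
      (hc.mono Ioo_subset_Icc_self) continuousOn_const
    refine (ae_restrict_iff' measurableSet_Ioo).2 ?_
    filter_upwards [hae] with t ht h'
    exact sub_eq_zero.1 (ht h')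
  have hIcc : EqOn c (fun _ => c₀) (Icc 0 T) := by
    refine hIoo.of_subset_closure hc continuousOn_const Ioo_subset_Icc_self ?_
    rw [closure_Ioo hT.ne]
  intro t ht
  rw [hIcc ht, hIcc ⟨le_rfl, hT.le⟩]

/-- A continuous function with integrable weak derivative `k` is a primitive of `k`. -/
theorem eq_add_integral_of_weak_deriv {b k : ℝ → ℝ} {T : ℝ} (hT : 0 < T)
    (hb : ContinuousOn b (Icc 0 T)) (hk : IntervalIntegrable k volume 0 T)
    (h : ∀ ψ : ℝ → ℝ, ContDiff ℝ ∞ ψ → HasCompactSupport ψ → tsupport ψ ⊆ Ioo 0 T →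
      ∫ t in (0)..T, b t * deriv ψ t = -∫ t in (0)..T, k t * ψ t) :
    ∀ t ∈ Icc 0 T, b t = b 0 + ∫ s in (0)..t, k s := by
  have h0 : (0 : ℝ) ∈ uIcc 0 T := by simp
  have hP := hk.absolutelyContinuousOnInterval_intervalIntegral h0
  have hPc : ContinuousOn (fun t => ∫ s in (0)..t, k s) (Icc 0 T) := by
    have := hP.continuousOn
    rwa [uIcc_of_le hT.le] at this
  -- The primitive of `k` has weak derivative `k`, by integration by parts for absolutely continuous
  -- functions; subtracting it from `b` leaves a function with zero weak derivative.
  have := eq_of_integral_mul_deriv_eq_zero hT (hb.sub hPc) fun ψ h1 h2 h3 => by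
    have hψ := (h1.of_le (m := 1) (by simp)).contDiffOn.absolutelyContinuousOnInterval
      (a := 0) (b := T)
    have e := hP.integral_mul_deriv_eq_deriv_mul hψ
    have hψT : ψ T = 0 := image_eq_zero_of_notMem_tsupport fun h' => (h3 h').2.ne rfl
    have hψd : Continuous (deriv ψ) := h1.continuous_deriv (by simp)
    have e2 : ∫ t in (0)..T, deriv (fun t => ∫ s in (0)..t, k s) t * ψ t =
        ∫ t in (0)..T, k t * ψ t := by
      refine intervalIntegral.integral_congr_ae ?_
      filter_upwards [hk.ae_hasDerivAt_integral] with t ht ht'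
      rw [(ht (uIoc_subset_uIcc ht') 0 h0).deriv]
    rw [e2, hψT] at e
    simp only [intervalIntegral.integral_same, mul_zero, zero_mul, sub_zero, zero_sub] at e
    have i1 : IntervalIntegrable (fun t => b t * deriv ψ t) volume 0 T := by
      refine ContinuousOn.intervalIntegrable ?_
      rw [uIcc_of_le hT.le]
      exact hb.mul hψd.continuousOn
    have i2 : IntervalIntegrable (fun t => (∫ s in (0)..t, k s) * deriv ψ t) volume 0 T := by
      refine ContinuousOn.intervalIntegrable ?_
      rw [uIcc_of_le hT.le]
      exact hPc.mul hψd.continuousOn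
    simp only [Pi.sub_apply, sub_mul]
    rw [intervalIntegral.integral_sub i1 i2, h ψ h1 h2 h3, e, sub_self]
  intro t ht
  have h1 := this t ht
  simp only [Pi.sub_apply, intervalIntegral.integral_same, sub_zero] at h1
  linarith

/-! ### Integrals of series of non-negative functions -/

/-- Monotone exchange of sum and integral in `ℝ≥0∞`, without assuming pointwise convergence: where
the series diverges its real sum is `0` by convention, which only helps. -/
theorem lintegral_tsum_le {f : ℕ → ℝ → ℝ} {s t B : ℝ} (hst : s ≤ t)
    (hf : ∀ n, IntervalIntegrable (f n) volume s t) (h0 : ∀ n r, 0 ≤ f n r)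
    (hB : ∀ N, ∫ r in s..t, ∑ n ∈ Finset.range N, f n r ≤ B) :
    ∫⁻ r in Ioc s t, ENNReal.ofReal (∑' n, f n r) ≤ ENNReal.ofReal B := by
  have hf' : ∀ n, IntegrableOn (f n) (Ioc s t) := fun n => (hf n).1
  calc ∫⁻ r in Ioc s t, ENNReal.ofReal (∑' n, f n r)
      ≤ ∫⁻ r in Ioc s t, ∑' n, ENNReal.ofReal (f n r) := by
        refine lintegral_mono fun r => ?_
        by_cases hs : Summable fun n => f n r
        · exact (ENNReal.ofReal_tsum_of_nonneg (fun n => h0 n r) hs).le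
        · rw [tsum_eq_zero_of_not_summable hs]; simp
    _ = ∑' n, ∫⁻ r in Ioc s t, ENNReal.ofReal (f n r) :=
        lintegral_tsum fun n => (hf' n).aestronglyMeasurable.aemeasurable.ennreal_ofReal
    _ ≤ ENNReal.ofReal B := by
        refine ENNReal.tsum_le_of_sum_range_le fun N => ?_
        have : ∀ n ∈ Finset.range N, ∫⁻ r in Ioc s t, ENNReal.ofReal (f n r) =
            ENNReal.ofReal (∫ r in Ioc s t, f n r) := fun n _ =>
          (ofReal_integral_eq_lintegral_ofReal (hf' n) (ae_of_all _ (h0 n))).symm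
        rw [Finset.sum_congr rfl this, ← ENNReal.ofReal_sum_of_nonneg
          fun n _ => integral_nonneg (h0 n), ← integral_finsetSum _ fun n _ => hf' n]
        apply ENNReal.ofReal_le_ofReal
        rw [← intervalIntegral.integral_of_le hst]
        exact hB N

theorem integral_le_of_lintegral_le {X : Type*} [MeasurableSpace X] {ν : Measure X} {f : X → ℝ}
    {B : ℝ} (h0 : ∀ x, 0 ≤ f x) (hB : 0 ≤ B)
    (h : ∫⁻ x, ENNReal.ofReal (f x) ∂ν ≤ ENNReal.ofReal B) : ∫ x, f x ∂ν ≤ B := by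
  by_cases hi : Integrable f ν
  · rw [← ENNReal.ofReal_le_ofReal_iff hB,
      ofReal_integral_eq_lintegral_ofReal hi (ae_of_all _ h0)]
    exact h
  · rwa [integral_undef hi]

namespace PosSelfAdjOp

variable {H : Type u} [NormedAddCommGroup H] [InnerProductSpace ℝ H] [CompleteSpace H]
  {A : PosSelfAdjOp H}

/-! ### Energy estimates -/

/-- Outside `H^s` both sides are `0` by default, so no membership has to be known before
integrating. -/
theorem norm_sq_toSob_eq_tsum (s : ℝ) (a : ℕ → ℝ) :
    ‖A.toSob s a‖ ^ 2 = ∑' n, A.eigenvalue n ^ s * a n ^ 2 := by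
  by_cases h : A.MemSob s a
  · exact norm_sq_toSob h
  · have h0 : A.toSob s a = 0 := dif_neg h
    rw [tsum_eq_zero_of_not_summable h, h0, norm_zero, zero_pow two_ne_zero]

theorem sum_le_norm_sq {s : ℝ} (x : A.Sob s) (N : ℕ) :
    ∑ n ∈ Finset.range N, A.eigenvalue n ^ s * coeff x n ^ 2 ≤ ‖x‖ ^ 2 := by
  rw [Sob.norm_sq]
  exact (memSob_coeff x).sum_le_tsum _ fun n _ =>
    mul_nonneg (Real.rpow_nonneg (A.eigenvalue_pos n).le _) (sq_nonneg _)

theorem norm_sq_le_of_sum_le {s B : ℝ} (x : A.Sob s)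
    (h : ∀ N, ∑ n ∈ Finset.range N, A.eigenvalue n ^ s * coeff x n ^ 2 ≤ B) : ‖x‖ ^ 2 ≤ B := by
  rw [Sob.norm_sq]
  exact (memSob_coeff x).tsum_le_of_sum_range_le h

theorem tendsto_sum_norm_sq {s : ℝ} (x : A.Sob s) :
    Tendsto (fun N => ∑ n ∈ Finset.range N, A.eigenvalue n ^ s * coeff x n ^ 2) atTop
      (𝓝 (‖x‖ ^ 2)) := by
  rw [Sob.norm_sq]
  exact (memSob_coeff x).hasSum.tendsto_sum_nat

theorem eigenvalue_neg_mul_rate (γ : ℝ) (n : ℕ) :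
    A.eigenvalue n ^ (-γ) * A.rate γ n = A.eigenvalue n := by
  rw [rate, ← Real.rpow_add (A.eigenvalue_pos n)]
  simp

theorem eigenvalue_neg_mul_rpow (γ : ℝ) (n : ℕ) :
    A.eigenvalue n ^ (-γ) * A.eigenvalue n ^ γ = 1 := by
  rw [← Real.rpow_add (A.eigenvalue_pos n)]
  simp

/-- The weight `λ^(-γ)` cancels the factor `λ^γ` of the forcing and turns the rate `λ^(1+γ)` into
`λ`: this is the equation paired with `w`, truncated to finitely many modes so that it can be
differentiated termwise. -/
theorem hasDerivAt_energy {γ : ℝ} {w f : ℝ → ℕ → ℝ} {t : ℝ}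
    (hd : ∀ n, HasDerivAt (fun t => w t n)
      (-A.rate γ n * w t n + A.eigenvalue n ^ γ * f t n) t) (N : ℕ) :
    HasDerivAt (fun t => ∑ n ∈ Finset.range N, A.eigenvalue n ^ (-γ) * w t n ^ 2)
      (∑ n ∈ Finset.range N, (2 * (f t n * w t n) - 2 * (A.eigenvalue n * w t n ^ 2))) t := by
  refine HasDerivAt.fun_sum fun n _ => ?_
  refine (((hd n).pow 2).const_mul (A.eigenvalue n ^ (-γ))).congr_deriv ?_
  have h1 := eigenvalue_neg_mul_rate (A := A) γ n
  have h2 := eigenvalue_neg_mul_rpow (A := A) γ n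
  simp only [Nat.cast_ofNat, Nat.add_one_sub_one, pow_one]
  linear_combination (-(2 * w t n ^ 2)) * h1 + (2 * w t n * f t n) * h2

theorem energy_sub_le {γ T : ℝ} {w f : ℝ → ℕ → ℝ} (hw : ∀ n, ContinuousOn (fun t => w t n) (Icc 0 T))
    (hd : ∀ n, ∀ t ∈ Ioo 0 T, HasDerivAt (fun t => w t n)
      (-A.rate γ n * w t n + A.eigenvalue n ^ γ * f t n) t) {s t : ℝ} {φ : ℝ → ℝ} (hs : 0 ≤ s)
    (hst : s ≤ t) (ht : t ≤ T) (hφ : IntegrableOn φ (Icc s t)) (N : ℕ)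
    (h : ∀ r ∈ Ioo s t, ∑ n ∈ Finset.range N,
      (2 * (f r n * w r n) - 2 * (A.eigenvalue n * w r n ^ 2)) ≤ φ r) :
    (∑ n ∈ Finset.range N, A.eigenvalue n ^ (-γ) * w t n ^ 2) -
      (∑ n ∈ Finset.range N, A.eigenvalue n ^ (-γ) * w s n ^ 2) ≤ ∫ r in s..t, φ r := by
  refine intervalIntegral.sub_le_integral_of_hasDeriv_right_of_le hst
    (g := fun t => ∑ n ∈ Finset.range N, A.eigenvalue n ^ (-γ) * w t n ^ 2) ?_
    (fun r hr => (hasDerivAt_energy (fun n => hd n r ⟨hs.trans_lt hr.1, hr.2.trans_le ht⟩)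
      N).hasDerivWithinAt) hφ h
  exact continuousOn_finsetSum _ fun n _ => continuousOn_const.mul
    (((hw n).mono (Icc_subset_Icc hs ht)).pow 2)

/-- The rate of decay in the dissipative estimates. -/
noncomputable def decayRate (A : PosSelfAdjOp H) (γ : ℝ) : ℝ := A.eigenvalue 0 ^ (1 + γ)

theorem decayRate_pos (γ : ℝ) : 0 < A.decayRate γ := Real.rpow_pos_of_pos (A.eigenvalue_pos 0) _

/-- Young's inequality with parameter `λ₀`, spending one of the two copies of the dissipation. -/
theorem two_mul_sub_le (n : ℕ) (x y : ℝ) :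
    2 * (x * y) - 2 * (A.eigenvalue n * y ^ 2) ≤
      x ^ 2 / A.eigenvalue 0 - A.eigenvalue n * y ^ 2 := by
  have h0 := A.eigenvalue_pos 0
  have h1 := A.eigenvalue_zero_le n
  have h2 : 2 * (x * y) ≤ x ^ 2 / A.eigenvalue 0 + A.eigenvalue 0 * y ^ 2 := by
    have : x ^ 2 / A.eigenvalue 0 + A.eigenvalue 0 * y ^ 2 - 2 * (x * y) =
        (x - A.eigenvalue 0 * y) ^ 2 / A.eigenvalue 0 := by field_simp; ring
    have := div_nonneg (sq_nonneg (x - A.eigenvalue 0 * y)) h0.le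
    linarith
  have h3 := mul_le_mul_of_nonneg_right h1 (sq_nonneg y)
  linarith

theorem sum_two_mul_sub_le {x y : ℕ → ℝ} {G : ℝ} (hx : L2Bound x G) (N : ℕ) :
    ∑ n ∈ Finset.range N, (2 * (x n * y n) - 2 * (A.eigenvalue n * y n ^ 2)) ≤
      G ^ 2 / A.eigenvalue 0 - ∑ n ∈ Finset.range N, A.eigenvalue n * y n ^ 2 := by
  refine (Finset.sum_le_sum fun n _ => two_mul_sub_le n (x n) (y n)).trans ?_
  rw [Finset.sum_sub_distrib, ← Finset.sum_div]
  have := div_le_div_of_nonneg_right (hx.2 N) (A.eigenvalue_pos 0).le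
  linarith

/-- Poincaré's inequality mode by mode: the `H^1` norm controls the `H^{-γ}` norm since `λ₀^(1+γ)
λ^(-γ) ≤ λ`. -/
theorem decayRate_mul_sum_le {γ : ℝ} (hγ : 0 ≤ γ) (y : ℕ → ℝ) (N : ℕ) :
    A.decayRate γ * ∑ n ∈ Finset.range N, A.eigenvalue n ^ (-γ) * y n ^ 2 ≤
      ∑ n ∈ Finset.range N, A.eigenvalue n * y n ^ 2 := by
  rw [Finset.mul_sum]
  refine Finset.sum_le_sum fun n _ => ?_
  have h1 : A.decayRate γ ≤ A.rate γ n :=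
    Real.rpow_le_rpow (A.eigenvalue_pos 0).le (A.eigenvalue_zero_le n) (by linarith)
  have h2 := mul_nonneg (Real.rpow_nonneg (A.eigenvalue_pos n).le (-γ)) (sq_nonneg (y n))
  have h3 := mul_le_mul_of_nonneg_right h1 h2
  have h4 := eigenvalue_neg_mul_rate (A := A) γ n
  linear_combination h3 + y n ^ 2 * h4

namespace IsMild

variable {γ : ℝ} {F : H → H} {g : H} {T M : ℝ} {u : ℝ → A.Sob (-γ)}

theorem norm_sq_le (hγ : 0 ≤ γ) (hu : A.IsMild γ F g T u) (hM : ∀ v, ‖F v‖ ≤ M)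
    (hF : Continuous F) {t : ℝ} (ht : t ∈ Icc 0 T) :
    ‖u t‖ ^ 2 ≤ Real.exp (-A.decayRate γ * t) * ‖u 0‖ ^ 2 +
      (‖g‖ + M) ^ 2 / (A.eigenvalue 0 * A.decayRate γ) := by
  refine norm_sq_le_of_sum_le _ fun N => ?_
  set α := A.decayRate γ
  have hα : 0 < α := decayRate_pos γ
  have h0 := A.eigenvalue_pos 0
  set K := (‖g‖ + M) ^ 2 / (A.eigenvalue 0 * α) with hK
  have hK0 : 0 ≤ K := by positivity
  set Y : ℝ → ℝ := fun t => ∑ n ∈ Finset.range N, A.eigenvalue n ^ (-γ) * coeff (u t) n ^ 2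
    with hY
  -- The truncated energy satisfies `Y' ≤ α(K - Y)`, where `K` is the equilibrium level; `exp(αt)`
  -- is the integrating factor. `K` does not depend on the truncation.
  have hanti : AntitoneOn (fun t => Real.exp (α * t) * (Y t - K)) (Icc 0 T) := by
    have hder : ∀ t ∈ Ioo 0 T, ∃ y', HasDerivAt Y y' t ∧ y' ≤ α * (K - Y t) := fun t ht => by
      refine ⟨_, hasDerivAt_energy (fun n => hu.hasDerivAt_coeff hγ hM hF n ht) N, ?_⟩
      refine (sum_two_mul_sub_le ((hu.boundedForcing hM hF).bound t
        (Ioo_subset_Ioc_self ht)) N).trans ?_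
      have h1 := decayRate_mul_sum_le (A := A) hγ (coeff (u t)) N
      have h2 : α * K = (‖g‖ + M) ^ 2 / A.eigenvalue 0 := by rw [hK]; field_simp
      rw [mul_sub, h2]
      linarith
    have hder2 : ∀ t ∈ Ioo 0 T, ∃ z', HasDerivAt (fun t => Real.exp (α * t) * (Y t - K)) z' t ∧
        z' ≤ 0 := fun t ht => by
      obtain ⟨y', h1, h2⟩ := hder t ht
      refine ⟨_, (((hasDerivAt_id t).const_mul α).exp).mul (h1.sub_const K), ?_⟩
      have h3 := Real.exp_pos (α * t)
      simp only [id]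
      nlinarith
    refine antitoneOn_of_deriv_nonpos (convex_Icc 0 T) ?_ ?_ ?_
    · refine ContinuousOn.mul (by fun_prop) (ContinuousOn.sub ?_ continuousOn_const)
      exact continuousOn_finsetSum _ fun n _ => continuousOn_const.mul
        ((hu.continuousOn_coeff n).pow 2)
    · rw [interior_Icc]
      intro t ht
      obtain ⟨z', h1, -⟩ := hder2 t ht
      exact h1.differentiableAt.differentiableWithinAt
    · rw [interior_Icc]
      intro t ht
      obtain ⟨z', h1, h2⟩ := hder2 t ht
      rwa [h1.deriv]
  have h1 := hanti ⟨le_rfl, ht.1.trans ht.2⟩ ht ht.1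
  simp only [mul_zero, Real.exp_zero, one_mul] at h1
  have h2 : Y 0 ≤ ‖u 0‖ ^ 2 := sum_le_norm_sq (u 0) N
  have h3 : Real.exp (-α * t) * Real.exp (α * t) = 1 := by rw [← Real.exp_add]; simp
  have h4 := Real.exp_pos (-α * t)
  have h5 := mul_le_mul_of_nonneg_left h1 h4.le
  rw [← mul_assoc, h3, one_mul] at h5
  have h6 := mul_le_mul_of_nonneg_left h2 h4.le
  have h7 := mul_nonneg h4.le hK0
  change Y t ≤ _
  linarith

/-- Integrate the truncated energy inequality, discard the energy at the final time, and let the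
truncation go to infinity by `lintegral_tsum_le`. -/
theorem lintegral_norm_sq_le (hγ : 0 ≤ γ) (hu : A.IsMild γ F g T u) (hM : ∀ v, ‖F v‖ ≤ M)
    (hF : Continuous F) {s t : ℝ} (hs : 0 ≤ s) (hst : s ≤ t) (ht : t ≤ T) :
    ∫⁻ r in Ioc s t, ENNReal.ofReal (‖A.toSob 1 (coeff (u r))‖ ^ 2) ≤
      ENNReal.ofReal (‖u s‖ ^ 2 + (t - s) * ((‖g‖ + M) ^ 2 / A.eigenvalue 0)) := by
  simp only [norm_sq_toSob_eq_tsum, Real.rpow_one]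
  have hc : ∀ n, ContinuousOn (fun r => A.eigenvalue n * coeff (u r) n ^ 2) (Icc s t) := fun n =>
    continuousOn_const.mul (((hu.continuousOn_coeff n).mono (Icc_subset_Icc hs ht)).pow 2)
  refine lintegral_tsum_le hst (fun n => ?_) (fun n r =>
    mul_nonneg (A.eigenvalue_pos n).le (sq_nonneg _)) fun N => ?_
  · refine ContinuousOn.intervalIntegrable ?_
    rw [uIcc_of_le hst]; exact hc n
  have hsum : ContinuousOn (fun r => ∑ n ∈ Finset.range N, A.eigenvalue n * coeff (u r) n ^ 2)
    (Icc s t) := continuousOn_finsetSum _ fun n _ => hc n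
  have h1 := energy_sub_le (A := A) (γ := γ) (w := fun r => coeff (u r))
    (fun n => hu.continuousOn_coeff n)
    (fun n r hr => hu.hasDerivAt_coeff hγ hM hF n hr) hs hst ht
    (φ := fun r => (‖g‖ + M) ^ 2 / A.eigenvalue 0 -
      ∑ n ∈ Finset.range N, A.eigenvalue n * coeff (u r) n ^ 2)
    ((continuousOn_const.sub hsum).integrableOn_Icc) N
    (fun r hr => sum_two_mul_sub_le ((hu.boundedForcing hM hF).bound r
      ⟨hs.trans_lt hr.1, hr.2.le.trans ht⟩) N)
  rw [intervalIntegral.integral_sub (by simp) (by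
    refine ContinuousOn.intervalIntegrable ?_
    rwa [uIcc_of_le hst]), intervalIntegral.integral_const, smul_eq_mul] at h1
  have h2 := sum_le_norm_sq (u s) N
  have h3 : 0 ≤ ∑ n ∈ Finset.range N, A.eigenvalue n ^ (-γ) * coeff (u t) n ^ 2 :=
    Finset.sum_nonneg fun n _ => mul_nonneg (Real.rpow_nonneg (A.eigenvalue_pos n).le _)
      (sq_nonneg _)
  linarith

theorem integral_norm_sq_le (hγ : 0 ≤ γ) (hu : A.IsMild γ F g T u) (hM : ∀ v, ‖F v‖ ≤ M)
    (hF : Continuous F) {s t : ℝ} (hs : 0 ≤ s) (hst : s ≤ t) (ht : t ≤ T) :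
    ∫ r in s..t, ‖A.toSob 1 (coeff (u r))‖ ^ 2 ≤
      ‖u s‖ ^ 2 + (t - s) * ((‖g‖ + M) ^ 2 / A.eigenvalue 0) := by
  rw [intervalIntegral.integral_of_le hst]
  refine integral_le_of_lintegral_le (fun _ => sq_nonneg _) ?_
    (hu.lintegral_norm_sq_le hγ hM hF hs hst ht)
  have := A.eigenvalue_pos 0
  have := sub_nonneg.2 hst
  positivity

theorem memSob_two (hγ : 0 ≤ γ) (hu : A.IsMild γ F g T u) (hM : ∀ v, ‖F v‖ ≤ M) {L : ℝ≥0}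
    (hL : LipschitzWith L F) {t : ℝ} (ht : t ∈ Ioc 0 T) : A.MemSob 2 (coeff (u t)) := by
  rcases le_total t 1 with h | h
  · exact MemSob.of_l2Bound (hu.smooth_bound hγ hM hL ht.1 h ht.2)
  -- Beyond time `1`, restart at `t - 1` and smooth over one unit.
  · have h1 := (hu.shift hM hL.continuous (sub_nonneg.2 h)).smooth_bound hγ hM hL one_pos le_rfl
      (by linarith [ht.2])
    rw [sub_add_cancel] at h1
    exact MemSob.of_l2Bound h1

end IsMild

/-! ### Weak solutions are mild -/

theorem toH_smul_single (c : ℝ) (n : ℕ) : A.toH (c • Pi.single n 1) = c • A.eigenbasis n := by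
  have h : Memℓp (c • Pi.single n 1 : ℕ → ℝ) 2 :=
    MemSob.memℓp (A := A) le_rfl ((A.sobSubmodule 0).smul_mem c (memSob_single 0 n))
  apply A.eigenbasis.repr.injective
  ext m
  rw [repr_toH h, map_smul, HilbertBasis.repr_self]
  simp [lp.single_apply]

theorem power_smul_single (r c : ℝ) (n : ℕ) :
    A.power r (c • Pi.single n 1) = (A.eigenvalue n ^ r * c) • Pi.single n 1 := by
  funext m
  rcases eq_or_ne m n with rfl | h
  · simp [power]
  · simp [power, h]

theorem inner_toH_smul_single (v : H) (c : ℝ) (n : ℕ) :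
    ⟪v, A.toH (c • Pi.single n 1)⟫_ℝ = A.eigenbasis.repr v n * c := by
  rw [toH_smul_single, inner_smul_right, HilbertBasis.repr_apply_apply, real_inner_comm, mul_comm]

namespace IsSolution

variable {γ : ℝ} {F : H → H} {g : H} {T M : ℝ} {u : ℝ → A.Sob (-γ)}

/-- The weak equation tested with `χ(t) eₙ`. -/
theorem weak_coeff (hu : A.IsSolution γ F g T u) (n : ℕ) {χ : ℝ → ℝ} (h1 : ContDiff ℝ ∞ χ)
    (h2 : HasCompactSupport χ) (h3 : tsupport χ ⊆ Ioo 0 T) :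
    -(∫ t in Ioo 0 T, coeff (u t) n * (A.eigenvalue n ^ (-γ) * deriv χ t)) +
      ∫ t in Ioo 0 T, coeff (u t) n * (A.eigenvalue n * χ t) =
      ∫ t in Ioo 0 T, A.forcing F g (fun s => coeff (u s)) t n * χ t := by
  have hc : ∀ c : ℝ, coeff (c • A.toSob 2 (Pi.single n 1)) = c • Pi.single n 1 := fun c => by
    rw [map_smul, coeff_toSob (memSob_single 2 n)]
  have hd : ∀ t, deriv (fun t => χ t • A.toSob 2 (Pi.single n 1)) t =
      deriv χ t • A.toSob 2 (Pi.single n 1) := fun t =>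
    deriv_smul_const (h1.differentiable (by simp) t) _
  have hsub : tsupport (fun t => χ t • A.toSob 2 (Pi.single n 1)) ⊆ tsupport χ :=
    closure_mono (Function.support_smul_subset_left χ _)
  have hw := hu.weak (fun t => χ t • A.toSob 2 (Pi.single n 1)) (h1.smul contDiff_const)
    (h2.of_isClosed_subset (isClosed_tsupport _) hsub) (hsub.trans h3)
  have hmem : ∀ᵐ t ∂volume.restrict (Ioo 0 T),
      A.eigenbasis.repr (A.toH (coeff (u t))) n = coeff (u t) n := by
    filter_upwards [hu.ae_mem] with t ht
    rw [repr_toH (ht.memℓp zero_le_one)]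
  simp only [hd, hc, power_smul_single, inner_toH_smul_single, Real.rpow_one] at hw
  have e : ∀ k : ℝ → ℝ, ∫ t in Ioo 0 T, A.eigenbasis.repr (A.toH (coeff (u t))) n * k t =
      ∫ t in Ioo 0 T, coeff (u t) n * k t := fun k =>
    integral_congr_ae (hmem.mono fun t ht => congrArg (· * k t) ht)
  rw [e, e] at hw
  exact hw

/-- Mode by mode, `exp(μt) u_n` has weak derivative `λ^γ exp(μt) f`, so Duhamel's formula follows by
integration. It holds at every time, not only almost everywhere, because `u` is continuous into
`H^{-γ}`. -/
theorem isMild (hγ : 0 ≤ γ) (hu : A.IsSolution γ F g T u) (hT : 0 < T) (hM : ∀ v, ‖F v‖ ≤ M)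
    (hF : Continuous F) : A.IsMild γ F g T u := by
  have hcont : ∀ n, ContinuousOn (fun t => coeff (u t) n) (Icc 0 T) := fun n =>
    (coeffCLM A (-γ) n).continuous.comp_continuousOn hu.continuousOn
  have hh : BoundedForcing T (‖g‖ + M) (A.forcing F g fun s => coeff (u s)) :=
    boundedForcing_of_continuousOn hM hF g (fun n =>
      ((hcont n).mono Ioc_subset_Icc_self).aestronglyMeasurable measurableSet_Ioc) (by
      rw [← Measure.restrict_congr_set Ioo_ae_eq_Ioc]
      filter_upwards [hu.ae_mem] with t ht
      exact ht.memℓp zero_le_one)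
  have hform : ∀ t ∈ Icc 0 T, coeff (u t) = duhamel (A.rate γ) (γ / (1 + γ)) (coeff (u 0))
      (A.forcing F g fun s => coeff (u s)) t := by
    intro t ht
    funext n
    set f : ℝ → ℝ := fun t => A.forcing F g (fun s => coeff (u s)) t n with hf
    set μ := A.rate γ n with hμ
    have hfi : IntervalIntegrable f volume 0 T := hh.intervalIntegrable n le_rfl hT.le le_rfl
    have key := eq_add_integral_of_weak_deriv hT
      (b := fun t => Real.exp (μ * t) * coeff (u t) n)
      (k := fun t => A.rate γ n ^ (γ / (1 + γ)) * Real.exp (μ * t) * f t)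
      (ContinuousOn.mul (by fun_prop) (hcont n)) (hfi.continuousOn_mul (by fun_prop))
      (fun ψ h1 h2 h3 => by
        -- The integrating factor goes into the test function; its derivative then produces a term
        -- cancelling the one from `A`.
        have hw := hu.weak_coeff n (χ := fun t => Real.exp (μ * t) * ψ t)
          (ContDiff.mul (by fun_prop) h1) (h2.mul_left) ((tsupport_mul_subset_right).trans h3)
        have hd : ∀ t, deriv (fun t => Real.exp (μ * t) * ψ t) t =
            μ * Real.exp (μ * t) * ψ t + Real.exp (μ * t) * deriv ψ t := fun t => by
          have hψ := (h1.differentiable (by simp) t).hasDerivAt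
          have h : HasDerivAt (fun t => Real.exp (μ * t) * ψ t) _ t :=
            (((hasDerivAt_id t).const_mul μ).exp).mul hψ
          rw [h.deriv]
          simp only [id]
          ring
        have hψc := h1.continuous
        have hψd : Continuous (deriv ψ) := h1.continuous_deriv (by simp)
        have e : ∀ t, coeff (u t) n * (A.eigenvalue n ^ (-γ) *
            (μ * Real.exp (μ * t) * ψ t + Real.exp (μ * t) * deriv ψ t)) =
            coeff (u t) n * (A.eigenvalue n * (Real.exp (μ * t) * ψ t)) +
            A.eigenvalue n ^ (-γ) * (Real.exp (μ * t) * coeff (u t) n * deriv ψ t) := fun t => by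
          have := eigenvalue_neg_mul_rate (A := A) γ n
          linear_combination (coeff (u t) n * (Real.exp (μ * t) * ψ t)) * this
        simp only [← integral_Ioc_eq_integral_Ioo, ← intervalIntegral.integral_of_le hT.le,
          hd, e] at hw
        have ci : ∀ k : ℝ → ℝ, Continuous k →
            IntervalIntegrable (fun t => coeff (u t) n * k t) volume 0 T := fun k hk => by
          refine ContinuousOn.intervalIntegrable ?_
          rw [uIcc_of_le hT.le]
          exact (hcont n).mul hk.continuousOn
        have ci2 : IntervalIntegrable
            (fun t => Real.exp (μ * t) * coeff (u t) n * deriv ψ t) volume 0 T := by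
          have := ci (fun t => Real.exp (μ * t) * deriv ψ t) (by fun_prop)
          refine this.congr fun t _ => ?_
          ring
        rw [intervalIntegral.integral_add (ci _ (by fun_prop)) (ci2.const_mul _),
          intervalIntegral.integral_const_mul] at hw
        have e3 : ∀ t, A.rate γ n ^ (γ / (1 + γ)) * Real.exp (μ * t) * f t * ψ t =
            A.eigenvalue n ^ γ * (f t * (Real.exp (μ * t) * ψ t)) := fun t => by
          rw [rate_rpow_theta hγ]; ring
        simp only [e3]
        rw [intervalIntegral.integral_const_mul]
        have e4 := eigenvalue_neg_mul_rpow (A := A) γ n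
        linear_combination (-(A.eigenvalue n ^ γ)) * hw -
          (∫ t in (0)..T, Real.exp (μ * t) * coeff (u t) n * deriv ψ t) * e4) t ht
    simp only [mul_zero, Real.exp_zero, one_mul] at key
    rw [BoundedForcing.duhamel_eq_exp_mul, ← key, ← mul_assoc, ← Real.exp_add]
    simp [hμ]
  refine ⟨hu.continuousOn, fun t ht => ?_, hform⟩
  rw [hform t (Ioc_subset_Icc_self ht)]
  exact memℓp_two_of_summable (hh.duhamel_bound (rate_pos (A := A) γ) (theta_nonneg hγ)
    (theta_lt_one hγ) ht.1 ht.2 (l2Bound_rate hγ (u 0))).summable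

end IsSolution

end PosSelfAdjOp

namespace PosSelfAdjOp

variable {H : Type u} [NormedAddCommGroup H] [InnerProductSpace ℝ H] [CompleteSpace H]
  {A : PosSelfAdjOp H}

/-! ### Mild solutions are weak -/

namespace IsMild

variable {γ : ℝ} {F : H → H} {g : H} {T M : ℝ} {u : ℝ → A.Sob (-γ)}

theorem ae_mem_and_memLp (hγ : 0 ≤ γ) (hu : A.IsMild γ F g T u) (hT : 0 < T) (hM : ∀ v, ‖F v‖ ≤ M)
    {L : ℝ≥0} (hL : LipschitzWith L F) :
    (∀ᵐ t ∂volume.restrict (Ioo 0 T), A.MemSob 1 (coeff (u t))) ∧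
      MemLp (fun t => A.toSob 1 (coeff (u t))) 2 (volume.restrict (Ioo 0 T)) := by
  have h1 : ∀ᵐ t ∂volume.restrict (Ioo 0 T), A.MemSob 1 (coeff (u t)) :=
    (ae_restrict_iff' measurableSet_Ioo).2 (ae_of_all _ fun t ht =>
      (hu.memSob_two hγ hM hL (Ioo_subset_Ioc_self ht)).mono one_le_two)
  have h2 : AEStronglyMeasurable (fun t => A.toSob 1 (coeff (u t)))
      (volume.restrict (Ioo 0 T)) := aestronglyMeasurable_of_coeff fun n =>
    (((hu.continuousOn_coeff n).mono Ioo_subset_Icc_self).aestronglyMeasurable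
      measurableSet_Ioo).congr (h1.mono fun t ht => by simp only [coeff_toSob ht])
  refine ⟨h1, (memLp_two_iff_integrable_sq_norm h2).2 ⟨h2.norm.pow 2, ?_⟩⟩
  rw [hasFiniteIntegral_iff_ofReal (ae_of_all _ fun _ => sq_nonneg _),
    Measure.restrict_congr_set Ioo_ae_eq_Ioc]
  exact (hu.lintegral_norm_sq_le hγ hM hL.continuous le_rfl hT.le le_rfl).trans_lt
    ENNReal.ofReal_lt_top

/-- The integrand is the derivative of `-λ^(-γ) u_n χ`, which vanishes at both ends. -/
theorem integral_coeff_eq_zero (hγ : 0 ≤ γ) (hu : A.IsMild γ F g T u) (hT : 0 < T)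
    (hM : ∀ v, ‖F v‖ ≤ M) (hF : Continuous F) (n : ℕ) {χ : ℝ → ℝ} (hχ : ContDiff ℝ 1 χ)
    (h0 : χ 0 = 0) (hχT : χ T = 0) :
    ∫ t in (0)..T, (-(coeff (u t) n * (A.eigenvalue n ^ (-γ) * deriv χ t)) +
      coeff (u t) n * (A.eigenvalue n * χ t) -
      A.forcing F g (fun s => coeff (u s)) t n * χ t) = 0 := by
  have hd : ∀ t ∈ Ioo 0 T, HasDerivAt
      (fun t => -(A.eigenvalue n ^ (-γ) * (coeff (u t) n * χ t)))
      (-(coeff (u t) n * (A.eigenvalue n ^ (-γ) * deriv χ t)) +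
        coeff (u t) n * (A.eigenvalue n * χ t) -
        A.forcing F g (fun s => coeff (u s)) t n * χ t) t := fun t ht => by
    have h1 := (((hu.hasDerivAt_coeff hγ hM hF n ht).mul
      (hχ.differentiable one_ne_zero t).hasDerivAt).const_mul (A.eigenvalue n ^ (-γ))).neg
    refine HasDerivAt.congr_deriv h1 ?_
    have e1 := eigenvalue_neg_mul_rate (A := A) γ n
    have e2 := eigenvalue_neg_mul_rpow (A := A) γ n
    linear_combination (coeff (u t) n * χ t) * e1 -
      (A.forcing F g (fun s => coeff (u s)) t n * χ t) * e2
  have hχd : Continuous (deriv χ) := hχ.continuous_deriv le_rfl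
  have hχc := hχ.continuous
  have hc := hu.continuousOn_coeff n
  rw [intervalIntegral.integral_eq_sub_of_hasDerivAt_of_le hT.le _ hd, h0, hχT]
  · simp
  · refine IntervalIntegrable.sub (ContinuousOn.intervalIntegrable ?_)
      (((hu.boundedForcing hM hF).intervalIntegrable n le_rfl hT.le le_rfl).mul_continuousOn
        hχc.continuousOn)
    rw [uIcc_of_le hT.le]
    fun_prop
  · fun_prop

/-- The `H` norm grows at worst like `t^(-θ/2)` at the origin, which is integrable. This supplies
the majorant in `isSolution`. -/
theorem integrableOn_toH (hγ : 0 ≤ γ) (hu : A.IsMild γ F g T u)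
    (hM : ∀ v, ‖F v‖ ≤ M) (hF : Continuous F) :
    IntegrableOn (fun t => A.toH (coeff (u t))) (Ioo 0 T) := by
  have h1 : IntervalIntegrable (fun t => t ^ (-(γ / (1 + γ) / 2)) * ‖u 0‖ +
      t ^ (1 - γ / (1 + γ)) / (1 - γ / (1 + γ)) * (‖g‖ + M)) volume 0 T := by
    have hθ0 := theta_nonneg hγ
    have hθ1 := theta_lt_one hγ
    exact ((intervalIntegral.intervalIntegrable_rpow' (by linarith)).mul_const _).add
      (((intervalIntegral.intervalIntegrable_rpow' (by linarith)).div_const _).mul_const _)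
  refine Integrable.mono' (h1.1.mono_set Ioo_subset_Ioc_self)
    (((hu.continuousOn_toH hγ hM hF).mono Ioo_subset_Ioc_self).aestronglyMeasurable
      measurableSet_Ioo) ((ae_restrict_iff' measurableSet_Ioo).2 (ae_of_all _ fun t ht => ?_))
  rw [hu.formula t (Ioo_subset_Icc_self ht)]
  exact norm_toH_le ((hu.boundedForcing hM hF).duhamel_bound (rate_pos (A := A) γ)
    (theta_nonneg hγ) (theta_lt_one hγ) ht.1 ht.2.le (l2Bound_rate hγ (u 0)))

/-- Each mode satisfies the tested equation by `integral_coeff_eq_zero`; finite sums of modes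
converge to the pairings in `H` under the integral sign. -/
theorem isSolution (hγ : 0 ≤ γ) (hu : A.IsMild γ F g T u) (hT : 0 < T) (hM : ∀ v, ‖F v‖ ≤ M)
    {L : ℝ≥0} (hL : LipschitzWith L F) : A.IsSolution γ F g T u := by
  obtain ⟨hae, hLp⟩ := hu.ae_mem_and_memLp hγ hT hM hL
  refine ⟨hu.continuousOn, hae, hLp, fun φ hφ hφc hφs => ?_⟩
  have hF := hL.continuous
  have hdφ : Continuous (deriv φ) := hφ.continuous_deriv (by simp)
  obtain ⟨B, hB⟩ := hφ.continuous.bounded_above_of_compact_support hφc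
  obtain ⟨B', hB'⟩ := hdφ.bounded_above_of_compact_support hφc.deriv
  have hB0 : 0 ≤ B := (norm_nonneg _).trans (hB 0)
  have hB0' : 0 ≤ B' := (norm_nonneg _).trans (hB' 0)
  have h0 := A.eigenvalue_pos 0
  set x : ℝ → H := fun t => A.toH (coeff (u t)) with hx
  set y₁ : ℝ → ℕ → ℝ := fun t => A.power (-γ) (coeff (deriv φ t)) with hy₁
  set y₂ : ℝ → ℕ → ℝ := fun t => A.power 1 (coeff (φ t)) with hy₂
  set y₃ : ℝ → ℕ → ℝ := fun t => coeff (φ t) with hy₃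
  set B₁ := A.eigenvalue 0 ^ (-γ - 2 / 2) * B' with hB₁
  set B₃ := A.eigenvalue 0 ^ ((0 : ℝ) - 2 / 2) * B with hB₃
  have b₁ : ∀ t, L2Bound (y₁ t) B₁ := fun t =>
    l2Bound_weight_mono (by linarith) ((l2Bound_coeff (deriv φ t)).mono (hB' t))
  have b₂ : ∀ t, L2Bound (y₂ t) B := fun t => by
    have := (l2Bound_coeff (φ t)).mono (hB t)
    rwa [show (2 : ℝ) / 2 = 1 by norm_num] at this
  have b₃ : ∀ t, L2Bound (y₃ t) B₃ := fun t => by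
    have := l2Bound_weight_mono (A := A) (r := 0) (by norm_num)
      ((l2Bound_coeff (φ t)).mono (hB t))
    simpa only [Real.rpow_zero, one_mul] using this
  have hxi : IntegrableOn x (Ioo 0 T) := hu.integrableOn_toH hγ hM hF
  have hFm : AEStronglyMeasurable (fun t => g - F (x t)) (volume.restrict (Ioo 0 T)) :=
    (continuous_const.sub hF).comp_aestronglyMeasurable hxi.aestronglyMeasurable
  have hzi : IntegrableOn (fun t => g - F (x t)) (Ioo 0 T) :=
    Integrable.mono' (g := fun _ => ‖g‖ + M) (integrable_const _) hFm
      (ae_of_all _ fun t => (norm_sub_le _ _).trans (by gcongr; exact hM _))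
  have hpair : ∀ (z : ℝ → H) (y : ℝ → ℕ → ℝ) (b : ℝ), IntegrableOn z (Ioo 0 T) →
      (∀ t, L2Bound (y t) b) → (∀ n, Continuous fun t => y t n) →
      IntegrableOn (fun t => ⟪z t, A.toH (y t)⟫_ℝ) (Ioo 0 T) := fun z y b hz hy hyc => by
    refine Integrable.mono' (hz.norm.mul_const b) (hz.aestronglyMeasurable.inner
      (aestronglyMeasurable_of_repr (A := A) fun n => ?_)) (ae_of_all _ fun t => ?_)
    · simp only [repr_toH_of_l2Bound (hy _)]
      exact (hyc n).aestronglyMeasurable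
    · exact (norm_inner_le_norm _ _).trans
        (mul_le_mul_of_nonneg_left (norm_toH_le (hy t)) (norm_nonneg _))
  have c₃ : ∀ n, Continuous fun t => y₃ t n := fun n =>
    (coeffCLM A 2 n).continuous.comp hφ.continuous
  have c₂ : ∀ n, Continuous fun t => y₂ t n := fun n => (c₃ n).const_mul _
  have c₁ : ∀ n, Continuous fun t => y₁ t n := fun n =>
    ((coeffCLM A 2 n).continuous.comp hdφ).const_mul _
  have i₁ := hpair x y₁ B₁ hxi b₁ c₁
  have i₂ := hpair x y₂ B hxi b₂ c₂
  have i₃ := hpair _ y₃ B₃ hzi b₃ c₃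
  set a : ℕ → ℝ → ℝ := fun n t => -(coeff (u t) n * y₁ t n) + coeff (u t) n * y₂ t n -
    A.forcing F g (fun s => coeff (u s)) t n * y₃ t n with ha
  have hxa : ∀ t ∈ Ioo 0 T, ∀ n, A.eigenbasis.repr (x t) n = coeff (u t) n := fun t ht n =>
    repr_toH (hu.memℓp t (Ioo_subset_Ioc_self ht)) n
  have hlim : ∀ t ∈ Ioo 0 T, Tendsto (fun N => ∑ n ∈ Finset.range N, a n t) atTop
      (𝓝 (-⟪x t, A.toH (y₁ t)⟫_ℝ + ⟪x t, A.toH (y₂ t)⟫_ℝ - ⟪g - F (x t), A.toH (y₃ t)⟫_ℝ)) :=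
    fun t ht => by
      have s₁ := hasSum_inner (A := A) (x t) (A.toH (y₁ t))
      have s₂ := hasSum_inner (A := A) (x t) (A.toH (y₂ t))
      have s₃ := hasSum_inner (A := A) (g - F (x t)) (A.toH (y₃ t))
      simp only [hxa t ht, repr_toH_of_l2Bound (b₁ t), repr_toH_of_l2Bound (b₂ t),
        repr_toH_of_l2Bound (b₃ t)] at s₁ s₂ s₃
      exact ((s₁.neg.add s₂).sub s₃).tendsto_sum_nat
  have hzero : ∀ n, IntegrableOn (a n) (Ioo 0 T) ∧ ∫ t in Ioo 0 T, a n t = 0 := fun n => by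
    have hχ : ContDiff ℝ 1 fun t => y₃ t n :=
      (coeffCLM A 2 n).contDiff.comp (hφ.of_le (by simp))
    have hz : ∀ t, t ∉ Ioo 0 T → y₃ t n = 0 := fun t ht => by
      simp only [hy₃]
      rw [image_eq_zero_of_notMem_tsupport fun h => ht (hφs h), map_zero, Pi.zero_apply]
    have hder : ∀ t, deriv (fun t => y₃ t n) t = coeff (deriv φ t) n := fun t =>
      ((coeffCLM A 2 n).hasFDerivAt.comp_hasDerivAt t
        (hφ.differentiable (by simp) t).hasDerivAt).deriv
    have h1 := hu.integral_coeff_eq_zero hγ hT hM hF n hχ (hz 0 (by simp)) (hz T (by simp))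
    simp only [hder] at h1
    rw [intervalIntegral.integral_of_le hT.le, integral_Ioc_eq_integral_Ioo] at h1
    have ci : ∀ k : ℝ → ℝ, Continuous k → IntegrableOn (fun t => coeff (u t) n * k t) (Ioo 0 T) :=
      fun k hk => (((hu.continuousOn_coeff n).mul hk.continuousOn).integrableOn_Icc).mono_set
        Ioo_subset_Icc_self
    refine ⟨((ci _ (c₁ n)).neg.add (ci _ (c₂ n))).sub ?_, ?_⟩
    · exact (((hu.boundedForcing hM hF).intervalIntegrable n le_rfl hT.le
        le_rfl).mul_continuousOn (c₃ n).continuousOn).1.mono_set Ioo_subset_Ioc_self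
    · simpa only [ha, hy₁, hy₂, hy₃, power, Real.rpow_one] using h1
  -- Cauchy–Schwarz bounds every partial sum by products of `H` norms, uniformly in the number of
  -- modes. The versions with a sign change provide the lower bounds.
  have hdom := tendsto_integral_of_dominated_convergence (μ := volume.restrict (Ioo 0 T))
    (F := fun N t => ∑ n ∈ Finset.range N, a n t)
    (fun t => ‖x t‖ * B₁ + ‖x t‖ * B + ‖g - F (x t)‖ * B₃)
    (fun N => (integrable_finsetSum _ fun n _ => (hzero n).1).aestronglyMeasurable)
    (((hxi.norm.mul_const _).add (hxi.norm.mul_const _)).add (hzi.norm.mul_const _))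
    (fun N => (ae_restrict_iff' measurableSet_Ioo).2 (ae_of_all _ fun t ht => by
      have bx : L2Bound (fun n => coeff (u t) n) ‖x t‖ := by
        simpa only [hxa t ht] using l2Bound_repr (A := A) (x t)
      have bz := l2Bound_repr (A := A) (g - F (x t))
      simp only [ha, Finset.sum_sub_distrib, Finset.sum_add_distrib, Finset.sum_neg_distrib]
      have p₁ := bx.sum_mul_le (b₁ t) N
      have p₂ := bx.sum_mul_le (b₂ t) N
      have p₃ := bz.sum_mul_le (b₃ t) N
      have q₁ := bx.neg.sum_mul_le (b₁ t) N
      have q₂ := bx.neg.sum_mul_le (b₂ t) N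
      have q₃ := bz.neg.sum_mul_le (b₃ t) N
      simp only [neg_mul, Finset.sum_neg_distrib] at q₁ q₂ q₃
      change |-(∑ n ∈ Finset.range N, coeff (u t) n * y₁ t n) +
        ∑ n ∈ Finset.range N, coeff (u t) n * y₂ t n -
        ∑ n ∈ Finset.range N, A.eigenbasis.repr (g - F (x t)) n * y₃ t n| ≤ _
      rw [abs_le]
      constructor <;> linarith))
    ((ae_restrict_iff' measurableSet_Ioo).2 (ae_of_all _ hlim))
  have hN : ∀ N, ∫ t in Ioo 0 T, ∑ n ∈ Finset.range N, a n t = 0 := fun N => by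
    rw [integral_finsetSum _ fun n _ => (hzero n).1]
    exact Finset.sum_eq_zero fun n _ => (hzero n).2
  simp only [hN] at hdom
  have hfin := tendsto_nhds_unique hdom tendsto_const_nhds
  have e : 0 = -(∫ t in Ioo 0 T, ⟪x t, A.toH (y₁ t)⟫_ℝ) + (∫ t in Ioo 0 T, ⟪x t, A.toH (y₂ t)⟫_ℝ) -
      ∫ t in Ioo 0 T, ⟪g - F (x t), A.toH (y₃ t)⟫_ℝ :=
    hfin.symm.trans ((integral_sub (i₁.neg.add i₂) i₃).trans (congrArg (· - _)
      ((integral_add i₁.neg i₂).trans (congrArg (· + _) (integral_neg _)))))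
  linarith

end IsMild

end PosSelfAdjOp

/-- Gronwall's inequality in integral form. -/
theorem le_mul_exp_of_le_add_integral {y : ℝ → ℝ} {T c K : ℝ} (hK : 0 ≤ K)
    (hy : ContinuousOn y (Icc 0 T)) (h : ∀ t ∈ Icc 0 T, y t ≤ c + K * ∫ s in (0)..t, y s) :
    ∀ t ∈ Icc 0 T, y t ≤ c * Real.exp (K * t) := by
  intro t ht
  have hT : 0 ≤ T := ht.1.trans ht.2
  have hd : ∀ t ∈ Ioo 0 T, HasDerivAt (fun t => Real.exp (-K * t) * (c + K * ∫ s in (0)..t, y s))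
      (Real.exp (-K * t) * (K * (y t - (c + K * ∫ s in (0)..t, y s)))) t := fun t ht => by
    have h1 := intervalIntegral.integral_hasDerivAt_right (a := 0) (b := t) (f := y)
      (ContinuousOn.intervalIntegrable (by
        rw [uIcc_of_le ht.1.le]; exact hy.mono (Icc_subset_Icc le_rfl ht.2.le)))
      ((hy.mono Ioo_subset_Icc_self).stronglyMeasurableAtFilter isOpen_Ioo t ht)
      ((hy.mono Ioo_subset_Icc_self).continuousAt (Ioo_mem_nhds ht.1 ht.2))
    refine HasDerivAt.congr_deriv (((hasDerivAt_id t).const_mul (-K)).exp.mul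
      ((h1.const_mul K).const_add c)) ?_
    simp only [id]
    ring
  have hanti : AntitoneOn (fun t => Real.exp (-K * t) * (c + K * ∫ s in (0)..t, y s))
      (Icc 0 T) := by
    refine antitoneOn_of_deriv_nonpos (convex_Icc 0 T) ?_ ?_ ?_
    · have hi : IntegrableOn y (uIcc 0 T) := by
        rw [uIcc_of_le hT]; exact hy.integrableOn_Icc
      have := intervalIntegral.continuousOn_primitive_interval hi
      rw [uIcc_of_le hT] at this
      fun_prop
    · rw [interior_Icc]
      exact fun t ht => (hd t ht).differentiableAt.differentiableWithinAt
    · rw [interior_Icc]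
      intro t ht
      rw [(hd t ht).deriv]
      refine mul_nonpos_of_nonneg_of_nonpos (Real.exp_pos _).le
        (mul_nonpos_of_nonneg_of_nonpos hK ?_)
      linarith [h t (Ioo_subset_Icc_self ht)]
  have h1 := hanti ⟨le_rfl, hT⟩ ht ht.1
  simp only [mul_zero, Real.exp_zero, intervalIntegral.integral_same, add_zero, one_mul] at h1
  have h2 := mul_le_mul_of_nonneg_right h1 (Real.exp_pos (K * t)).le
  rw [mul_right_comm, ← Real.exp_add] at h2
  simp only [neg_mul, neg_add_cancel, Real.exp_zero, one_mul] at h2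
  exact (h t ht).trans h2

namespace PosSelfAdjOp

variable {H : Type u} [NormedAddCommGroup H] [InnerProductSpace ℝ H] [CompleteSpace H]
  {A : PosSelfAdjOp H}

/-! ### Lipschitz dependence on the initial data -/

/-- The constant in the interpolation of `ℓ²` between `H^{-γ}` and `H^1`. -/
noncomputable def interpConst (L γ : ℝ) : ℝ := L * (2 * L) ^ γ

theorem interpConst_nonneg {L : ℝ} (hL : 0 ≤ L) (γ : ℝ) : 0 ≤ interpConst L γ :=
  mul_nonneg hL (Real.rpow_nonneg (by linarith) _)

/-- If `x` is at least `2L` there is nothing to do; otherwise `(2L/x)^γ ≥ 1`. Applied with `x` an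
eigenvalue, this bounds `2L‖w‖²` by the `H^1` and `H^{-γ}` norms, with no constant that depends on
`A`. -/
theorem le_interp {L γ x : ℝ} (hL : 0 ≤ L) (hγ : 0 ≤ γ) (hx : 0 < x) :
    2 * L ≤ x + 2 * interpConst L γ * x ^ (-γ) := by
  rcases le_total (2 * L) x with h | h
  · have := mul_nonneg (interpConst_nonneg hL γ) (Real.rpow_nonneg hx.le (-γ))
    linarith
  · have h1 : 1 ≤ (2 * L) ^ γ * x ^ (-γ) := by
      rw [Real.rpow_neg hx.le, ← div_eq_mul_inv, one_le_div (Real.rpow_pos_of_pos hx γ)]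
      exact Real.rpow_le_rpow hx.le h hγ
    have h2 := mul_le_mul_of_nonneg_left h1 hL
    unfold interpConst
    linarith

namespace IsMild

variable {γ : ℝ} {F : H → H} {g : H} {T M : ℝ} {u₁ u₂ : ℝ → A.Sob (-γ)}

/-- The start is at `s > 0` because continuity into `H`, needed to integrate `‖d‖²`, is available
only there. The nonlinear term sees all modes, so the argument runs with truncations and a limit,
and the full `H^1` norm never appears. -/
theorem sub_energy_le_of_pos (hγ : 0 ≤ γ) (h₁ : A.IsMild γ F g T u₁) (h₂ : A.IsMild γ F g T u₂)
    (hM : ∀ v, ‖F v‖ ≤ M) {L : ℝ≥0} (hL : LipschitzWith L F) {s t : ℝ} (hs : 0 < s) (hst : s ≤ t)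
    (ht : t ≤ T) (m : ℕ) :
    ‖u₁ t - u₂ t‖ ^ 2 + (∫ r in s..t, ∑ n ∈ Finset.range m,
      A.eigenvalue n * coeff (u₁ r - u₂ r) n ^ 2) ≤
      ‖u₁ s - u₂ s‖ ^ 2 + 2 * interpConst L γ * ∫ r in s..t, ‖u₁ r - u₂ r‖ ^ 2 := by
  have hF := hL.continuous
  have hsub : Icc s t ⊆ Icc 0 T := Icc_subset_Icc hs.le ht
  have hsub' : Icc s t ⊆ Ioc 0 T := fun r hr => ⟨hs.trans_le hr.1, hr.2.trans ht⟩
  set w : ℝ → ℕ → ℝ := fun r => coeff (u₁ r - u₂ r) with hw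
  have hw' : ∀ r n, w r n = coeff (u₁ r) n - coeff (u₂ r) n := fun r n => by
    simp only [hw, map_sub, Pi.sub_apply]
  have hwc : ∀ n, ContinuousOn (fun r => w r n) (Icc 0 T) := fun n => by
    simp only [hw']
    exact (h₁.continuousOn_coeff n).sub (h₂.continuousOn_coeff n)
  set f : ℝ → ℕ → ℝ := fun r n => A.forcing F g (fun s => coeff (u₁ s)) r n -
    A.forcing F g (fun s => coeff (u₂ s)) r n with hf
  have hwd : ∀ n, ∀ r ∈ Ioo 0 T, HasDerivAt (fun r => w r n)
      (-A.rate γ n * w r n + A.eigenvalue n ^ γ * f r n) r := fun n r hr => by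
    simp only [hw']
    refine ((h₁.hasDerivAt_coeff hγ hM hF n hr).sub
      (h₂.hasDerivAt_coeff hγ hM hF n hr)).congr_deriv ?_
    simp only [hf]
    ring
  set d : ℝ → H := fun r => A.toH (coeff (u₁ r)) - A.toH (coeff (u₂ r)) with hd
  have hdc : ContinuousOn (fun r => ‖d r‖ ^ 2) (Icc s t) :=
    (((h₁.continuousOn_toH hγ hM hF).sub (h₂.continuousOn_toH hγ hM hF)).mono hsub').norm.pow 2
  have bw : ∀ r ∈ Icc s t, L2Bound (w r) ‖d r‖ := fun r hr => by
    have := l2Bound_toH_sub (A := A) (h₁.memℓp r (hsub' hr)) (h₂.memℓp r (hsub' hr))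
    simpa only [← hw'] using this
  have bf : ∀ r, L2Bound (f r) (L * ‖d r‖) := fun r => by
    have h3 : L2Bound (fun n => A.eigenbasis.repr (F (A.toH (coeff (u₁ r))) -
        F (A.toH (coeff (u₂ r)))) n) (L * ‖d r‖) := (l2Bound_repr _).mono (hL.norm_sub_le _ _)
    refine h3.of_abs_le fun n => le_of_eq ?_
    simp only [hf, forcing, map_sub, lp.coeFn_sub, Pi.sub_apply]
    rw [← abs_neg]
    congr 1
    ring
  have intg : ∀ {k : ℝ → ℝ}, ContinuousOn k (Icc s t) → IntervalIntegrable k volume s t :=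
    fun hk => ContinuousOn.intervalIntegrable (by rwa [uIcc_of_le hst])
  set D : ℕ → ℝ → ℝ := fun N r => ∑ n ∈ Finset.range N, A.eigenvalue n * w r n ^ 2 with hD
  have hDc : ∀ N, ContinuousOn (D N) (Icc s t) := fun N =>
    continuousOn_finsetSum _ fun n _ => continuousOn_const.mul (((hwc n).mono hsub).pow 2)
  set V : ℕ → ℝ → ℝ := fun N r => ∑ n ∈ Finset.range N, w r n ^ 2 with hV
  have hVc : ∀ N, ContinuousOn (V N) (Icc s t) := fun N =>
    continuousOn_finsetSum _ fun n _ => ((hwc n).mono hsub).pow 2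
  set Y : ℕ → ℝ → ℝ := fun N r => ∑ n ∈ Finset.range N, A.eigenvalue n ^ (-γ) * w r n ^ 2 with hY
  have hNc : ContinuousOn (fun r => ‖u₁ r - u₂ r‖ ^ 2) (Icc s t) :=
    ((h₁.continuousOn.sub h₂.continuousOn).mono hsub).norm.pow 2
  have hYlim : ∀ r, Tendsto (fun N => Y N r) atTop (𝓝 (‖u₁ r - u₂ r‖ ^ 2)) := fun r =>
    tendsto_sum_norm_sq (u₁ r - u₂ r)
  have hDmono : ∀ {N N' : ℕ}, N ≤ N' → ∫ r in s..t, D N r ≤ ∫ r in s..t, D N' r :=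
    fun {N N'} h => intervalIntegral.integral_mono_on hst (intg (hDc N)) (intg (hDc N'))
      fun r _ => Finset.sum_le_sum_of_subset_of_nonneg (Finset.range_mono h) fun n _ _ =>
        mul_nonneg (A.eigenvalue_pos n).le (sq_nonneg _)
  set K := interpConst L γ with hK
  have hL0 : (0 : ℝ) ≤ L := L.2
  have e1 : ∀ N, Y N t - Y N s ≤ (∫ r in s..t, 2 * (L * ‖d r‖ ^ 2)) - 2 * ∫ r in s..t, D N r :=
    fun N => by
      have i1 : ContinuousOn (fun r => 2 * (L * ‖d r‖ ^ 2)) (Icc s t) :=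
        continuousOn_const.mul (continuousOn_const.mul hdc)
      have i2 : ContinuousOn (fun r => 2 * D N r) (Icc s t) := continuousOn_const.mul (hDc N)
      rw [← intervalIntegral.integral_const_mul, ← intervalIntegral.integral_sub (intg i1)
        (intg i2)]
      refine energy_sub_le hwc hwd hs.le hst ht (i1.sub i2).integrableOn_Icc N fun r hr => ?_
      rw [Finset.sum_sub_distrib, ← Finset.mul_sum, ← Finset.mul_sum]
      have := (bf r).sum_mul_le (bw r (Ioo_subset_Icc_self hr)) N
      change _ ≤ 2 * (L * ‖d r‖ ^ 2) - 2 * ∑ n ∈ Finset.range N, A.eigenvalue n * w r n ^ 2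
      linarith
  -- The energies pass to the limit while the dissipation stays truncated at `N`, by monotonicity in
  -- the truncation.
  have e2 : ∀ N, ‖u₁ t - u₂ t‖ ^ 2 - ‖u₁ s - u₂ s‖ ^ 2 ≤
      (∫ r in s..t, 2 * (L * ‖d r‖ ^ 2)) - 2 * ∫ r in s..t, D N r := fun N => by
    refine le_of_tendsto ((hYlim t).sub (hYlim s)) ?_
    filter_upwards [eventually_ge_atTop N] with N' hN'
    linarith [e1 N', hDmono hN']
  have e3 : ∀ N, 2 * L * (∫ r in s..t, V N r) ≤
      (∫ r in s..t, D N r) + 2 * K * ∫ r in s..t, ‖u₁ r - u₂ r‖ ^ 2 := fun N => by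
    rw [← intervalIntegral.integral_const_mul, ← intervalIntegral.integral_const_mul,
      ← intervalIntegral.integral_add (intg (hDc N)) ((intg hNc).const_mul _)]
    refine intervalIntegral.integral_mono_on hst ((intg (hVc N)).const_mul _)
      ((intg (hDc N)).add ((intg hNc).const_mul _)) fun r _ => ?_
    have h3 : Y N r ≤ ‖u₁ r - u₂ r‖ ^ 2 := sum_le_norm_sq (u₁ r - u₂ r) N
    have h4 : 2 * L * V N r ≤ D N r + 2 * K * Y N r := by
      simp only [hV, hD, hY, Finset.mul_sum]
      rw [← Finset.sum_add_distrib]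
      refine Finset.sum_le_sum fun n _ => ?_
      have := mul_le_mul_of_nonneg_right (le_interp hL0 hγ (A.eigenvalue_pos n)) (sq_nonneg (w r n))
      rw [hK]
      linarith
    have h5 := mul_le_mul_of_nonneg_left h3 (mul_nonneg zero_le_two (interpConst_nonneg hL0 γ))
    exact h4.trans (by gcongr)
  have e4 : Tendsto (fun N => ∫ r in s..t, V N r) atTop (𝓝 (∫ r in s..t, ‖d r‖ ^ 2)) := by
    refine intervalIntegral.tendsto_integral_filter_of_dominated_convergence
      (fun r => ‖d r‖ ^ 2) (Eventually.of_forall fun N => (intg (hVc N)).aestronglyMeasurable_restrict_uIoc)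
      (Eventually.of_forall fun N => ae_of_all _ fun r hr => ?_) (intg hdc)
      (ae_of_all _ fun r hr => ?_)
    all_goals
      rw [uIoc_of_le hst] at hr
      have hr' := Ioc_subset_Icc_self hr
    · rw [Real.norm_eq_abs, abs_of_nonneg (Finset.sum_nonneg fun n _ => sq_nonneg _)]
      exact (bw r hr').2 N
    · have h3 := hasSum_inner (A := A) (d r) (d r)
      rw [real_inner_self_eq_norm_sq] at h3
      refine (h3.tendsto_sum_nat).congr fun N => Finset.sum_congr rfl fun n _ => ?_
      have h4 : A.eigenbasis.repr (d r) n = w r n := by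
        rw [hw']
        simp only [hd, map_sub, lp.coeFn_sub, Pi.sub_apply, repr_toH (h₁.memℓp r (hsub' hr')),
          repr_toH (h₂.memℓp r (hsub' hr'))]
      rw [h4, sq]
  have e5 : ∫ r in s..t, 2 * (L * ‖d r‖ ^ 2) = 2 * L * ∫ r in s..t, ‖d r‖ ^ 2 := by
    rw [intervalIntegral.integral_const_mul, intervalIntegral.integral_const_mul, mul_assoc]
  -- Interpolation consumes one of the two copies of the dissipation; the other is kept, truncated
  -- at `m`. In the limit `2L∫‖d‖²` occurs on both sides and, being finite, cancels.
  have e6 : 2 * L * (∫ r in s..t, ‖d r‖ ^ 2) ≤ ‖u₁ s - u₂ s‖ ^ 2 - ‖u₁ t - u₂ t‖ ^ 2 +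
      2 * L * (∫ r in s..t, ‖d r‖ ^ 2) - (∫ r in s..t, D m r) +
      2 * K * ∫ r in s..t, ‖u₁ r - u₂ r‖ ^ 2 := by
    refine le_of_tendsto (e4.const_mul (2 * (L : ℝ))) ?_
    filter_upwards [eventually_ge_atTop m] with N hN
    have h3 := e2 N
    rw [e5] at h3
    linarith [e3 N, hDmono hN]
  change ‖u₁ t - u₂ t‖ ^ 2 + (∫ r in s..t, D m r) ≤ _
  linarith

/-- Both sides are continuous in the initial time, since the `H` norm has disappeared from the
inequality; so it extends to the initial time `0`. -/
theorem sub_energy_le (hγ : 0 ≤ γ) (h₁ : A.IsMild γ F g T u₁) (h₂ : A.IsMild γ F g T u₂)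
    (hM : ∀ v, ‖F v‖ ≤ M) {L : ℝ≥0} (hL : LipschitzWith L F) {s t : ℝ} (hs : 0 ≤ s) (hst : s ≤ t)
    (ht : t ≤ T) (m : ℕ) :
    ‖u₁ t - u₂ t‖ ^ 2 + (∫ r in s..t, ∑ n ∈ Finset.range m,
      A.eigenvalue n * coeff (u₁ r - u₂ r) n ^ 2) ≤
      ‖u₁ s - u₂ s‖ ^ 2 + 2 * interpConst L γ * ∫ r in s..t, ‖u₁ r - u₂ r‖ ^ 2 := by
  rcases hst.eq_or_lt with rfl | hst'
  · simp
  have hsub : Icc s t ⊆ Icc 0 T := Icc_subset_Icc hs ht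
  have hNc : ContinuousOn (fun r => ‖u₁ r - u₂ r‖ ^ 2) (Icc s t) :=
    ((h₁.continuousOn.sub h₂.continuousOn).mono hsub).norm.pow 2
  have hDc : ContinuousOn (fun r => ∑ n ∈ Finset.range m,
      A.eigenvalue n * coeff (u₁ r - u₂ r) n ^ 2) (Icc s t) := by
    simp only [map_sub, Pi.sub_apply]
    exact continuousOn_finsetSum _ fun n _ => continuousOn_const.mul
      ((((h₁.continuousOn_coeff n).sub (h₂.continuousOn_coeff n)).mono hsub).pow 2)
  have prim : ∀ {k : ℝ → ℝ}, ContinuousOn k (Icc s t) →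
      ContinuousOn (fun r => ∫ x in r..t, k x) (Icc s t) := fun hk => by
    have := intervalIntegral.continuousOn_primitive_interval_left (μ := volume) (a := s) (b := t)
      (by rw [uIcc_of_le hst]; exact hk.integrableOn_Icc)
    rwa [uIcc_of_le hst] at this
  have hcl : closure (Ioo s t) = Icc s t := closure_Ioo hst'.ne
  refine le_on_closure (s := Ioo s t)
    (f := fun s => ‖u₁ t - u₂ t‖ ^ 2 + (∫ r in s..t, ∑ n ∈ Finset.range m,
      A.eigenvalue n * coeff (u₁ r - u₂ r) n ^ 2))
    (g := fun s => ‖u₁ s - u₂ s‖ ^ 2 + 2 * interpConst L γ * ∫ r in s..t, ‖u₁ r - u₂ r‖ ^ 2)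
    (fun r hr => h₁.sub_energy_le_of_pos hγ h₂ hM hL (hs.trans_lt hr.1) hr.2.le ht m) ?_ ?_ ?_
  · rw [hcl]; exact continuousOn_const.add (prim hDc)
  · rw [hcl]; exact hNc.add (continuousOn_const.mul (prim hNc))
  · rw [hcl]; exact ⟨le_rfl, hst⟩

theorem norm_sub_sq_le (hγ : 0 ≤ γ) (h₁ : A.IsMild γ F g T u₁) (h₂ : A.IsMild γ F g T u₂)
    (hM : ∀ v, ‖F v‖ ≤ M) {L : ℝ≥0} (hL : LipschitzWith L F) :
    ∀ t ∈ Icc 0 T, ‖u₁ t - u₂ t‖ ^ 2 ≤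
      ‖u₁ 0 - u₂ 0‖ ^ 2 * Real.exp (2 * interpConst L γ * t) := by
  refine le_mul_exp_of_le_add_integral (mul_nonneg zero_le_two (interpConst_nonneg L.2 γ))
    ((h₁.continuousOn.sub h₂.continuousOn).norm.pow 2) fun t ht => ?_
  -- With `m = 0` the dissipation term is empty, which leaves the hypothesis of Gronwall's
  -- inequality.
  simpa using h₁.sub_energy_le hγ h₂ hM hL le_rfl ht.1 ht.2 0

theorem eqOn (hγ : 0 ≤ γ) (h₁ : A.IsMild γ F g T u₁) (h₂ : A.IsMild γ F g T u₂)
    (hM : ∀ v, ‖F v‖ ≤ M) {L : ℝ≥0} (hL : LipschitzWith L F) (h0 : u₁ 0 = u₂ 0) :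
    ∀ t ∈ Icc 0 T, u₁ t = u₂ t := fun t ht => by
  have h := h₁.norm_sub_sq_le hγ h₂ hM hL t ht
  rw [h0, sub_self, norm_zero, zero_pow two_ne_zero, zero_mul] at h
  have h2 := le_antisymm h (sq_nonneg _)
  exact sub_eq_zero.1 (norm_eq_zero.1 (pow_eq_zero_iff two_ne_zero |>.1 h2))

theorem lipschitz_bound (hγ : 0 ≤ γ) (h₁ : A.IsMild γ F g T u₁) (h₂ : A.IsMild γ F g T u₂)
    (hM : ∀ v, ‖F v‖ ≤ M) {L : ℝ≥0} (hL : LipschitzWith L F) {t : ℝ} (ht : 0 ≤ t)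
    (htT : t + 1 ≤ T) :
    ‖u₁ t - u₂ t‖ ^ 2 + (∫ τ in t..(t + 1), ‖A.toSob 1 (coeff (u₁ τ - u₂ τ))‖ ^ 2) ≤
      (2 + 2 * interpConst L γ * Real.exp (2 * interpConst L γ)) * ‖u₁ 0 - u₂ 0‖ ^ 2 *
        Real.exp (2 * interpConst L γ * t) := by
  have hsub : Icc t (t + 1) ⊆ Icc 0 T := Icc_subset_Icc ht htT
  set κ := 2 * interpConst L γ with hκ
  have hκ0 : 0 ≤ κ := mul_nonneg zero_le_two (interpConst_nonneg L.2 γ)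
  set y₀ := ‖u₁ 0 - u₂ 0‖ ^ 2 with hy₀
  have hy₀0 : 0 ≤ y₀ := sq_nonneg _
  have hb := h₁.norm_sub_sq_le hγ h₂ hM hL
  have hbt := hb t ⟨ht, by linarith⟩
  -- The energy inequality on `[t, t+1]`, with both the energy at `t` and its integral estimated by
  -- Gronwall's bound.
  set B := y₀ * Real.exp (κ * t) + κ * (y₀ * Real.exp (κ * (t + 1))) with hB
  have hB0 : 0 ≤ B := by positivity
  have hint : ∫ τ in t..(t + 1), ‖A.toSob 1 (coeff (u₁ τ - u₂ τ))‖ ^ 2 ≤ B := by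
    rw [intervalIntegral.integral_of_le (by linarith)]
    refine integral_le_of_lintegral_le (fun _ => sq_nonneg _) hB0 ?_
    simp only [norm_sq_toSob_eq_tsum, Real.rpow_one]
    refine lintegral_tsum_le (by linarith) (fun n => ?_) (fun n r =>
      mul_nonneg (A.eigenvalue_pos n).le (sq_nonneg _)) fun N => ?_
    · refine ContinuousOn.intervalIntegrable ?_
      rw [uIcc_of_le (by linarith)]
      simp only [map_sub, Pi.sub_apply]
      exact continuousOn_const.mul
        ((((h₁.continuousOn_coeff n).sub (h₂.continuousOn_coeff n)).mono hsub).pow 2)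
    · have h3 := h₁.sub_energy_le hγ h₂ hM hL ht (by linarith : t ≤ t + 1) htT N
      have h4 : ∫ r in t..(t + 1), ‖u₁ r - u₂ r‖ ^ 2 ≤ y₀ * Real.exp (κ * (t + 1)) := by
        have hc : IntervalIntegrable (fun r => ‖u₁ r - u₂ r‖ ^ 2) volume t (t + 1) := by
          refine ContinuousOn.intervalIntegrable ?_
          rw [uIcc_of_le (by linarith)]
          exact ((h₁.continuousOn.sub h₂.continuousOn).mono hsub).norm.pow 2
        have := intervalIntegral.integral_mono_on (by linarith) hc
          (intervalIntegrable_const (c := y₀ * Real.exp (κ * (t + 1)))) fun r hr =>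
            (hb r (hsub hr)).trans (mul_le_mul_of_nonneg_left
              (Real.exp_le_exp.2 (mul_le_mul_of_nonneg_left hr.2 hκ0)) hy₀0)
        simpa using this
      have h5 := mul_le_mul_of_nonneg_left h4 hκ0
      linarith [sq_nonneg ‖u₁ (t + 1) - u₂ (t + 1)‖]
  have e : Real.exp (κ * (t + 1)) = Real.exp κ * Real.exp (κ * t) := by
    rw [← Real.exp_add]; congr 1; ring
  rw [hB, e] at hint
  linarith

end IsMild

end PosSelfAdjOp

/-! ### Existence of mild solutions -/

/-- Reversing time turns the weighted kernel into `∫ τ^(-θ) exp(-κτ)`, at most `κ^(-(1-θ)) Γ(1-θ)`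
uniformly in `t`. This tends to `0` as `κ → ∞`, so one `κ` serves all times and no continuation
argument is needed. -/
theorem exists_weight (L : ℝ) {θ : ℝ} (hθ : θ < 1) : ∃ κ : ℝ, 0 < κ ∧ ∀ t : ℝ, 0 < t →
    IntervalIntegrable (fun s => (t - s) ^ (-θ) * Real.exp (κ * s)) volume 0 t ∧
    L * (Real.exp (-κ * t) * ∫ s in (0)..t, (t - s) ^ (-θ) * Real.exp (κ * s)) ≤ 1 / 2 := by
  have hlim : Tendsto (fun κ : ℝ => |L| * (κ ^ (-(1 - θ)) * Real.Gamma (1 - θ))) atTop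
      (𝓝 (|L| * (0 * Real.Gamma (1 - θ)))) :=
    ((tendsto_rpow_neg_atTop (by linarith)).mul_const _).const_mul _
  rw [zero_mul, mul_zero] at hlim
  obtain ⟨κ, hκ0, hκ⟩ := ((eventually_gt_atTop 0).and
    (hlim.eventually (ge_mem_nhds (by norm_num : (0 : ℝ) < 1 / 2)))).exists
  refine ⟨κ, hκ0, fun t ht => ⟨(intervalIntegrable_sub_rpow (by linarith) 0 t).mul_continuousOn
    (by fun_prop), ?_⟩⟩
  have e1 : Real.exp (-κ * t) * ∫ s in (0)..t, (t - s) ^ (-θ) * Real.exp (κ * s) =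
      ∫ τ in (0)..t, τ ^ (-θ) * Real.exp (-(κ * τ)) := by
    rw [← intervalIntegral.integral_const_mul]
    have := intervalIntegral.integral_comp_sub_left (a := 0) (b := t)
      (fun τ => τ ^ (-θ) * Real.exp (-(κ * τ))) t
    rw [sub_self, sub_zero] at this
    rw [← this]
    refine intervalIntegral.integral_congr fun s _ => ?_
    rw [mul_left_comm, ← Real.exp_add]
    congr 2
    ring
  have hi : IntegrableOn (fun τ : ℝ => τ ^ (-θ) * Real.exp (-(κ * τ))) (Ioi 0) := by
    have := integrableOn_rpow_mul_exp_neg_mul_rpow (p := 1) (s := -θ) (b := κ)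
      (by linarith) one_pos hκ0
    simpa only [Real.rpow_one, neg_mul] using this
  have e2 : ∫ τ in (0)..t, τ ^ (-θ) * Real.exp (-(κ * τ)) ≤
      κ ^ (-(1 - θ)) * Real.Gamma (1 - θ) := by
    have h1 := Real.integral_rpow_mul_exp_neg_mul_Ioi (a := 1 - θ) (by linarith) hκ0
    rw [show 1 - θ - 1 = -θ by ring, one_div, Real.inv_rpow hκ0.le, ← Real.rpow_neg hκ0.le] at h1
    rw [intervalIntegral.integral_of_le ht.le, ← h1]
    refine setIntegral_mono_set hi ?_ (Ioc_subset_Ioi_self).eventuallyLE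
    exact (ae_restrict_iff' measurableSet_Ioi).2 (ae_of_all _ fun τ hτ =>
      mul_nonneg (Real.rpow_nonneg (le_of_lt hτ) _) (Real.exp_pos _).le)
  have e3 : 0 ≤ ∫ τ in (0)..t, τ ^ (-θ) * Real.exp (-(κ * τ)) :=
    intervalIntegral.integral_nonneg ht.le fun τ hτ =>
      mul_nonneg (Real.rpow_nonneg hτ.1 _) (Real.exp_pos _).le
  rw [e1]
  exact (mul_le_mul (le_abs_self L) e2 e3 (abs_nonneg L)).trans hκ

namespace PosSelfAdjOp

variable {H : Type u} [NormedAddCommGroup H] [InnerProductSpace ℝ H] [CompleteSpace H]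
  {A : PosSelfAdjOp H}

theorem memSob_duhamel {γ T G : ℝ} (hγ : 0 ≤ γ) {h : ℝ → ℕ → ℝ} (hh : BoundedForcing T G h)
    (x : A.Sob (-γ)) {t : ℝ} (ht : t ∈ Icc 0 T) :
    A.MemSob (-γ) (duhamel (A.rate γ) (γ / (1 + γ)) (coeff x) h t) := by
  rcases ht.1.eq_or_lt with rfl | h0
  · convert memSob_coeff x using 1
    funext n
    simp [duhamel]
  · refine MemSob.mono (s := 0) (by linarith) (memSob_zero_iff.2 ?_)
    exact (hh.duhamel_bound (rate_pos (A := A) γ) (theta_nonneg hγ)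
      (theta_lt_one hγ) h0 ht.2 (l2Bound_rate hγ x)).summable

/-- For the data, dominated convergence in the Fourier series, as each `exp(-μt)` tends to `1`; no
rate is available. The Duhamel term is of order `t^(1-θ/2)` in `H^{-γ}`. -/
theorem tendsto_toSob_duhamel_zero {γ T G : ℝ} (hγ : 0 ≤ γ) {h : ℝ → ℕ → ℝ}
    (hh : BoundedForcing T G h) (x : A.Sob (-γ)) :
    Tendsto (fun t => A.toSob (-γ) (duhamel (A.rate γ) (γ / (1 + γ)) (coeff x) h t))
      (𝓝[Icc 0 T] 0) (𝓝 x) := by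
  have hθ0 := theta_nonneg hγ
  have hθ1 := theta_lt_one hγ
  set θ := γ / (1 + γ) with hθ
  have b0 := l2Bound_rate hγ x
  have hm : ∀ t, 0 ≤ t → ∀ n, |Real.exp (-A.rate γ n * t) - 1| ≤ 1 := fun t ht n => by
    have h2 : Real.exp (-A.rate γ n * t) ≤ 1 :=
      Real.exp_le_one_iff.2 (by nlinarith [rate_pos (A := A) γ n])
    have := Real.exp_pos (-A.rate γ n * t)
    rw [abs_le]; constructor <;> linarith
  set S : ℝ → ℝ := fun t => ∑' n, ((Real.exp (-A.rate γ n * t) - 1) *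
    (A.rate γ n ^ (-(θ / 2)) * coeff x n)) ^ 2 with hS
  have hSlim : Tendsto S (𝓝[Icc 0 T] 0) (𝓝 0) := by
    have := tendsto_tsum_of_dominated_convergence (𝓕 := 𝓝[Icc 0 T] (0 : ℝ))
      (f := fun t n => ((Real.exp (-A.rate γ n * t) - 1) *
        (A.rate γ n ^ (-(θ / 2)) * coeff x n)) ^ 2) (g := fun _ => (0 : ℝ)) b0.summable
      (fun n => by
        have : Continuous fun t : ℝ => ((Real.exp (-A.rate γ n * t) - 1) *
          (A.rate γ n ^ (-(θ / 2)) * coeff x n)) ^ 2 := by fun_prop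
        have := (this.tendsto 0).mono_left (nhdsWithin_le_nhds (s := Icc 0 T))
        simpa using this)
      (by
        filter_upwards [self_mem_nhdsWithin] with t ht n
        rw [Real.norm_eq_abs, abs_of_nonneg (sq_nonneg _), mul_pow]
        refine mul_le_of_le_one_left (sq_nonneg _) ?_
        rw [← sq_abs]
        exact pow_le_one₀ (abs_nonneg _) (hm t ht.1 n))
    rwa [tsum_zero] at this
  rw [tendsto_iff_norm_sub_tendsto_zero]
  have hlim : Tendsto (fun t => √(S t) + t ^ (1 - θ / 2) / (1 - θ / 2) * G) (𝓝[Icc 0 T] 0)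
      (𝓝 0) := by
    have h1 : Tendsto (fun t : ℝ => t ^ (1 - θ / 2) / (1 - θ / 2) * G) (𝓝[Icc 0 T] 0)
        (𝓝 ((0 : ℝ) ^ (1 - θ / 2) / (1 - θ / 2) * G)) :=
      (((continuous_id.continuousAt.rpow_const (Or.inr (by linarith))).div_const _).mul_const
        _).tendsto.mono_left nhdsWithin_le_nhds
    have := hSlim.sqrt.add h1
    rwa [Real.sqrt_zero, Real.zero_rpow (by linarith), zero_div, zero_mul, zero_add] at this
  refine squeeze_zero' (Eventually.of_forall fun _ => norm_nonneg _) ?_ hlim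
  filter_upwards [self_mem_nhdsWithin] with t ht
  refine norm_le_of_l2Bound _ ?_
  have b1 : L2Bound (fun n => (Real.exp (-A.rate γ n * t) - 1) *
      (A.rate γ n ^ (-(θ / 2)) * coeff x n)) √(S t) :=
    L2Bound.of_tsum (b0.mul zero_le_one (hm t ht.1)).summable (Real.sqrt_nonneg _)
      (Real.sq_sqrt (tsum_nonneg fun _ => sq_nonneg _)).ge
  have b2 := hh.duhamel_integral_bound (rate_pos (A := A) γ) hθ1 (p := θ / 2) ht.1 ht.2
    (by linarith) (by linarith)
  rw [show 1 - (θ - θ / 2) = 1 - θ / 2 by ring] at b2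
  convert b1.add b2 using 2 with n
  rw [map_sub, Pi.sub_apply, coeff_toSob (memSob_duhamel hγ hh x ht),
    ← rate_rpow_neg_half_theta hγ, ← hθ, duhamel]
  ring

theorem continuousOn_toSob_duhamel {γ T G : ℝ} (hγ : 0 ≤ γ) {h : ℝ → ℕ → ℝ}
    (hh : BoundedForcing T G h) (x : A.Sob (-γ)) :
    ContinuousOn (fun t => A.toSob (-γ) (duhamel (A.rate γ) (γ / (1 + γ)) (coeff x) h t))
      (Icc 0 T) := by
  have hIoc : ContinuousOn
      (fun t => A.toSob (-γ) (duhamel (A.rate γ) (γ / (1 + γ)) (coeff x) h t)) (Ioc 0 T) := by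
    refine continuousOn_Ioc_of_holder (holderExp_pos hγ) fun ε hε => ?_
    obtain ⟨K, hK⟩ := hh.holder_bound_local (rate_pos (A := A) γ) (theta_nonneg hγ)
      (theta_lt_one hγ) (holderExp_pos hγ) (two_mul_holderExp hγ) (l2Bound_rate hγ x) hε
    refine ⟨A.eigenvalue 0 ^ (-γ / 2 - 0) * K, fun s t hs hst ht => ?_⟩
    rw [mul_left_comm]
    refine norm_le_of_l2Bound _ (l2Bound_weight_mono (by linarith) ?_)
    simp only [Real.rpow_zero, one_mul, map_sub, Pi.sub_apply]
    rw [coeff_toSob (memSob_duhamel hγ hh x ⟨by linarith, ht⟩),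
      coeff_toSob (memSob_duhamel hγ hh x ⟨by linarith, by linarith⟩)]
    exact hK s t hs hst ht
  intro t ht
  rcases ht.1.eq_or_lt with rfl | h0
  · have h1 := tendsto_toSob_duhamel_zero hγ hh x
    have h2 : duhamel (A.rate γ) (γ / (1 + γ)) (coeff x) h 0 = coeff x := by
      funext n; simp [duhamel]
    rw [ContinuousWithinAt, h2, toSob_coeff]
    exact h1
  · refine (hIoc t ⟨h0, ht.2⟩).mono_of_mem_nhdsWithin ?_
    have : Icc 0 T ∩ Ioi 0 ⊆ Ioc 0 T := fun r hr => ⟨hr.2, hr.1.2⟩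
    exact mem_of_superset (inter_mem self_mem_nhdsWithin (nhdsWithin_le_nhds (Ioi_mem_nhds h0)))
      this

open Classical in
/-- The coefficients of the function `exp (κ s) k(s)`, extended by zero to `s ≤ 0`. -/
noncomputable def weightedCoeff (A : PosSelfAdjOp H) (κ : ℝ)
    (k : BoundedContinuousFunction (Ioi (0 : ℝ)) H) (s : ℝ) (n : ℕ) : ℝ :=
  if hs : 0 < s then Real.exp (κ * s) * A.eigenbasis.repr (k ⟨s, hs⟩) n else 0

theorem weightedCoeff_of_pos (κ : ℝ) (k : BoundedContinuousFunction (Ioi (0 : ℝ)) H) {s : ℝ}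
    (hs : 0 < s) (n : ℕ) :
    A.weightedCoeff κ k s n = Real.exp (κ * s) * A.eigenbasis.repr (k ⟨s, hs⟩) n := dif_pos hs

theorem l2Bound_weightedCoeff (κ : ℝ) (k : BoundedContinuousFunction (Ioi (0 : ℝ)) H) {s : ℝ}
    (hs : 0 < s) : L2Bound (A.weightedCoeff κ k s) (Real.exp (κ * s) * ‖k‖) := by
  have := ((l2Bound_repr (A := A) (k ⟨s, hs⟩)).mono (k.norm_coe_le_norm _)).mul
    (m := fun _ => Real.exp (κ * s)) (Real.exp_pos _).le fun _ => (abs_of_pos (Real.exp_pos _)).le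
  simpa only [← weightedCoeff_of_pos κ k hs] using this

theorem boundedForcing_weightedCoeff {κ : ℝ} (hκ : 0 ≤ κ)
    (k : BoundedContinuousFunction (Ioi (0 : ℝ)) H) (T : ℝ) :
    BoundedForcing T (Real.exp (κ * T) * ‖k‖) (A.weightedCoeff κ k) where
  meas n := by
    have : ContinuousOn (fun s => A.weightedCoeff κ k s n) (Ioi 0) := by
      rw [continuousOn_iff_continuous_domRestrict]
      have h1 : Continuous fun s : Ioi (0 : ℝ) =>
          Real.exp (κ * s) * ⟪A.eigenbasis n, k s⟫_ℝ := by fun_prop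
      refine h1.congr fun s => ?_
      rw [domRestrict_apply, weightedCoeff_of_pos κ k s.2, HilbertBasis.repr_apply_apply]
    exact (this.mono Ioc_subset_Ioi_self).aestronglyMeasurable measurableSet_Ioc
  bound s hs := (l2Bound_weightedCoeff κ k hs.1).mono (by
    have := hs.2
    gcongr)

/-- The map whose fixed point gives the forcing term of the solution. -/
noncomputable def forcingMap (A : PosSelfAdjOp H) {γ : ℝ} (hγ : 0 ≤ γ) {F : H → H} {M : ℝ}
    (hM : ∀ v, ‖F v‖ ≤ M) (hF : Continuous F) (g : H) (x : A.Sob (-γ)) {κ : ℝ} (hκ : 0 ≤ κ)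
    (k : BoundedContinuousFunction (Ioi (0 : ℝ)) H) : BoundedContinuousFunction (Ioi (0 : ℝ)) H :=
  BoundedContinuousFunction.ofNormedAddCommGroup
    (fun t : Ioi (0 : ℝ) => Real.exp (-κ * t) • (g - F (A.toH
      (duhamel (A.rate γ) (γ / (1 + γ)) (coeff x) (A.weightedCoeff κ k) t))))
    (by
      have : ContinuousOn (fun t => A.toH
          (duhamel (A.rate γ) (γ / (1 + γ)) (coeff x) (A.weightedCoeff κ k) t)) (Ioi 0) := by
        intro t ht
        -- The forcing is bounded only on bounded intervals, because of `exp(κs)`; continuity at `t`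
        -- uses the horizon `t + 1`.
        refine (continuousOn_toH_duhamel hγ (boundedForcing_weightedCoeff hκ k (t + 1)) x t
          ⟨ht, by linarith⟩).mono_of_mem_nhdsWithin ?_
        have : Ioi 0 ∩ Iio (t + 1) ⊆ Ioc 0 (t + 1) := fun r hr => ⟨hr.1, le_of_lt hr.2⟩
        exact mem_of_superset (inter_mem self_mem_nhdsWithin
          (nhdsWithin_le_nhds (Iio_mem_nhds (by linarith)))) this
      have h1 := hF.comp (continuousOn_iff_continuous_domRestrict.1 this)
      refine Continuous.smul (by fun_prop) (continuous_const.sub h1))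
    (‖g‖ + M) fun t => by
      rw [norm_smul, Real.norm_eq_abs, abs_of_pos (Real.exp_pos _)]
      have h1 : Real.exp (-κ * (t : ℝ)) ≤ 1 :=
        Real.exp_le_one_iff.2 (by nlinarith [mul_nonneg hκ (le_of_lt t.2)])
      have h2 := norm_sub_le g (F (A.toH
        (duhamel (A.rate γ) (γ / (1 + γ)) (coeff x) (A.weightedCoeff κ k) t)))
      calc _ ≤ 1 * ‖g - F (A.toH
            (duhamel (A.rate γ) (γ / (1 + γ)) (coeff x) (A.weightedCoeff κ k) t))‖ := by gcongr
        _ ≤ ‖g‖ + M := by rw [one_mul]; exact h2.trans (by gcongr; exact hM _)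

theorem l2Bound_duhamel_sub {γ : ℝ} (hγ : 0 ≤ γ) (x : A.Sob (-γ)) {κ : ℝ} (hκ : 0 ≤ κ)
    (k₁ k₂ : BoundedContinuousFunction (Ioi (0 : ℝ)) H) {t : ℝ} (ht : 0 < t)
    (hi : IntervalIntegrable (fun s => (t - s) ^ (-(γ / (1 + γ))) * Real.exp (κ * s))
      volume 0 t) :
    L2Bound (fun n => duhamel (A.rate γ) (γ / (1 + γ)) (coeff x) (A.weightedCoeff κ k₁) t n -
      duhamel (A.rate γ) (γ / (1 + γ)) (coeff x) (A.weightedCoeff κ k₂) t n)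
      ((∫ s in (0)..t, (t - s) ^ (-(γ / (1 + γ))) * Real.exp (κ * s)) * ‖k₁ - k₂‖) := by
  have f₁ := boundedForcing_weightedCoeff (A := A) hκ k₁ t
  have f₂ := boundedForcing_weightedCoeff (A := A) hκ k₂ t
  rw [← intervalIntegral.integral_mul_const]
  have hk : ∀ n, Continuous fun s => A.rate γ n ^ (γ / (1 + γ)) *
    Real.exp (-A.rate γ n * (t - s)) := fun n => by fun_prop
  have h := L2Bound.intervalIntegral (f := fun s n => A.rate γ n ^ (γ / (1 + γ)) *
      Real.exp (-A.rate γ n * (t - s)) * (A.weightedCoeff κ (k₁ - k₂) s n)) ht.le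
    (fun n => (boundedForcing_weightedCoeff (A := A) hκ (k₁ - k₂) t).meas_kernel (hk n) n le_rfl
      le_rfl) (hi.mul_const ‖k₁ - k₂‖) (fun s hs => by
      have := (l2Bound_weightedCoeff (A := A) κ (k₁ - k₂) hs.1).mul
        (m := fun n => A.rate γ n ^ (γ / (1 + γ)) * Real.exp (-A.rate γ n * (t - s)))
        (Real.rpow_nonneg (sub_pos.2 hs.2).le _)
        (BoundedForcing.kernel_bound (rate_pos γ) (theta_nonneg hγ) (theta_lt_one hγ)
          (sub_pos.2 hs.2))
      rwa [← mul_assoc] at this)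
  convert h using 2 with n
  rw [duhamel, duhamel, add_sub_add_left_eq_sub, ← intervalIntegral.integral_sub
    ((f₁.intervalIntegrable n le_rfl ht.le le_rfl).continuousOn_mul (hk n).continuousOn)
    ((f₂.intervalIntegrable n le_rfl ht.le le_rfl).continuousOn_mul (hk n).continuousOn)]
  refine intervalIntegral.integral_congr_ae (ae_of_all _ fun s hs => ?_)
  rw [uIoc_of_le ht.le] at hs
  rw [weightedCoeff_of_pos _ _ hs.1, weightedCoeff_of_pos _ _ hs.1, weightedCoeff_of_pos _ _ hs.1]
  simp only [BoundedContinuousFunction.coe_sub, Pi.sub_apply, map_sub, lp.coeFn_sub]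
  ring

/-- Banach's fixed point theorem for `k(t) = exp(-κt)(g - F(u(t)))` in bounded continuous functions
on `(0,∞)`. The half line is open at `0` because `u` need not have a limit in `H` there. -/
theorem exists_forcing {γ : ℝ} (hγ : 0 ≤ γ) {F : H → H} {M : ℝ} (hM : ∀ v, ‖F v‖ ≤ M) {L : ℝ≥0}
    (hL : LipschitzWith L F) (g : H) (x : A.Sob (-γ)) :
    ∃ κ : ℝ, 0 ≤ κ ∧ ∃ k : BoundedContinuousFunction (Ioi (0 : ℝ)) H, ∀ t, 0 < t → ∀ n,
      A.weightedCoeff κ k t n = A.eigenbasis.repr (g - F (A.toH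
        (duhamel (A.rate γ) (γ / (1 + γ)) (coeff x) (A.weightedCoeff κ k) t))) n := by
  obtain ⟨κ, hκ0, hκ⟩ := exists_weight L (theta_lt_one hγ)
  have hcontr : ContractingWith (1 / 2) (A.forcingMap hγ hM hL.continuous g x hκ0.le) := by
    refine ⟨by
      rw [← NNReal.coe_lt_coe]; norm_num, LipschitzWith.of_dist_le_mul fun k₁ k₂ => ?_⟩
    rw [BoundedContinuousFunction.dist_le (by positivity)]
    intro t
    obtain ⟨hi, hle⟩ := hκ t t.2
    have b := l2Bound_duhamel_sub (A := A) hγ x hκ0.le k₁ k₂ t.2 hi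
    have m : ∀ k, Memℓp (duhamel (A.rate γ) (γ / (1 + γ)) (coeff x) (A.weightedCoeff κ k) t) 2 :=
      fun k => memℓp_two_of_summable ((boundedForcing_weightedCoeff hκ0.le k t).duhamel_bound
        (rate_pos (A := A) γ) (theta_nonneg hγ) (theta_lt_one hγ) t.2 le_rfl
        (l2Bound_rate hγ x)).summable
    have b2 := norm_toH_sub_le (A := A) (m k₁) (m k₂) b
    have b3 := hL.norm_sub_le
      (A.toH (duhamel (A.rate γ) (γ / (1 + γ)) (coeff x) (A.weightedCoeff κ k₁) t))
      (A.toH (duhamel (A.rate γ) (γ / (1 + γ)) (coeff x) (A.weightedCoeff κ k₂) t))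
    have b4 := b3.trans (mul_le_mul_of_nonneg_left b2 L.2)
    rw [dist_eq_norm, dist_eq_norm]
    change ‖Real.exp (-κ * t) • (g - F _) - Real.exp (-κ * t) • (g - F _)‖ ≤ _
    rw [← smul_sub, norm_smul, Real.norm_eq_abs, abs_of_pos (Real.exp_pos _),
      sub_sub_sub_cancel_left, norm_sub_rev]
    have b5 := mul_le_mul_of_nonneg_left b4 (Real.exp_pos (-κ * (t : ℝ))).le
    -- The choice of `κ` gives the contraction factor `1/2` at every `t`.
    have b6 := mul_le_mul_of_nonneg_right hle (norm_nonneg (k₁ - k₂))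
    push_cast
    refine b5.trans (le_trans (le_of_eq ?_) b6)
    ring
  refine ⟨κ, hκ0.le, ContractingWith.fixedPoint _ hcontr, fun t ht n => ?_⟩
  set k := ContractingWith.fixedPoint _ hcontr with hk
  have h1 : A.forcingMap hγ hM hL.continuous g x hκ0.le k = k := hcontr.fixedPoint_isFixedPt
  have h2 : k ⟨t, ht⟩ = Real.exp (-κ * t) • (g - F (A.toH
      (duhamel (A.rate γ) (γ / (1 + γ)) (coeff x) (A.weightedCoeff κ k) t))) := by
    nth_rewrite 1 [← h1]
    rfl
  rw [weightedCoeff_of_pos κ k ht, h2, map_smul, lp.coeFn_smul, Pi.smul_apply, smul_eq_mul,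
    ← mul_assoc, ← Real.exp_add]
  simp

theorem exists_isMild {γ : ℝ} (hγ : 0 ≤ γ) {F : H → H} {M : ℝ} (hM : ∀ v, ‖F v‖ ≤ M) {L : ℝ≥0}
    (hL : LipschitzWith L F) (g : H) (x : A.Sob (-γ)) :
    ∃ u : ℝ → A.Sob (-γ), u 0 = x ∧ ∀ T, A.IsMild γ F g T u := by
  obtain ⟨κ, hκ, k, hk⟩ := exists_forcing (A := A) hγ hM hL g x
  have hh := boundedForcing_weightedCoeff (A := A) hκ k
  set c : ℝ → ℕ → ℝ := duhamel (A.rate γ) (γ / (1 + γ)) (coeff x) (A.weightedCoeff κ k) with hc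
  have hmem : ∀ t, 0 ≤ t → A.MemSob (-γ) (c t) := fun t ht =>
    memSob_duhamel hγ (hh t) x ⟨ht, le_rfl⟩
  have hcoeff : ∀ t, 0 ≤ t → coeff (A.toSob (-γ) (c t)) = c t := fun t ht => coeff_toSob (hmem t ht)
  have h0 : A.toSob (-γ) (c 0) = x := by
    have : c 0 = coeff x := by funext n; simp [hc, duhamel]
    rw [this, toSob_coeff]
  refine ⟨fun t => A.toSob (-γ) (c t), h0, fun T =>
    ⟨continuousOn_toSob_duhamel hγ (hh T) x, fun t ht => ?_, fun t ht => ?_⟩⟩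
  · rw [hcoeff t ht.1.le]
    exact memℓp_two_of_summable ((hh T).duhamel_bound (rate_pos (A := A) γ) (theta_nonneg hγ)
      (theta_lt_one hγ) ht.1 ht.2 (l2Bound_rate hγ x)).summable
  · rw [hcoeff t ht.1, h0]
    funext n
    simp only [hc, duhamel]
    congr 1
    refine intervalIntegral.integral_congr_ae (ae_of_all _ fun s hs => ?_)
    rw [uIoc_of_le ht.1] at hs
    rw [forcing, hk s hs.1, hcoeff s hs.1.le]

end PosSelfAdjOp

/-! ### Constants uniform in time, initial data and `g` -/

namespace PosSelfAdjOp

variable {H : Type u} [NormedAddCommGroup H] [InnerProductSpace ℝ H] [CompleteSpace H]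
  {A : PosSelfAdjOp H} {γ : ℝ} {F : H → H} {M : ℝ}

theorem add_sq_le_mul_one_add_sq (x M : ℝ) : (x + M) ^ 2 ≤ 2 * (1 + M ^ 2) * (1 + x ^ 2) := by
  nlinarith [sq_nonneg (x - M), mul_nonneg (sq_nonneg x) (sq_nonneg M)]

/-- The dissipative estimate in `H^{-γ}`. -/
theorem exists_dissipative_const (A : PosSelfAdjOp H) (hγ : 0 ≤ γ) (hM : ∀ v, ‖F v‖ ≤ M)
    (hF : Continuous F) :
    ∃ C : ℝ, 0 < C ∧ ∀ (g : H) (u : ℝ → A.Sob (-γ)) (t : ℝ), 0 ≤ t → A.IsMild γ F g (t + 1) u →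
      ‖u t‖ ^ 2 + (∫ τ in t..(t + 1), ‖A.toSob 1 (coeff (u τ))‖ ^ 2) ≤
        C * Real.exp (-A.decayRate γ * t) * ‖u 0‖ ^ 2 + C * (1 + ‖g‖ ^ 2) := by
  have h0 := A.eigenvalue_pos 0
  have hα := decayRate_pos (A := A) γ
  -- The bound for `‖u t‖²` is used twice, once for itself and once as initial energy on `[t, t+1]`;
  -- hence the factors `2` here and in the constant.
  set c := 2 / (A.eigenvalue 0 * A.decayRate γ) + 1 / A.eigenvalue 0 with hc
  have hc0 : 0 ≤ c := by positivity
  refine ⟨2 + c * (2 * (1 + M ^ 2)), by positivity, fun g u t ht hu => ?_⟩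
  have h1 := hu.norm_sq_le hγ hM hF (t := t) ⟨ht, by linarith⟩
  have h2 := hu.integral_norm_sq_le hγ hM hF ht (by linarith : t ≤ t + 1) le_rfl
  rw [add_sub_cancel_left, one_mul] at h2
  have h3 := mul_le_mul_of_nonneg_left (add_sq_le_mul_one_add_sq ‖g‖ M) hc0
  have h4 : c * (‖g‖ + M) ^ 2 = 2 * ((‖g‖ + M) ^ 2 / (A.eigenvalue 0 * A.decayRate γ)) +
      (‖g‖ + M) ^ 2 / A.eigenvalue 0 := by rw [hc]; ring
  have h5 : 0 ≤ c * (2 * (1 + M ^ 2)) * (Real.exp (-A.decayRate γ * t) * ‖u 0‖ ^ 2) := by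
    positivity
  have h6 : 0 ≤ 1 + ‖g‖ ^ 2 := by positivity
  linarith

/-- The smoothing estimate. -/
theorem exists_smoothing_const (A : PosSelfAdjOp H) (hγ : 0 ≤ γ) (hM : ∀ v, ‖F v‖ ≤ M) {L : ℝ≥0}
    (hL : LipschitzWith L F) :
    ∃ C : ℝ, 0 < C ∧ ∀ (g : H) (u : ℝ → A.Sob (-γ)) (t : ℝ), 0 < t → t ≤ 1 → A.IsMild γ F g t u →
      L2Bound (fun n => A.eigenvalue n ^ ((2 : ℝ) / 2) * coeff (u t) n)
        (C * t⁻¹ * (‖u 0‖ + ‖g‖ + 1)) := by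
  have hδ := holderExp_pos hγ
  have hM0 : 0 ≤ M := (norm_nonneg _).trans (hM 0)
  set c₁ : ℝ := 1 + L * (4 + 2 / holderExp γ) with hc₁
  set c₂ : ℝ := 1 + L * (2 / holderExp γ ^ 2) with hc₂
  have h₁ : 0 < c₁ := by positivity
  have h₂ : 0 < c₂ := by positivity
  refine ⟨c₁ + c₂ * (1 + M), by positivity, fun g u t ht ht1 hu => ?_⟩
  refine (hu.smooth_bound hγ hM hL ht ht1 le_rfl).mono ?_
  rw [mul_comm (c₁ + c₂ * (1 + M)), mul_assoc]
  refine mul_le_mul_of_nonneg_left ?_ (inv_nonneg.2 ht.le)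
  rw [← hc₁, ← hc₂, ← sub_nonneg]
  have : (c₁ + c₂ * (1 + M)) * (‖u 0‖ + ‖g‖ + 1) - (c₁ * ‖u 0‖ + c₂ * (‖g‖ + M)) =
      c₁ * (‖g‖ + 1) + c₂ * (‖u 0‖ + 1) + c₂ * M * (‖u 0‖ + ‖g‖) := by ring
  rw [this]
  positivity

set_option maxHeartbeats 800000 in
/-- The dissipative estimate in `H²`. -/
theorem exists_dissipative_two_const (A : PosSelfAdjOp H) (hγ : 0 ≤ γ) (hM : ∀ v, ‖F v‖ ≤ M)
    {L : ℝ≥0} (hL : LipschitzWith L F) :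
    ∃ C : ℝ, 0 < C ∧ ∀ (g : H) (u : ℝ → A.Sob (-γ)) (t : ℝ), 0 ≤ t → A.IsMild γ F g t u →
      A.MemSob 2 (coeff (u 0)) → A.MemSob 2 (coeff (u t)) ∧
      ‖A.toSob 2 (coeff (u t))‖ ^ 2 ≤
        C * ‖A.toSob 2 (coeff (u 0))‖ ^ 2 * Real.exp (-A.decayRate γ * t) +
          C * (1 + ‖g‖ ^ 2) := by
  have h0 := A.eigenvalue_pos 0
  have hα := decayRate_pos (A := A) γ
  have hδ := holderExp_pos hγ
  have hM0 : 0 ≤ M := (norm_nonneg _).trans (hM 0)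
  set α := A.decayRate γ with hαdef
  set c₁ : ℝ := 1 + L * (4 + 2 / holderExp γ) with hc₁
  set c₂ : ℝ := 1 + L * (2 / holderExp γ ^ 2) with hc₂
  set c₃ : ℝ := 1 + L * (A.eigenvalue 0 ^ (-(1 / 2) : ℝ) * (2 + 1 / holderExp γ)) with hc₃
  set c₄ : ℝ := A.eigenvalue 0 ^ (-γ / 2 - 2 / 2) with hc₄
  -- The three summands serve `t = 0`, `0 < t ≤ 1` and `t ≥ 1`; `exp α` absorbs the delay of at most
  -- one unit of time in the decaying exponential.
  set a := (1 + 2 * c₃ ^ 2 + 2 * c₁ ^ 2 * c₄ ^ 2) * Real.exp α with ha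
  set b := (2 * c₁ ^ 2 / (A.eigenvalue 0 * α) + 2 * c₂ ^ 2) * (2 * (1 + M ^ 2)) with hb
  have ha0 : 0 < a := by positivity
  have hb0 : 0 ≤ b := by positivity
  clear_value a b c₄ c₃ c₂ c₁ α
  suffices h : ∀ (g : H) (u : ℝ → A.Sob (-γ)) (t : ℝ), 0 ≤ t → A.IsMild γ F g t u →
      A.MemSob 2 (coeff (u 0)) → ∃ B, L2Bound (fun n => A.eigenvalue n ^ ((2 : ℝ) / 2) *
        coeff (u t) n) B ∧ B ^ 2 ≤ a * Real.exp (-α * t) * ‖A.toSob 2 (coeff (u 0))‖ ^ 2 +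
          b * (1 + ‖g‖ ^ 2) by
    refine ⟨a + b, by positivity, fun g u t ht hu hu0 => ?_⟩
    obtain ⟨B, hB, hB2⟩ := h g u t ht hu hu0
    refine ⟨MemSob.of_l2Bound hB, ?_⟩
    have h1 := pow_le_pow_left₀ (norm_nonneg _) (norm_toSob_le hB) 2
    have h2 : 0 ≤ b * (Real.exp (-α * t) * ‖A.toSob 2 (coeff (u 0))‖ ^ 2) := by positivity
    have h3 : 0 ≤ a * (1 + ‖g‖ ^ 2) := by positivity
    linarith
  intro g u t ht hu hu0
  have hN := l2Bound_toSob hu0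
  set N := ‖A.toSob 2 (coeff (u 0))‖
  clear_value N
  have hG := add_sq_le_mul_one_add_sq ‖g‖ M
  set G := ‖g‖ + M with hGdef
  clear_value G
  have hN2 : 0 ≤ N ^ 2 := sq_nonneg N
  have hle : ∀ c, 0 ≤ c → c ≤ 1 + 2 * c₃ ^ 2 + 2 * c₁ ^ 2 * c₄ ^ 2 → ∀ r, t - 1 ≤ r →
      c * Real.exp (-α * r) * N ^ 2 ≤ a * Real.exp (-α * t) * N ^ 2 := fun c hc hca r hr => by
    rw [ha, mul_assoc _ (Real.exp α), ← Real.exp_add]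
    have : Real.exp (-α * r) ≤ Real.exp (α + -α * t) := Real.exp_le_exp.2 (by nlinarith)
    gcongr
  have hbG : ∀ c, 0 ≤ c → c ≤ 2 * c₁ ^ 2 / (A.eigenvalue 0 * α) + 2 * c₂ ^ 2 →
      c * G ^ 2 ≤ b * (1 + ‖g‖ ^ 2) := fun c hc hcb => by
    rw [hb, mul_assoc]
    gcongr
  have p₁ : 0 ≤ 2 * c₁ ^ 2 / (A.eigenvalue 0 * α) := by positivity
  have p₂ : 0 ≤ 2 * c₁ ^ 2 * c₄ ^ 2 := by positivity
  have sq_add_le : ∀ x y : ℝ, (x + y) ^ 2 ≤ 2 * x ^ 2 + 2 * y ^ 2 := fun x y => by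
    nlinarith [sq_nonneg (x - y)]
  -- Up to time `1` the data's own `H²` regularity is used. Afterwards, smoothing from `t - 1` to
  -- `t` reduces the claim to decay in `H^{-γ}`, where `c₄` bounds the `H^{-γ}` norm of the data by
  -- their `H²` norm.
  rcases le_total t 1 with ht1 | ht1
  · rcases ht.eq_or_lt with rfl | ht0
    · refine ⟨N, hN, ?_⟩
      have h1 := hle 1 zero_le_one (by nlinarith [sq_nonneg c₃]) 0 (by norm_num)
      have h2 : 0 ≤ b * (1 + ‖g‖ ^ 2) := by positivity
      rw [mul_zero, Real.exp_zero, one_mul, one_mul] at h1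
      rw [mul_zero, Real.exp_zero]
      linarith
    · refine ⟨_, hu.smooth_bound_of_memSob hγ hM hL ht0 ht1 le_rfl hN, ?_⟩
      rw [← hc₂, ← hc₃, ← hGdef]
      have h1 := sq_add_le (c₃ * N) (c₂ * G)
      have h2 := hle (2 * c₃ ^ 2) (by positivity) (by linarith) 0 (by linarith)
      have h3 := hbG (2 * c₂ ^ 2) (by positivity) (by linarith)
      rw [mul_zero, Real.exp_zero, mul_one] at h2
      linarith
  · have hsh := hu.shift hM hL.continuous (sub_nonneg.2 ht1)
    have h1 := hsh.smooth_bound hγ hM hL one_pos le_rfl (by linarith)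
    rw [sub_add_cancel, add_zero, ← hc₁, ← hc₂, ← hGdef, inv_one, one_mul] at h1
    refine ⟨_, h1, ?_⟩
    have h2 := hu.norm_sq_le hγ hM hL.continuous (t := t - 1) ⟨by linarith, by linarith⟩
    rw [← hGdef, ← hαdef] at h2
    have h3 : ‖u 0‖ ≤ c₄ * N := by
      rw [hc₄]
      exact norm_le_of_l2Bound _ (l2Bound_weight_mono (r := -γ / 2) (by linarith) hN)
    have h4 := pow_le_pow_left₀ (norm_nonneg _) h3 2
    have h5 := sq_add_le (c₁ * ‖u (t - 1)‖) (c₂ * G)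
    have h6 := hle (2 * c₁ ^ 2 * c₄ ^ 2) p₂ (le_add_of_nonneg_left (by positivity)) (t - 1) le_rfl
    have h7 := hbG _ (by positivity) le_rfl
    have h8 := mul_le_mul_of_nonneg_left h2 (by positivity : 0 ≤ 2 * c₁ ^ 2)
    have h9 := mul_le_mul_of_nonneg_left h4
      (by positivity : 0 ≤ 2 * c₁ ^ 2 * Real.exp (-α * (t - 1)))
    have h10 : (2 * c₁ ^ 2 / (A.eigenvalue 0 * α) + 2 * c₂ ^ 2) * G ^ 2 =
        2 * c₁ ^ 2 * (G ^ 2 / (A.eigenvalue 0 * α)) + 2 * c₂ ^ 2 * G ^ 2 := by ring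
    linarith

end PosSelfAdjOp

/-! ### Assembly of the solution operators and the estimates -/

theorem proposition1p1 (γ : ℝ) (hγ : 0 ≤ γ) (L : ℝ≥0) :
    -- the constants of the Lipschitz estimate depend only on `γ` and `L`
    ∃ C' > (0 : ℝ), ∃ Lγ > (0 : ℝ),
    ∀ (H : Type u) [NormedAddCommGroup H] [InnerProductSpace ℝ H] [CompleteSpace H]
      (A : PosSelfAdjOp H) (F : H → H),
      (∃ M : ℝ, ∀ v, ‖F v‖ ≤ M) → LipschitzWith L F →
    -- the other constants depend only on `γ`, `A` and `F`
    ∃ C > (0 : ℝ), ∃ α > (0 : ℝ), ∀ g : H,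
    ∃ S : ℝ → A.Sob (-γ) → A.Sob (-γ),
      -- global solvability, with `S(t) u₀` the solution that starts at `u₀`
      (∀ u₀, S 0 u₀ = u₀ ∧ A.IsGlobalSolution γ F g fun t => S t u₀) ∧
      -- uniqueness, on every time interval
      (∀ T : ℝ, 0 < T → ∀ u₁ u₂ : ℝ → A.Sob (-γ), A.IsSolution γ F g T u₁ →
        A.IsSolution γ F g T u₂ → u₁ 0 = u₂ 0 → ∀ t ∈ Icc 0 T, u₁ t = u₂ t) ∧
      -- semigroup property
      (∀ t s : ℝ, 0 ≤ t → 0 ≤ s → ∀ u₀, S (t + s) u₀ = S t (S s u₀)) ∧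
      -- dissipative estimate in `H^{-γ}`
      (∀ u₀, ∀ t : ℝ, 0 ≤ t →
        ‖S t u₀‖ ^ 2 + (∫ τ in t..(t + 1), ‖A.toSob 1 (PosSelfAdjOp.coeff (S τ u₀))‖ ^ 2)
          ≤ C * Real.exp (-α * t) * ‖u₀‖ ^ 2 + C * (1 + ‖g‖ ^ 2)) ∧
      -- global Lipschitz continuity in `H^{-γ}`
      (∀ u₁ u₂ : ℝ → A.Sob (-γ), A.IsGlobalSolution γ F g u₁ → A.IsGlobalSolution γ F g u₂ →
        ∀ t : ℝ, 0 ≤ t →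
        ‖u₁ t - u₂ t‖ ^ 2
            + (∫ τ in t..(t + 1), ‖A.toSob 1 (PosSelfAdjOp.coeff (u₁ τ - u₂ τ))‖ ^ 2)
          ≤ C' * ‖u₁ 0 - u₂ 0‖ ^ 2 * Real.exp (Lγ * t)) ∧
      -- instantaneous smoothing from `H^{-γ}` to `H²`
      (∀ u₀, ∀ t ∈ Ioc (0 : ℝ) 1, A.MemSob 2 (PosSelfAdjOp.coeff (S t u₀)) ∧
        ‖A.toSob 2 (PosSelfAdjOp.coeff (S t u₀))‖ ≤ C * t⁻¹ * (‖u₀‖ + ‖g‖ + 1)) ∧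
      -- dissipative estimate in `H²`
      (∀ u₀ : A.Sob (-γ), A.MemSob 2 (PosSelfAdjOp.coeff u₀) → ∀ t : ℝ, 0 ≤ t →
        A.MemSob 2 (PosSelfAdjOp.coeff (S t u₀)) ∧
        ‖A.toSob 2 (PosSelfAdjOp.coeff (S t u₀))‖ ^ 2
          ≤ C * ‖A.toSob 2 (PosSelfAdjOp.coeff u₀)‖ ^ 2 * Real.exp (-α * t)
            + C * (1 + ‖g‖ ^ 2)) := by
  have hK0 : 0 ≤ PosSelfAdjOp.interpConst L γ := PosSelfAdjOp.interpConst_nonneg L.2 γ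
  set K := PosSelfAdjOp.interpConst L γ with hK
  -- The added `1` keeps the growth rate strictly positive when the interpolation constant vanishes.
  refine ⟨2 + 2 * K * Real.exp (2 * K), by positivity, 2 * K + 1, by positivity, ?_⟩
  intro H _ _ _ A F ⟨M, hM⟩ hL
  obtain ⟨C₁, hC₁, h₁⟩ := A.exists_dissipative_const hγ hM hL.continuous
  obtain ⟨C₂, hC₂, h₂⟩ := A.exists_smoothing_const hγ hM hL
  obtain ⟨C₃, hC₃, h₃⟩ := A.exists_dissipative_two_const hγ hM hL
  refine ⟨C₁ + C₂ + C₃, by positivity, A.decayRate γ, PosSelfAdjOp.decayRate_pos γ, fun g => ?_⟩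
  choose S hS0 hS using fun x : A.Sob (-γ) => PosSelfAdjOp.exists_isMild hγ hM hL g x
  refine ⟨fun t x => S x t, fun x => ⟨hS0 x, fun T hT => (hS x T).isSolution hγ hT hM hL⟩,
    fun T hT u₁ u₂ hu₁ hu₂ h0 => (hu₁.isMild hγ hT hM hL.continuous).eqOn hγ
      (hu₂.isMild hγ hT hM hL.continuous) hM hL h0, fun t s ht hs x => ?_, fun x t ht => ?_,
    fun u₁ u₂ hu₁ hu₂ t ht => ?_, fun x t ht => ?_, fun x hx t ht => ?_⟩
  -- The solution shifted by `s` and the one started at its value at time `s` have the same initial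
  -- value, so they agree by uniqueness.
  · have hshift := (hS x (s + t)).shift hM hL.continuous hs
    rw [add_sub_cancel_left] at hshift
    have := hshift.eqOn hγ (hS (S x s) t) hM hL (by rw [add_zero, hS0]) t ⟨ht, le_rfl⟩
    rwa [add_comm s t] at this
  · have h := h₁ g (S x) t ht (hS x _)
    rw [hS0] at h
    refine h.trans ?_
    gcongr <;> linarith
  · have hT : 0 < t + 1 := by linarith
    refine ((hu₁ _ hT).isMild hγ hT hM hL.continuous).lipschitz_bound hγ
      ((hu₂ _ hT).isMild hγ hT hM hL.continuous) hM hL ht le_rfl |>.trans ?_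
    rw [← hK]
    gcongr
    linarith
  · have h := h₂ g (S x) t ht.1 ht.2 (hS x _)
    rw [hS0] at h
    refine ⟨PosSelfAdjOp.MemSob.of_l2Bound h, (PosSelfAdjOp.norm_toSob_le h).trans ?_⟩
    have := inv_nonneg.2 ht.1.le
    gcongr
    linarith
  · have h := h₃ g (S x) t ht (hS x _)
    rw [hS0] at h
    refine ⟨(h hx).1, (h hx).2.trans ?_⟩
    gcongr <;> linarith
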